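/- **Setting.** Let $\mathcal G$ be a finite collection of non-degenerate closed intervals contained in $I=[0,1]$ with pairwise disjoint interiors, such that $0$ and $1$ belong to two different elements $\Delta_0,\Delta_1$ of $\mathcal G$; put $I_*=\bigcup_{\Delta\in\mathcal G}\Delta$. Let $\mathcal G=\mathcal G_C\sqcup\mathcal G_E$, let $\gamma:\mathcal G_C\to\{1,2,\dots\}$, let $c_\Delta\in\partial\Delta$ for $\Delta\in\mathcal G_C$, let $\emptyset\neq\mathcal G_C^{(0)}\subseteq\mathcal G_C$, and let $\kappa,A>1$. Put $\mathrm{Crit}(\mathcal G)=\{c_\Delta:\Delta\in\mathcal G_C\}$. On $\Delta\in\mathcal G$ derivatives of $f$ are those of $f|_\Delta$ (one-sided at the endpoints). Let $\mathcal M$ be the set of continuous maps $f:I_*\to I$ such that: 1. for all $\Delta\in\mathcal G$: $f|_\Delta$ is $C^3$ and injective, $f(\Delta)=I$, and $\frac{f'''}{f'}-\frac32\left(\frac{f''}{f'}\right)^2<0$ wherever $f'\ne0$ on $\Delta$; 2. $|f'|\ge\kappa$ on every $\Delta\in\mathcal G_E$; 3. for $\Delta\in\mathcal G_C$, $c_\Delta$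 is the unique zero of $f'$ in $\Delta$, with $f(c_\Delta)=0$ if $\Delta\in\mathcal G_C^{(0)}$ and $f(c_\Delta)=1$ otherwise; 4. $f(0)=f(1)=0$, $f'(0)\ge\kappa$, $f'(1)\le-\kappa$, and $|f'|\le A$; 5. there is $s\in(0,1)$ with $(f|_{\Delta_0})^{-1}(\max\{|\Delta_0|,|\Delta_1|\})\le s$ and $|f'|\ge\kappa$ on $I_*\cap([0,s]\cup[1-s,1])$; 6. for every $\Delta\in\mathcal G_C$ there is a $C^3$ function $A_\Delta$ on $\Delta$ with $|A_\Delta|,|A_\Delta'|\in[1/A,A]$ and $f(x)=f(c_\Delta)+A_\Delta(x)(x-c_\Delta)^{1+\gamma_\Delta}$ on $\Delta$. Let $(\Omega,\mathcal F,m)$ be a probability space, $\theta:\Omega\to\Omega$ an invertible bimeasurable ergodic $m$-preserving map, and $\Omega\ni\omega\mapsto T_\omega\in\mathcal M$ such that $\omega\mapsto T_\omega(x)$ is measurable for every $x\in I_*$, and such that, for some constant $C>0$, $|T_\omega'(x)|\ge C|x-c_\Delta|^{\gamma_\Delta}$ for all $\omega\in\Omega$, $\Delta\in\mathcal G_C$,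 $x\in\Delta$. Write $T^n_\omega=T_{\theta^{n-1}\omega}\circ\dots\circ T_\omega$, $\mathcal J_\omega=\{x: T^n_\omega(x)\in I_*\ \forall n\ge0\}$, $\mathcal J=\bigcup_\omega\{\omega\}\times\mathcal J_\omega$, and $\mathrm{Crit}_-=\bigcup_{\omega}\{\omega\}\times\bigcup_{n\ge0}T_\omega^{-n}(\mathrm{Crit}(\mathcal G))$. A random measure $\nu$ on $\mathcal J$ is a probability measure on $\Omega\times\mathbb R$ with marginal $m$ and $\nu(\mathcal J)=1$, given by its disintegration $(\nu_\omega)_{\omega\in\Omega}$. For $t\ge0$ it is called *$t$-conformal*, with witness a measurable function $\lambda:\Omega\to(0,\infty)$, if for $m$-a.e. $\omega$, with $\psi=\lambda_\omega|T_\omega'|^t$: (F) for every Borel set $B\subseteq\mathcal J_\omega$ on which $T_\omega$ is injective, $T_\omega(B)$ is Borel and $\nu_{\theta\omega}(T_\omega(B))=\int_B\psi\,d\nu_\omega$; and (B) $\nu_\omega\circ T_\omega^{-1}\ll\nu_{\theta\omega}$ and for every such $B$, $\nu_\omega(B)=\int_{T_\omega(B)}\frac1{\psi\circ(T_\omega|_B)^{-1}}\,d\nu_{\theta\omega}$,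 where $1/0=\infty$. (At a common endpoint of two intervals, $|T_\omega'|$ means the smaller of the two one-sided values.) Put $\lambda^n_\omega=\lambda_\omega\lambda_{\theta\omega}\cdots\lambda_{\theta^{n-1}\omega}$. **Statement.** Let $t>0$ and let $\nu',\nu''$ be two $t$-conformal random measures, with witnesses $\lambda',\lambda''$. Then (a) $\nu'(\mathcal J\setminus\mathrm{Crit}_-)=\nu''(\mathcal J\setminus\mathrm{Crit}_-)=1$; (b) $\nu'$ and $\nu''$ are equivalent (mutually absolutely continuous), and $\nu'_\omega$ and $\nu''_\omega$ are equivalent for $m$-a.e. $\omega\in\Omega$; (c) for $m$-a.e. $\omega\in\Omega$ there is a strictly increasing sequence $(n_k)_{k}$ of natural numbers such that the limit $\lim_{k\to\infty}(\lambda')^{n_k}_\omega/(\lambda'')^{n_k}_\omega$ exists and lies in $(0,\infty)$; (d) $\log\lambda'$ and $\log\lambda''$ are $m$-integrable and $\int_\Omega\log\lambda'\,dm=\int_\Omega\log\lambda''\,dm$; that is, the expected pressure $\mathcal{EP}(t)=\int_\Omega\log\lambda_{\omega}\,dm(\omega)$ does not depend on the choice of the $t$-conformal measure. -/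

import Mathlib

open MeasureTheory ProbabilityTheory Set Filter Topology

noncomputable section

namespace CritFinite

/-- A finite collection `𝒢` of closed intervals `Δ i = [lo i, hi i] ⊆ [0,1]` with disjoint interiors
(indexed by `ι`), the split `𝒢 = 𝒢_C ∪ 𝒢_E` (`crit` is `𝒢_C`, its complement is `𝒢_E`), the critical
points `c_Δ ∈ ∂Δ` (`Δ ∈ 𝒢_C`), the subfamily `𝒢_C^{(0)}` (`critZero`) of those critical intervals
whose critical value is `0`, and the orders `γ : 𝒢_C → {1,2,…}`.  The points `0` and `1` belong to
two different intervals (`i0`, `i1`), and `𝒢_C^{(0)}` is non-empty. The values of `c` and `γ`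
outside `𝒢_C` play no role. -/
structure IntervalFamily (ι : Type*) where
  lo : ι → ℝ
  hi : ι → ℝ
  lo_lt_hi : ∀ i, lo i < hi i
  lo_nonneg : ∀ i, 0 ≤ lo i
  hi_le_one : ∀ i, hi i ≤ 1
  disjoint_interiors : Pairwise fun i j => Disjoint (Ioo (lo i) (hi i)) (Ioo (lo j) (hi j))
  i0 : ι
  i1 : ι
  lo_i0 : lo i0 = 0
  hi_i1 : hi i1 = 1
  i0_ne_i1 : i0 ≠ i1
  crit : Set ι
  critZero : Set ι
  critZero_subset : critZero ⊆ crit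
  critZero_nonempty : critZero.Nonempty
  c : ι → ℝ
  c_mem_boundary : ∀ i ∈ crit, c i = lo i ∨ c i = hi i
  γ : ι → ℕ
  one_le_γ : ∀ i ∈ crit, 1 ≤ γ i

namespace IntervalFamily

variable {ι : Type*} (G : IntervalFamily ι)

/-- The closed interval `Δ i`. -/
def cell (i : ι) : Set ℝ := Icc (G.lo i) (G.hi i)

/-- `|Δ i|`. -/
def len (i : ι) : ℝ := G.hi i - G.lo i

/-- `I_* = ⋃ Δ`. -/
def Istar : Set ℝ := ⋃ i, G.cell i

/-- `Crit(𝒢) = {c_Δ : Δ ∈ 𝒢_C}`. -/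
def Crit : Set ℝ := G.c '' G.crit

/-- Derivative of the restriction `f|_Δ` (one-sided at the endpoints of `Δ`). -/
def D (f : ℝ → ℝ) (i : ι) (x : ℝ) : ℝ := derivWithin f (G.cell i) x

/-- Schwarzian derivative `f'''/f' - (3/2) (f''/f')²` of the restriction `f|_Δ`. -/
def schwarzian (f : ℝ → ℝ) (i : ι) (x : ℝ) : ℝ :=
  iteratedDerivWithin 3 f (G.cell i) x / G.D f i x
    - 3 / 2 * (iteratedDerivWithin 2 f (G.cell i) x / G.D f i x) ^ 2

/-- `|f'(x)|` for `x ∈ I_*`. At a common endpoint of two intervals, where the two one-sided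
derivatives may differ, the smaller modulus is taken, so that `|f'|` vanishes at every critical
point. (The value is `∞` off `I_*`, where it is never used.) -/
def speed (f : ℝ → ℝ) (x : ℝ) : ENNReal :=
  ⨅ i, ⨅ _ : x ∈ G.cell i, ENNReal.ofReal |G.D f i x|

/-- The class `ℳ(𝒢; κ, A, γ)` of maps `f : I_* → [0,1]`; only the values of `f` on `I_*` matter. -/
structure IsMap (κ A : ℝ) (f : ℝ → ℝ) : Prop where
  continuousOn : ContinuousOn f G.Istar
  contDiffOn : ∀ i, ContDiffOn ℝ 3 f (G.cell i)
  injOn : ∀ i, InjOn f (G.cell i)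
  image_cell : ∀ i, f '' G.cell i = Icc 0 1
  /-- negative Schwarzian derivative, at the points where it is defined -/
  schwarzian_neg : ∀ i, ∀ x ∈ G.cell i, G.D f i x ≠ 0 → G.schwarzian f i x < 0
  expanding : ∀ i ∉ G.crit, ∀ x ∈ G.cell i, κ ≤ |G.D f i x|
  critical : ∀ i ∈ G.crit, ∀ x ∈ G.cell i, (G.D f i x = 0 ↔ x = G.c i)
  critValue_zero : ∀ i ∈ G.critZero, f (G.c i) = 0
  critValue_one : ∀ i ∈ G.crit \ G.critZero, f (G.c i) = 1
  map_one : f 1 = 0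
  map_zero : f 0 = 0
  deriv_zero : κ ≤ G.D f G.i0 0
  deriv_one : G.D f G.i1 1 ≤ -κ
  deriv_le : ∀ i, ∀ x ∈ G.cell i, |G.D f i x| ≤ A
  /-- there is `s ∈ (0,1)` with `f₀⁻¹(max{|Δ₀|,|Δ₁|}) ≤ s` and `|f'| ≥ κ` on `[0,s] ∪ [1-s,1]` -/
  expanding_ends : ∃ s ∈ Ioo (0 : ℝ) 1,
    (∀ y ∈ G.cell G.i0, f y = max (G.len G.i0) (G.len G.i1) → y ≤ s) ∧
    ∀ i, ∀ x ∈ G.cell i, x ∈ Icc 0 s ∪ Icc (1 - s) 1 → κ ≤ |G.D f i x|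
  nonflat : ∀ i ∈ G.crit, ∃ a : ℝ → ℝ, ContDiffOn ℝ 3 a (G.cell i) ∧ ∀ x ∈ G.cell i,
    |a x| ∈ Icc A⁻¹ A ∧ |derivWithin a (G.cell i) x| ∈ Icc A⁻¹ A ∧
    f x = f (G.c i) + a x * (x - G.c i) ^ (1 + G.γ i)

end IntervalFamily

section Random

variable {ι Ω : Type*} (G : IntervalFamily ι) (θ : Ω → Ω) (T : Ω → ℝ → ℝ)

/-- `T_ω^n = T_{θ^{n-1}ω} ∘ ⋯ ∘ T_{θω} ∘ T_ω`. -/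
def iter : ℕ → Ω → ℝ → ℝ
  | 0, _, x => x
  | n + 1, ω, x => iter n (θ ω) (T ω x)

/-- `𝒥_ω(T)`: the points all of whose iterates stay in `I_*`. -/
def julia (ω : Ω) : Set ℝ := {x | ∀ n, iter θ T n ω x ∈ G.Istar}

/-- `𝒥(T) ⊆ Ω × ℝ`. -/
def juliaGraph : Set (Ω × ℝ) := {p | p.2 ∈ julia G θ T p.1}

/-- `Crit_-(𝒢, ω) = ⋃ₙ T_ω^{-n}(Crit(𝒢))`. -/
def critBack (ω : Ω) : Set ℝ := {x ∈ julia G θ T ω | ∃ n, iter θ T n ω x ∈ G.Crit}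

/-- `Crit_-(𝒢) = ⋃_ω {ω} × Crit_-(𝒢, ω)`. -/
def critBackGraph : Set (Ω × ℝ) := {p | p.2 ∈ critBack G θ T p.1}

/-- `lam_ω^n = lam_ω lam_{θω} ⋯ lam_{θ^{n-1}ω}`. -/
def cocycle (lam : Ω → ℝ) (n : ℕ) (ω : Ω) : ℝ := ∏ k ∈ Finset.range n, lam (θ^[k] ω)

/-- A random critically finite map of the interval over the base map `θ`. -/
structure IsRandomMap [MeasurableSpace Ω] (κ A : ℝ) : Prop where
  one_lt_κ : 1 < κ
  one_lt_A : 1 < A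
  isMap : ∀ ω, G.IsMap κ A (T ω)
  measurable : ∀ x ∈ G.Istar, Measurable fun ω => T ω x
  /-- the lower half of the comparability `|T_ω'(x)| ≍ |x - c_Δ|^{γ_Δ}` on critical intervals,
  with a constant that does not depend on `ω` -/
  deriv_lower : ∃ C : ℝ, 0 < C ∧ ∀ ω, ∀ i ∈ G.crit, ∀ x ∈ G.cell i,
    C * |x - G.c i| ^ G.γ i ≤ |G.D (T ω) i x|

end Random

/-- `A` is a special subset of `X` for `f`: a Borel set on which `f` is one-to-one. -/
def IsSpecial (f : ℝ → ℝ) (X A : Set ℝ) : Prop := A ⊆ X ∧ MeasurableSet A ∧ InjOn f A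

/-- `f : X → ℝ` is `ψ`-Fconformal for the pair `(μ, ν)`: `ψ` is the Jacobian of `f`. -/
def FConformal (f : ℝ → ℝ) (X : Set ℝ) (ψ : ℝ → ENNReal) (μ ν : Measure ℝ) : Prop :=
  ∀ A, IsSpecial f X A → MeasurableSet (f '' A) ∧ ν (f '' A) = ∫⁻ x in A, ψ x ∂μ

/-- `f : X → ℝ` is `ψ`-Bconformal for the pair `(μ, ν)`: it is quasi-invariant (`μ ∘ f⁻¹ ≪ ν`) and
the inverse of `f` on each special set has Jacobian `1/ψ ∘ f⁻¹` with respect to `ν` and `μ`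
(with `1/0 = ∞`, `1/∞ = 0`). -/
def BConformal (f : ℝ → ℝ) (X : Set ℝ) (ψ : ℝ → ENNReal) (μ ν : Measure ℝ) : Prop :=
  (∀ B, MeasurableSet B → ν B = 0 → μ (X ∩ f ⁻¹' B) = 0) ∧
  ∀ A, IsSpecial f X A → μ A = ∫⁻ y in f '' A, (ψ (Function.invFunOn f A y))⁻¹ ∂ν

/-- `ν = (ν_ω)` is a random probability measure supported on `𝒥(T)` that is `t`-conformal, as
witnessed by the measurable function `lam : Ω → (0,∞)`: for a.e. `ω` the map
`T_ω : 𝒥_ω(T) → 𝒥_{θω}(T)` is both `lam_ω |T_ω'|^t`-Fconformal and `lam_ω |T_ω'|^t`-Bconformal for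
the pair `(ν_ω, ν_{θω})`. -/
structure IsConformal {ι Ω : Type*} [MeasurableSpace Ω] (G : IntervalFamily ι) (θ : Ω → Ω)
    (T : Ω → ℝ → ℝ) (m : Measure Ω) (t : ℝ) (ν : Kernel Ω ℝ) (lam : Ω → ℝ) : Prop where
  supported : ∀ᵐ ω ∂m, ν ω (julia G θ T ω) = 1
  measurable : Measurable lam
  pos : ∀ ω, 0 < lam ω
  fconformal : ∀ᵐ ω ∂m, FConformal (T ω) (julia G θ T ω)
    (fun x => ENNReal.ofReal (lam ω) * G.speed (T ω) x ^ t) (ν ω) (ν (θ ω))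
  bconformal : ∀ᵐ ω ∂m, BConformal (T ω) (julia G θ T ω)
    (fun x => ENNReal.ofReal (lam ω) * G.speed (T ω) x ^ t) (ν ω) (ν (θ ω))

end CritFinite

end

open MeasureTheory ProbabilityTheory Set Filter Topology
noncomputable section
namespace CritFinite

/-! Let γ be the largest critical order, α = γ/(1+γ), a = αt, β = t − a. Call a point regular if its
orbit stays in the interiors of the cells, and let K be the set of regular points outside small
cylinders at 0 and 1.

Negative Schwarzian derivative means that |f'|^(-1/2) is convex on each branch. This gives a
one-sided Koebe inequality that is stable under composition (`KoebeOn.comp`). Hence on an n-cylinder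
the derivative of the n-th iterate is comparable with a reference value at all points that are in K
at time n. Every regular orbit visits K infinitely often, and the cylinders around a regular point
shrink to it (`eq_of_forall_mem_ccyl`). A covering by cylinders then compares two conformal measures
on the set of points that visit K infinitely often at times when the ratio of the products Λ', Λ''
of the λ's is controlled (`cover_le`).

Suppose that ν' is not absolutely continuous with respect to ν'' on some fibre. Call n red if Λ''_n
≥ sΛ'_n and blue otherwise. Then a set of positive ν''-measure is eventually outside K at all red
times, and one of positive ν'-measure at all blue times. At an avoided time n the points are inside
an excursion near the ends of [0,1] that began at a last visit l < n to K. Along the excursion the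
t-th power of the derivative is at least a constant times e^a P, where e is the final distance to
the ends and P is the product of |T'(0)|^β over the excursion (`growth_exit`). The mass of such
points with weight e^(-a) is dominated by the mass of points of K that a cell with a critical point
of order γ launches close to 0 (`launch_bound`). Let b_n be P_n times the sum of the inverse
reference values over all n-cylinders; it does not depend on the measure. The estimates combine to
b_n ≤ C (∑_{l<n} b_l) p_n with ∑ p_n finite, so that ∑ b_n converges by a discrete Gronwall
argument, and P_n Λ'_n is bounded by tails of this series. Therefore P_n Λ'_n → 0
(`tendsto_of_not_absolutelyContinuous`).

But log(P_n Λ'_n) is a Birkhoff sum of the bounded function ζ = log λ' + β log|T'(0)|, whose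
integral is nonnegative because the cylinders 0ⁿ cannot carry too much mass (`integral_zet_nonneg`).
Such sums do not tend to −∞ almost everywhere (`not_ae_tendsto_birkhoffSum_atBot`), and by
ergodicity they then do so almost nowhere. This proves (b).

For (c), the points at which the ratio of the products tends to 0 or ∞ along visits to K form a null
set, and a point outside it provides the subsequence. A maximal ergodic inequality turns (c) into
(d). For (a), a critical point with value 0 makes {0} a null set; hence the ends, and all points
that ever reach the boundary of a cell, are null. -/

/-! ### Distortion from negative Schwarzian derivative -/

theorem sub_le_sub_of_hasDerivAt_le {f g f' g' : ℝ → ℝ} {a b : ℝ} (hab : a ≤ b)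
    (hf : ∀ u ∈ Icc a b, HasDerivAt f (f' u) u) (hg : ∀ u ∈ Icc a b, HasDerivAt g (g' u) u)
    (h : ∀ u ∈ Icc a b, f' u ≤ g' u) : f b - f a ≤ g b - g a := by
  have hmono : MonotoneOn (fun u => g u - f u) (Icc a b) := by
    apply monotoneOn_of_deriv_nonneg (convex_Icc a b)
    · exact fun u hu => ((hg u hu).sub (hf u hu)).continuousAt.continuousWithinAt
    · intro u hu
      have hu := interior_subset hu
      exact ((hg u hu).sub (hf u hu)).differentiableAt.differentiableWithinAt
    · intro u hu
      have hu := interior_subset hu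
      have := ((hg u hu).sub (hf u hu)).deriv
      rw [show (fun u => g u - f u) = g - f from rfl, this]
      linarith [h u hu]
  have := hmono (left_mem_Icc.2 hab) (right_mem_Icc.2 hab) hab
  simp only at this
  linarith

/-- Primitives of the inverse square of an affine function are Möbius maps, which have Schwarzian
derivative zero; they are the comparison maps in `convex_distortion`. -/
theorem hasDerivAt_div_affine {a s x c u : ℝ} (hc : c ≠ 0) (hu : a + s * (u - x) ≠ 0) (x' : ℝ)
    (hx' : a + s * (x' - x) = c) :
    HasDerivAt (fun u => (u - x') / (c * (a + s * (u - x)))) (1 / (a + s * (u - x)) ^ 2) u := by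
  have h1 : HasDerivAt (fun u => u - x') 1 u := (hasDerivAt_id u).sub_const x'
  have h2 : HasDerivAt (fun u => c * (a + s * (u - x))) (c * (s * 1)) u :=
    ((((hasDerivAt_id u).sub_const x).const_mul s).const_add a).const_mul c
  refine (h1.div h2 (mul_ne_zero hc hu)).congr_deriv ?_
  have : 1 * (c * (a + s * (u - x))) - (u - x') * (c * (s * 1)) = c ^ 2 := by rw [← hx']; ring
  rw [this]
  field_simp

/-- Distortion control towards a reference point `q` for a primitive of `φ⁻²`, `φ` convex. -/
theorem convex_distortion {f φ : ℝ → ℝ} {I : Set ℝ} (hφ : ConvexOn ℝ I φ)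
    (hpos : ∀ u ∈ I, 0 < φ u) (hf : ∀ u ∈ I, HasDerivAt f (1 / φ u ^ 2) u) {x x' q : ℝ}
    (hx : x ∈ I) (hq : q ∈ I) (h1 : x < x') (h2 : x' < q) :
    φ x' * (q - x) * (f q - f x') ≤ φ x * (q - x') * (f q - f x) := by
  have hI := hφ.1.ordConnected
  have hx' : x' ∈ I := hI.out hx hq ⟨h1.le, h2.le⟩
  -- The chord of φ through x and x' lies above φ on [x, x'] and below φ beyond x'. So f grows at
  -- least as much as the Möbius map of the chord on [x, x'], and at most as much on [x', q].
  set s := (φ x' - φ x) / (x' - x) with hs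
  have e0 : 0 < x' - x := sub_pos.2 h1
  have e1 : 0 < q - x' := sub_pos.2 h2
  have hsx : s * (x' - x) = φ x' - φ x := by rw [hs]; field_simp
  have px := hpos x hx
  have px' := hpos x' hx'
  have hl : φ x + s * (x' - x) = φ x' := by rw [hsx]; ring
  have hlpos : ∀ u ∈ Icc x x', 0 < φ x + s * (u - x) := by
    intro u hu
    have : (φ x + s * (u - x)) * (x' - x) = φ x * (x' - u) + φ x' * (u - x) := by
      linear_combination (u - x) * hsx
    have h3 : 0 < φ x * (x' - u) + φ x' * (u - x) := by
      rcases eq_or_lt_of_le hu.1 with h | h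
      · subst h; nlinarith
      · nlinarith [mul_nonneg px.le (sub_nonneg.2 hu.2), mul_pos px' (sub_pos.2 h)]
    rw [← this] at h3
    exact (pos_iff_pos_of_mul_pos h3).2 e0
  have A1 : (x' - x) / (φ x * φ x') ≤ f x' - f x := by
    have := sub_le_sub_of_hasDerivAt_le (f := fun u => (u - x) / (φ x * (φ x + s * (u - x))))
      (f' := fun u => 1 / (φ x + s * (u - x)) ^ 2) (g := f) (g' := fun u => 1 / φ u ^ 2) h1.le
      (fun u hu => hasDerivAt_div_affine px.ne' (hlpos u hu).ne' x (by simp))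
      (fun u hu => hf u (hI.out hx hx' hu)) ?_
    · simpa [hl] using this
    · intro u hu
      have huI := hI.out hx hx' hu
      have hc : φ u ≤ φ x + s * (u - x) := by
        have := hφ.2 hx hx' (show 0 ≤ (x' - u) / (x' - x) from div_nonneg (by linarith [hu.2]) e0.le)
          (show 0 ≤ (u - x) / (x' - x) from div_nonneg (by linarith [hu.1]) e0.le)
          (by field_simp; ring)
        have e : (x' - u) / (x' - x) * x + (u - x) / (x' - x) * x' = u := by field_simp; ring
        simp only [smul_eq_mul] at this
        rw [e] at this
        refine this.trans (le_of_eq ?_)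
        rw [hs]; field_simp; ring
      have := hpos u huI
      gcongr
  set L := φ x + s * (q - x) with hL
  have key : (x' - x) * L = φ x' * (q - x) - φ x * (q - x') := by
    rw [hL]; linear_combination (q - x) * hsx
  have hB0 : 0 ≤ f q - f x' := by
    have := sub_le_sub_of_hasDerivAt_le (f := fun _ => (0 : ℝ)) (f' := fun _ => 0) (g := f)
      (g' := fun u => 1 / φ u ^ 2) h2.le (fun u _ => hasDerivAt_const u 0)
      (fun u hu => hf u (hI.out hx' hq hu)) (fun u _ => by positivity)
    simpa using this
  have B1 : (f q - f x') * L ≤ (q - x') / φ x' := by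
    -- L is the height of the chord at q. If it is not positive, the Möbius map may have a pole
    -- before q, but then the bound is trivial.
    rcases le_or_gt L 0 with h | h
    · exact (mul_nonpos_of_nonneg_of_nonpos hB0 h).trans (by positivity)
    have hlpos' : ∀ u ∈ Icc x' q, 0 < φ x + s * (u - x) := by
      intro u hu
      have : (φ x + s * (u - x)) * (q - x') = φ x' * (q - u) + L * (u - x') := by
        rw [hL, ← hl]; ring
      have h3 : 0 < φ x' * (q - u) + L * (u - x') := by
        rcases eq_or_lt_of_le hu.1 with h' | h'
        · subst h'; nlinarith
        · nlinarith [mul_nonneg px'.le (sub_nonneg.2 hu.2), mul_pos h (sub_pos.2 h')]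
      rw [← this] at h3
      exact (pos_iff_pos_of_mul_pos h3).2 e1
    have := sub_le_sub_of_hasDerivAt_le (g := fun u => (u - x') / (φ x' * (φ x + s * (u - x))))
      (g' := fun u => 1 / (φ x + s * (u - x)) ^ 2) (f := f) (f' := fun u => 1 / φ u ^ 2) h2.le
      (fun u hu => hf u (hI.out hx' hq hu))
      (fun u hu => hasDerivAt_div_affine px'.ne' (hlpos' u hu).ne' x' hl) ?_
    · simp only [sub_self, zero_div, sub_zero] at this
      calc _ ≤ (q - x') / (φ x' * L) * L := by gcongr
        _ = _ := by field_simp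
    · intro u hu
      have huI := hI.out hx' hq hu
      have hc : φ x + s * (u - x) ≤ φ u := by
        rcases eq_or_lt_of_le hu.1 with h' | h'
        · subst h'; exact hl.le
        have := hφ.2 hx huI (show 0 ≤ (u - x') / (u - x) from div_nonneg (by linarith) (by linarith))
          (show 0 ≤ (x' - x) / (u - x) from div_nonneg (by linarith) (by linarith))
          (by have : u - x ≠ 0 := by linarith
              field_simp; ring)
        have hux : u - x ≠ 0 := by linarith
        have e : (u - x') / (u - x) * x + (x' - x) / (u - x) * u = x' := by field_simp; ring
        simp only [smul_eq_mul] at this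
        rw [e] at this
        have h5 : φ x' * (u - x) ≤ (u - x') * φ x + (x' - x) * φ u := by
          have h6 := mul_le_mul_of_nonneg_right this (by linarith : 0 ≤ u - x)
          refine h6.trans (le_of_eq ?_)
          field_simp
        have h7 : (φ x + s * (u - x)) * (x' - x) ≤ φ u * (x' - x) := by
          nlinarith [hsx]
        exact le_of_mul_le_mul_right h7 e0
      have := hlpos' u hu
      gcongr
  have h3 : (f q - f x') * (φ x' * (q - x) - φ x * (q - x')) ≤ φ x * (q - x') * (f x' - f x) := by
    rw [← key]
    have h4 : (q - x') * (x' - x) / φ x' ≤ φ x * (q - x') * (f x' - f x) := by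
      calc (q - x') * (x' - x) / φ x' = φ x * (q - x') * ((x' - x) / (φ x * φ x')) := by field_simp
        _ ≤ _ := by gcongr
    have h5 : (x' - x) * ((f q - f x') * L) ≤ (x' - x) * ((q - x') / φ x') := by gcongr
    calc _ = (x' - x) * ((f q - f x') * L) := by ring
      _ ≤ _ := h5
      _ = (q - x') * (x' - x) / φ x' := by ring
      _ ≤ _ := h4
  nlinarith [h3]

/-- `d` plays the role of the derivative of `F`: the density of `F`, normalised by the
reference point `q` on both sides, does not decrease towards `q`. -/
def KoebeOn (F d : ℝ → ℝ) (S : Set ℝ) : Prop :=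
  ∀ x ∈ S, ∀ x' ∈ S, ∀ q ∈ S, x' ∈ uIcc x q →
    |d x| * (q - x) ^ 2 * (F q - F x') ^ 2 ≤ |d x'| * (q - x') ^ 2 * (F q - F x) ^ 2

theorem koebe_of_convex_aux {f g φ : ℝ → ℝ} {I : Set ℝ} (hφ : ConvexOn ℝ I φ)
    (hpos : ∀ u ∈ I, 0 < φ u) (hf : ∀ u ∈ I, HasDerivAt f (g u) u)
    (hg : ∀ u ∈ I, g u = 1 / φ u ^ 2) {x x' q : ℝ}
    (hx : x ∈ I) (hq : q ∈ I) (h1 : x < x') (h2 : x' < q) :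
    |g x| * (q - x) ^ 2 * (f q - f x') ^ 2 ≤ |g x'| * (q - x') ^ 2 * (f q - f x) ^ 2 := by
  have hI := hφ.1.ordConnected
  have hx' : x' ∈ I := hI.out hx hq ⟨h1.le, h2.le⟩
  have hf' : ∀ u ∈ I, HasDerivAt f (1 / φ u ^ 2) u := fun u hu => hg u hu ▸ hf u hu
  have key := convex_distortion hφ hpos hf' hx hq h1 h2
  have px := hpos x hx
  have px' := hpos x' hx'
  have hB0 : 0 ≤ f q - f x' := by
    have := sub_le_sub_of_hasDerivAt_le (f := fun _ => (0 : ℝ)) (f' := fun _ => 0) (g := f)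
      (g' := fun u => 1 / φ u ^ 2) h2.le (fun u _ => hasDerivAt_const u 0)
      (fun u hu => hf' u (hI.out hx' hq hu)) (fun u _ => by positivity)
    simpa using this
  have h0 : 0 ≤ φ x' * (q - x) * (f q - f x') := by
    have : 0 ≤ q - x := by linarith
    positivity
  have := pow_le_pow_left₀ h0 key 2
  rw [hg x hx, hg x' hx', abs_of_pos (by positivity), abs_of_pos (by positivity)]
  calc 1 / φ x ^ 2 * (q - x) ^ 2 * (f q - f x') ^ 2
      = (φ x' * (q - x) * (f q - f x')) ^ 2 / (φ x ^ 2 * φ x' ^ 2) := by field_simp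
    _ ≤ (φ x * (q - x') * (f q - f x)) ^ 2 / (φ x ^ 2 * φ x' ^ 2) := by gcongr
    _ = _ := by field_simp

theorem koebeOn_of_convex {f g φ : ℝ → ℝ} {I : Set ℝ} (hφ : ConvexOn ℝ I φ)
    (hpos : ∀ u ∈ I, 0 < φ u) (hf : ∀ u ∈ I, HasDerivAt f (g u) u)
    (hg : ∀ u ∈ I, g u = 1 / φ u ^ 2) : KoebeOn f g I := by
  intro x hx x' hx' q hq hb
  rcases eq_or_ne x' x with rfl | hne
  · exact le_rfl
  rcases eq_or_ne x' q with rfl | hne'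
  · simp
  rcases le_total x q with h | h
  · rw [uIcc_of_le h] at hb
    exact koebe_of_convex_aux hφ hpos hf hg hx hq (lt_of_le_of_ne hb.1 hne.symm)
      (lt_of_le_of_ne hb.2 hne')
  · rw [uIcc_of_ge h] at hb
    -- The case q < x follows by reflecting at the origin; changing the sign of f as well keeps the
    -- derivative positive.
    have hφ' : ConvexOn ℝ (Neg.neg ⁻¹' I) (fun u => φ (-u)) := by
      exact hφ.comp_linearMap (-LinearMap.id)
    have := koebe_of_convex_aux (f := fun u => - f (-u)) (g := fun u => g (-u)) hφ'
      (fun u hu => hpos _ hu)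
      (fun u hu => by
        have h1 := (hf (-u) hu).comp u (hasDerivAt_neg u)
        exact h1.neg.congr_deriv (by ring)) (fun u hu => hg _ hu) (x := -x) (x' := -x')
      (q := -q) (by simpa using hx) (by simpa using hq)
      (neg_lt_neg (lt_of_le_of_ne hb.2 hne)) (neg_lt_neg (lt_of_le_of_ne hb.1 hne'.symm))
    simp only [neg_neg] at this
    convert this using 2 <;> ring

/-- Contracting all three points towards the midpoint keeps their order, and the inequality survives
the limit. This reaches endpoints that are critical, where |f'|^(-1/2) is infinite. -/
theorem KoebeOn.closure_Icc {F d : ℝ → ℝ} {a b : ℝ} (hab : a < b) (hF : ContinuousOn F (Icc a b))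
    (hd : ContinuousOn d (Icc a b)) (h : KoebeOn F d (Ioo a b)) : KoebeOn F d (Icc a b) := by
  intro x hx x' hx' q hq hb
  set m := (a + b) / 2 with hm
  have hmem : ∀ y ∈ Icc a b, ∀ s ∈ Ioo (0 : ℝ) 1, y + s * (m - y) ∈ Ioo a b := by
    intro y hy s hs
    have e : y + s * (m - y) = (1 - s) * y + s * m := by ring
    rw [e]
    have h1 : a < m := by rw [hm]; linarith
    have h2 : m < b := by rw [hm]; linarith
    constructor
    · nlinarith [mul_le_mul_of_nonneg_left hy.1 (by linarith [hs.2] : 0 ≤ 1 - s),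
        mul_lt_mul_of_pos_left h1 hs.1]
    · nlinarith [mul_le_mul_of_nonneg_left hy.2 (by linarith [hs.2] : 0 ≤ 1 - s),
        mul_lt_mul_of_pos_left h2 hs.1]
  have hev : ∀ᶠ s in 𝓝[>] (0 : ℝ), s ∈ Ioo (0 : ℝ) 1 := Ioo_mem_nhdsGT one_pos
  have ht0 : ∀ y, Tendsto (fun s : ℝ => y + s * (m - y)) (𝓝[>] 0) (𝓝 y) := by
    intro y
    have : Tendsto (fun s : ℝ => y + s * (m - y)) (𝓝 0) (𝓝 (y + 0 * (m - y))) :=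
      (Continuous.tendsto (by fun_prop) 0)
    simpa using this.mono_left nhdsWithin_le_nhds
  have ht : ∀ g : ℝ → ℝ, ContinuousOn g (Icc a b) → ∀ y ∈ Icc a b,
      Tendsto (fun s : ℝ => g (y + s * (m - y))) (𝓝[>] 0) (𝓝 (g y)) := by
    intro g hg y hy
    refine (hg y hy).tendsto.comp (tendsto_nhdsWithin_iff.2 ⟨ht0 y, ?_⟩)
    filter_upwards [hev] with s hs using Ioo_subset_Icc_self (hmem y hy s hs)
  refine le_of_tendsto_of_tendsto (b := 𝓝[>] (0 : ℝ))
    (((ht d hd x hx).abs.mul (((ht0 q).sub (ht0 x)).pow 2)).mul (((ht F hF q hq).sub (ht F hF x' hx')).pow 2))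
    (((ht d hd x' hx').abs.mul (((ht0 q).sub (ht0 x')).pow 2)).mul (((ht F hF q hq).sub (ht F hF x hx)).pow 2)) ?_
  filter_upwards [hev] with s hs
  refine h _ (hmem x hx s hs) _ (hmem x' hx' s hs) _ (hmem q hq s hs) ?_
  have hs1 : 0 ≤ 1 - s := by linarith [hs.2]
  rw [mem_uIcc] at hb ⊢
  rcases hb with ⟨h1, h2⟩ | ⟨h1, h2⟩
  · left; constructor <;> nlinarith [mul_le_mul_of_nonneg_left h1 hs1, mul_le_mul_of_nonneg_left h2 hs1]
  · right; constructor <;> nlinarith [mul_le_mul_of_nonneg_left h1 hs1, mul_le_mul_of_nonneg_left h2 hs1]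

/-- The second derivative of g^(-1/2) is −½ g^(-1/2) times the Schwarzian derivative of F, so
g^(-1/2) is convex. -/
theorem koebeOn_of_schwarzian {g g' g'' F : ℝ → ℝ} {a b : ℝ}
    (hF : ∀ u ∈ Ioo a b, HasDerivAt F (g u) u) (hpos : ∀ u ∈ Ioo a b, 0 < g u)
    (hg : ∀ u ∈ Ioo a b, HasDerivAt g (g' u) u) (hg' : ∀ u ∈ Ioo a b, HasDerivAt g' (g'' u) u)
    (hS : ∀ u ∈ Ioo a b, g'' u / g u - 3 / 2 * (g' u / g u) ^ 2 < 0) : KoebeOn F g (Ioo a b) := by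
  refine koebeOn_of_convex (φ := fun u => g u ^ (-1 / 2 : ℝ)) ?_
    (fun u hu => Real.rpow_pos_of_pos (hpos u hu) _) hF ?_
  · have h1 : ∀ (p : ℝ), ∀ u ∈ Ioo a b,
        HasDerivAt (fun u => g u ^ p) (g' u * p * g u ^ (p - 1)) u :=
      fun p u hu => (hg u hu).rpow_const (Or.inl (hpos u hu).ne')
    refine convexOn_of_hasDerivWithinAt2_nonneg (convex_Ioo a b)
      (f' := fun u => g' u * (-1 / 2) * g u ^ (-1 / 2 - 1 : ℝ))
      (f'' := fun u => g'' u * (-1 / 2) * g u ^ (-1 / 2 - 1 : ℝ)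
        + g' u * (-1 / 2) * (g' u * (-1 / 2 - 1) * g u ^ (-1 / 2 - 1 - 1 : ℝ)))
      (fun u hu => (h1 _ u hu).continuousAt.continuousWithinAt) ?_ ?_ ?_
    · rw [interior_Ioo]; exact fun u hu => (h1 _ u hu).hasDerivWithinAt
    · rw [interior_Ioo]
      exact fun u hu => (((hg' u hu).mul_const _).mul (h1 _ u hu)).hasDerivWithinAt
    · rw [interior_Ioo]
      intro u hu
      have p := hpos u hu
      have := hS u hu
      rw [Real.rpow_sub_one p.ne' (-1 / 2 - 1), Real.rpow_sub_one p.ne' (-1 / 2)]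
      have e : g'' u * (-1 / 2) * (g u ^ (-1 / 2 : ℝ) / g u)
        + g' u * (-1 / 2) * (g' u * (-1 / 2 - 1) * (g u ^ (-1 / 2 : ℝ) / g u / g u))
        = (1 / 2) * g u ^ (-1 / 2 : ℝ) * (-(g'' u / g u - 3 / 2 * (g' u / g u) ^ 2)) := by
        field_simp; ring
      rw [e]
      have := Real.rpow_pos_of_pos p (-1 / 2 : ℝ)
      apply mul_nonneg <;> [positivity; linarith]
  · intro u hu
    have p := hpos u hu
    rw [← Real.rpow_natCast, ← Real.rpow_mul p.le]
    norm_num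
    rw [Real.rpow_neg_one]; simp

/-! ### Elementary properties of maps of the class ℳ -/

namespace IntervalFamily
variable {ι : Type*} (G : IntervalFamily ι)

theorem uniqueDiffOn_cell (i : ι) : UniqueDiffOn ℝ (G.cell i) := uniqueDiffOn_Icc (G.lo_lt_hi i)

theorem cell_subset (i : ι) : G.cell i ⊆ Icc 0 1 := fun _ hx =>
  ⟨(G.lo_nonneg i).trans hx.1, hx.2.trans (G.hi_le_one i)⟩

variable {G} {κ A : ℝ} {f : ℝ → ℝ}

theorem IsMap.strict (h : G.IsMap κ A f) (i : ι) :
    StrictMonoOn f (G.cell i) ∨ StrictAntiOn f (G.cell i) :=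
  ((h.contDiffOn i).continuousOn).strictMonoOn_of_injOn_Icc' (G.lo_lt_hi i).le (h.injOn i)

theorem IsMap.bijOn (h : G.IsMap κ A f) (i : ι) : BijOn f (G.cell i) (Icc 0 1) :=
  ⟨fun _ hx => h.image_cell i ▸ mem_image_of_mem f hx, h.injOn i, (h.image_cell i).symm.subset⟩

theorem IsMap.hasDerivWithinAt (h : G.IsMap κ A f) (i : ι) {x : ℝ} (hx : x ∈ G.cell i) :
    HasDerivWithinAt f (G.D f i x) (G.cell i) x :=
  (((h.contDiffOn i).differentiableOn (by norm_num)) x hx).hasDerivWithinAt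

theorem IsMap.D_continuousOn (h : G.IsMap κ A f) (i : ι) : ContinuousOn (G.D f i) (G.cell i) :=
  (h.contDiffOn i).continuousOn_derivWithin (G.uniqueDiffOn_cell i) (by norm_num)

theorem IsMap.D_ne (h : G.IsMap κ A f) (hκ : 0 < κ) {i : ι} {x : ℝ} (hx : x ∈ Ioo (G.lo i) (G.hi i)) :
    G.D f i x ≠ 0 := by
  have hx' : x ∈ G.cell i := Ioo_subset_Icc_self hx
  by_cases hi : i ∈ G.crit
  · intro h0
    have := (h.critical i hi x hx').1 h0
    rcases G.c_mem_boundary i hi with h1 | h1 <;> rw [this, h1] at hx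
    · exact lt_irrefl _ hx.1
    · exact lt_irrefl _ hx.2
  · intro h0
    have := h.expanding i hi x hx'
    rw [h0, abs_zero] at this
    linarith

theorem IsMap.koebe (h : G.IsMap κ A f) (hκ : 0 < κ) (i : ι) : KoebeOn f (G.D f i) (G.cell i) := by
  refine KoebeOn.closure_Icc (G.lo_lt_hi i) (h.contDiffOn i).continuousOn (h.D_continuousOn i) ?_
  have hU := G.uniqueDiffOn_cell i
  have hnhds : ∀ u ∈ Ioo (G.lo i) (G.hi i), G.cell i ∈ 𝓝 u := fun u hu => Icc_mem_nhds hu.1 hu.2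
  have hD0 : ∀ u ∈ Ioo (G.lo i) (G.hi i), HasDerivAt f (G.D f i u) u := fun u hu =>
    (h.hasDerivWithinAt i (Ioo_subset_Icc_self hu)).hasDerivAt (hnhds u hu)
  have hD1 : ∀ u ∈ Ioo (G.lo i) (G.hi i),
      HasDerivAt (G.D f i) (iteratedDerivWithin 2 f (G.cell i) u) u := by
    intro u hu
    have h1 := ((h.contDiffOn i).differentiableOn_iteratedDerivWithin (m := 1) (by norm_num) hU) u
      (Ioo_subset_Icc_self hu)
    have h2 := h1.hasDerivWithinAt.hasDerivAt (hnhds u hu)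
    rw [← iteratedDerivWithin_succ] at h2
    refine h2.congr_of_eventuallyEq ?_
    filter_upwards [hnhds u hu] with v hv
    rw [iteratedDerivWithin_one]; rfl
  have hD2 : ∀ u ∈ Ioo (G.lo i) (G.hi i), HasDerivAt (iteratedDerivWithin 2 f (G.cell i))
      (iteratedDerivWithin 3 f (G.cell i) u) u := by
    intro u hu
    have h1 := ((h.contDiffOn i).differentiableOn_iteratedDerivWithin (m := 2)
      (by norm_cast) hU) u (Ioo_subset_Icc_self hu)
    have h2 := h1.hasDerivWithinAt.hasDerivAt (hnhds u hu)
    rwa [← iteratedDerivWithin_succ] at h2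
  -- The sign σ makes the derivative positive; it affects neither the Schwarzian derivative nor the
  -- squared increments.
  have key : ∀ σ : ℝ, σ ^ 2 = 1 → (∀ u ∈ Ioo (G.lo i) (G.hi i), 0 < σ * G.D f i u) →
      KoebeOn f (G.D f i) (Ioo (G.lo i) (G.hi i)) := by
    intro σ hσ hp
    have hσ0 : σ ≠ 0 := by rintro rfl; norm_num at hσ
    have hk := koebeOn_of_schwarzian (F := fun u => σ * f u)
      (fun u hu => (hD0 u hu).const_mul σ) hp (fun u hu => (hD1 u hu).const_mul σ)
      (fun u hu => (hD2 u hu).const_mul σ) (fun u hu => by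
        have h1 := h.schwarzian_neg i u (Ioo_subset_Icc_self hu) (h.D_ne hκ hu)
        unfold schwarzian at h1
        rwa [mul_div_mul_left _ _ hσ0, mul_div_mul_left _ _ hσ0])
    intro x hx x' hx' q hq hb
    have h3 := hk x hx x' hx' q hq hb
    have hσa : |σ| = 1 := by
      have : |σ| ^ 2 = 1 := by rw [sq_abs, hσ]
      nlinarith [abs_nonneg σ]
    have e : ∀ y z : ℝ, (σ * y - σ * z) ^ 2 = (y - z) ^ 2 := fun y z => by
      linear_combination (y - z) ^ 2 * hσ
    simpa only [abs_mul, hσa, one_mul, e] using h3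
  rcases h.strict i with hs | hs
  · refine key 1 (by norm_num) fun u hu => ?_
    rw [one_mul]
    exact lt_of_le_of_ne hs.monotoneOn.derivWithin_nonneg (h.D_ne hκ hu).symm
  · refine key (-1) (by norm_num) fun u hu => ?_
    have := lt_of_le_of_ne hs.antitoneOn.derivWithin_nonpos (h.D_ne hκ hu)
    change G.D f i u < 0 at this
    linarith

end IntervalFamily

/-! ### Expansion at the ends and the critical exponent α -/

/-- The features of a map of the class `ℳ` on which the argument rests; `d i` is the derivative
on the `i`-th cell, and `j` is a cell carrying a critical point of the highest order. -/
structure BranchMap {ι : Type*} (G : IntervalFamily ι) (κ A α c₀ C₁ ρ : ℝ) (j : ι) (f : ℝ → ℝ)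
    (d : ι → ℝ → ℝ) : Prop where
  continuousOn : ∀ i, ContinuousOn f (G.cell i)
  bijOn : ∀ i, BijOn f (G.cell i) (Icc 0 1)
  hasDeriv : ∀ i, ∀ x ∈ G.cell i, HasDerivWithinAt f (d i x) (G.cell i) x
  deriv_cont : ∀ i, ContinuousOn (d i) (G.cell i)
  deriv_ne : ∀ i, ∀ x ∈ Ioo (G.lo i) (G.hi i), d i x ≠ 0
  deriv_le : ∀ i, ∀ x ∈ G.cell i, |d i x| ≤ A
  koebe : ∀ i, KoebeOn f (d i) (G.cell i)
  map_zero : f 0 = 0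
  map_one : f 1 = 0
  expand_zero : ∀ x ∈ G.cell G.i0, f x ∈ G.cell G.i0 → κ ≤ |d G.i0 x|
  expand_one : ∀ u ∈ G.cell G.i1, f u ≤ ρ → κ ≤ |d G.i1 u| ∧ 1 - u ≤ f u
  deriv_lower : ∀ i, ∀ x ∈ G.cell i, c₀ * min (f x) (1 - f x) ^ α ≤ |d i x|
  launch : (j ≠ G.i0 ∧ j ≠ G.i1 ∧ ∀ x ∈ G.cell j, |d j x| ≤ C₁ * f x ^ α) ∨
    ∀ x ∈ G.cell j, |d j x| ≤ C₁ * (1 - f x) ^ α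

namespace IntervalFamily
variable {ι : Type*} {G : IntervalFamily ι} {κ A : ℝ} {f : ℝ → ℝ}

theorem zero_mem_cell_i0 (G : IntervalFamily ι) : (0 : ℝ) ∈ G.cell G.i0 :=
  ⟨G.lo_i0.le, G.lo_i0 ▸ (G.lo_lt_hi G.i0).le⟩

theorem one_mem_cell_i1 (G : IntervalFamily ι) : (1 : ℝ) ∈ G.cell G.i1 :=
  ⟨G.hi_i1 ▸ (G.lo_lt_hi G.i1).le, G.hi_i1.ge⟩

theorem c_mem_cell {i : ι} (hi : i ∈ G.crit) : G.c i ∈ G.cell i := by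
  rcases G.c_mem_boundary i hi with h | h <;> rw [h]
  · exact left_mem_Icc.2 (G.lo_lt_hi i).le
  · exact right_mem_Icc.2 (G.lo_lt_hi i).le

theorem IsMap.mem_unit (h : G.IsMap κ A f) {i : ι} {x : ℝ} (hx : x ∈ G.cell i) :
    f x ∈ Icc (0 : ℝ) 1 := (h.bijOn i).mapsTo hx

theorem IsMap.abs_sub_le (h : G.IsMap κ A f) {i : ι} {x y : ℝ} (hx : x ∈ G.cell i)
    (hy : y ∈ G.cell i) : |f y - f x| ≤ A * |y - x| :=
  (convex_Icc _ _).norm_image_sub_le_of_norm_hasDerivWithin_le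
    (fun _ hz => h.hasDerivWithinAt i hz) (fun z hz => h.deriv_le i z hz) hx hy

theorem IsMap.nonflat' (h : G.IsMap κ A f) (hA : 1 < A) {i : ι} (hi : i ∈ G.crit) {x : ℝ}
    (hx : x ∈ G.cell i) :
    |f x - f (G.c i)| ≤ A * |x - G.c i| ^ (1 + G.γ i) ∧
    |x - G.c i| ^ (1 + G.γ i) ≤ A * |f x - f (G.c i)| ∧
    |G.D f i x| ≤ A * (2 + G.γ i) * |x - G.c i| ^ (G.γ i) := by
  obtain ⟨a, ha, hprop⟩ := h.nonflat i hi
  obtain ⟨h1, h2, h3⟩ := hprop x hx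
  have hA0 : 0 < A := by linarith
  have e : f x - f (G.c i) = a x * (x - G.c i) ^ (1 + G.γ i) := by linarith
  have e' : |f x - f (G.c i)| = |a x| * |x - G.c i| ^ (1 + G.γ i) := by rw [e, abs_mul, abs_pow]
  have hs1 : |x - G.c i| ≤ 1 := by
    have hc := G.cell_subset i (c_mem_cell hi)
    have hx1 := G.cell_subset i hx
    rw [abs_le]; constructor <;> linarith [hc.1, hc.2, hx1.1, hx1.2]
  have hs0 := abs_nonneg (x - G.c i)
  refine ⟨?_, ?_, ?_⟩
  · rw [e']; exact mul_le_mul_of_nonneg_right h1.2 (by positivity)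
  · rw [e', ← mul_assoc]
    have : 1 ≤ A * |a x| := by
      calc (1 : ℝ) = A * A⁻¹ := by field_simp
        _ ≤ _ := by gcongr; exact h1.1
    exact le_mul_of_one_le_left (by positivity) this
  · have hd1 := ((ha.differentiableOn (by norm_num)) x hx).hasDerivWithinAt
    have hd2 : HasDerivWithinAt (fun x => (x - G.c i) ^ (1 + G.γ i))
        (((1 + G.γ i : ℕ) : ℝ) * (x - G.c i) ^ (G.γ i)) (G.cell i) x := by
      have := ((hasDerivAt_id x).sub_const (G.c i)).pow (1 + G.γ i)
      refine (this.congr_deriv ?_).hasDerivWithinAt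
      simp
    have hd3 := (hd1.mul hd2).const_add (f (G.c i))
    have hd4 : HasDerivWithinAt f _ (G.cell i) x :=
      hd3.congr (fun y hy => by simpa using (hprop y hy).2.2) (by simpa using h3)
    have hD : G.D f i x = _ := hd4.derivWithin (G.uniqueDiffOn_cell i x hx)
    rw [hD]
    refine (abs_add_le _ _).trans ?_
    rw [abs_mul, abs_mul, abs_mul, abs_pow, abs_pow, Nat.abs_cast, pow_add, pow_one]
    have hp : 0 ≤ |x - G.c i| ^ G.γ i := by positivity
    have b1 : |derivWithin a (G.cell i) x| * (|x - G.c i| * |x - G.c i| ^ G.γ i)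
        ≤ A * (1 * |x - G.c i| ^ G.γ i) := by
      gcongr; exact h2.2
    have b2 : |a x| * (((1 + G.γ i : ℕ) : ℝ) * |x - G.c i| ^ G.γ i)
        ≤ A * (((1 + G.γ i : ℕ) : ℝ) * |x - G.c i| ^ G.γ i) := by
      gcongr; exact h1.2
    push_cast at b2 ⊢
    linarith

theorem IsMap.critValue (h : G.IsMap κ A f) {i : ι} (hi : i ∈ G.crit) :
    f (G.c i) = 0 ∨ f (G.c i) = 1 := by
  by_cases h0 : i ∈ G.critZero
  · exact Or.inl (h.critValue_zero i h0)
  · exact Or.inr (h.critValue_one i ⟨hi, h0⟩)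

theorem IsMap.strictMonoOn_i0 (h : G.IsMap κ A f) : StrictMonoOn f (G.cell G.i0) := by
  rcases h.strict G.i0 with hs | hs
  · exact hs
  · have h1 : (0 : ℝ) < G.hi G.i0 := by have := G.lo_lt_hi G.i0; rwa [G.lo_i0] at this
    have h2 : G.hi G.i0 ∈ G.cell G.i0 := right_mem_Icc.2 (G.lo_lt_hi _).le
    have := hs G.zero_mem_cell_i0 h2 h1
    rw [h.map_zero] at this
    linarith [(h.mem_unit h2).1]

theorem IsMap.strictAntiOn_i1 (h : G.IsMap κ A f) : StrictAntiOn f (G.cell G.i1) := by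
  rcases h.strict G.i1 with hs | hs
  · have h1 : G.lo G.i1 < 1 := by have := G.lo_lt_hi G.i1; rwa [G.hi_i1] at this
    have h2 : G.lo G.i1 ∈ G.cell G.i1 := left_mem_Icc.2 (G.lo_lt_hi _).le
    have := hs h2 G.one_mem_cell_i1 h1
    rw [h.map_one] at this
    linarith [(h.mem_unit h2).1]
  · exact hs

/-- Condition 5 of the class gives expansion on [0, s] and [1−s, 1], where s is at least the
preimage in Δ₀ of η = max(|Δ₀|, |Δ₁|). As |f'| ≤ A, that preimage is at least η/A, so the expanding
region has size at least η/A at both ends. -/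
theorem IsMap.expand_ends (h : G.IsMap κ A f) (hκ : 1 < κ) (hA : 1 < A) :
    (∀ x ∈ G.cell G.i0, f x ∈ G.cell G.i0 → κ ≤ |G.D f G.i0 x|) ∧
    ∀ u ∈ G.cell G.i1, f u ≤ max (G.len G.i0) (G.len G.i1) / A →
      κ ≤ |G.D f G.i1 u| ∧ 1 - u ≤ f u := by
  have hA0 : 0 < A := by linarith
  set η := max (G.len G.i0) (G.len G.i1) with hη
  have hlen1 : ∀ i, G.len i ≤ 1 := fun i => by
    unfold len; linarith [G.lo_nonneg i, G.hi_le_one i]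
  have hη1 : η ≤ 1 := max_le (hlen1 _) (hlen1 _)
  have hη0 : 0 < η := lt_max_of_lt_left (sub_pos.2 (G.lo_lt_hi _))
  obtain ⟨s, hs, hs1, hs2⟩ := h.expanding_ends
  obtain ⟨y, hy, hfy⟩ := (h.bijOn G.i0).surjOn ⟨hη0.le, hη1⟩
  have hys := hs1 y hy hfy
  have hmono := h.strictMonoOn_i0
  have hanti := h.strictAntiOn_i1
  refine ⟨fun x hx hfx => ?_, fun u hu hfu => ?_⟩
  · refine hs2 _ x hx (Or.inl ⟨(G.cell_subset _ hx).1, le_trans ?_ hys⟩)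
    refine (hmono.le_iff_le hx hy).1 ?_
    rw [hfy]
    have := hfx.2
    refine le_trans ?_ (le_max_left _ _)
    unfold len; rw [G.lo_i0]; linarith
  · have hy0 : η / A ≤ y := by
      have := h.abs_sub_le G.zero_mem_cell_i0 hy
      rw [hfy, h.map_zero, sub_zero, sub_zero, abs_of_pos hη0,
        abs_of_nonneg (G.cell_subset _ hy).1] at this
      rw [div_le_iff₀ hA0]; linarith
    have hexp : ∀ z ∈ G.cell G.i1, 1 - s ≤ z → κ ≤ |G.D f G.i1 z| := fun z hz hz' =>
      hs2 _ z hz (Or.inr ⟨hz', (G.cell_subset _ hz).2⟩)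
    have hlow : ∀ z ∈ G.cell G.i1, 1 - s ≤ z → κ * (1 - z) ≤ f z := by
      intro z hz hzs
      rcases eq_or_lt_of_le (G.cell_subset _ hz).2 with h1 | h1
      · rw [h1]; simpa using (h.mem_unit G.one_mem_cell_i1).1
      have hsub : Icc z 1 ⊆ G.cell G.i1 := Icc_subset_Icc hz.1 G.hi_i1.ge
      have hsub' : Ioo z 1 ⊆ Ioo (G.lo G.i1) (G.hi G.i1) := Ioo_subset_Ioo hz.1 G.hi_i1.ge
      obtain ⟨w, hw, hw'⟩ := exists_hasDerivAt_eq_slope f (G.D f G.i1) h1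
        ((h.contDiffOn G.i1).continuousOn.mono hsub)
        (fun v hv => (h.hasDerivWithinAt G.i1 (hsub (Ioo_subset_Icc_self hv))).hasDerivAt
          (Icc_mem_nhds (hsub' hv).1 (hsub' hv).2))
      have h2 := hexp w (hsub (Ioo_subset_Icc_self hw)) (by linarith [hw.1])
      rw [hw', h.map_one, zero_sub, abs_div, abs_neg, abs_of_nonneg (h.mem_unit hz).1,
        abs_of_pos (by linarith), le_div_iff₀ (by linarith)] at h2
      exact h2
    -- The last cell has length at least 1/A, because it is mapped onto [0,1] with slope at most A,
    -- and η ≤ 1.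
    have hb : 1 - η / A ∈ G.cell G.i1 := by
      have h1 := h.abs_sub_le G.one_mem_cell_i1
        (left_mem_Icc.2 (G.lo_lt_hi G.i1).le : G.lo G.i1 ∈ G.cell G.i1)
      obtain ⟨z, hz, hfz⟩ := (h.bijOn G.i1).surjOn (right_mem_Icc.2 zero_le_one)
      have h2 := h.abs_sub_le G.one_mem_cell_i1 hz
      have hz1 := (G.cell_subset _ hz).2
      rw [hfz, h.map_one, sub_zero, abs_one, abs_of_nonpos (by linarith)] at h2
      have : η / A ≤ 1 - z := by
        rw [div_le_iff₀ hA0]; linarith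
      refine ⟨by linarith [hz.1], ?_⟩
      rw [G.hi_i1]
      have : 0 ≤ η / A := by positivity
      linarith
    have h3 := hlow _ hb (by linarith)
    have hu' : 1 - η / A ≤ u := by
      refine (hanti.le_iff_ge hu hb).1 (hfu.trans ?_)
      have : 0 ≤ η / A := by positivity
      nlinarith
    refine ⟨hexp u hu (by linarith), ?_⟩
    have := hlow u hu (by linarith)
    nlinarith [(G.cell_subset _ hu).2]

end IntervalFamily

-- Near a critical point of order γ one has |f'| ≍ |x−c|^γ ≍ |f(x)−f(c)|^(γ/(1+γ)), and the critical
-- values are 0 or 1. The largest order has the largest exponent α, which serves as a lower bound on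
-- all cells and as an upper bound on the cell j that attains it.
open IntervalFamily in
theorem IsRandomMap.exists_branchMap {ι Ω : Type*} [Finite ι] [MeasurableSpace Ω]
    {G : IntervalFamily ι} {κ A : ℝ} {T : Ω → ℝ → ℝ} (h : IsRandomMap G T κ A) :
    ∃ α ∈ Ioo (0 : ℝ) 1, ∃ c₀ > 0, ∃ C₁ > 0, ∃ ρ ∈ Ioc (0 : ℝ) (1 / 2), ∃ j, ∀ ω,
      BranchMap G κ A α c₀ C₁ ρ j (T ω) (G.D (T ω)) := by
  have hκ := h.one_lt_κ
  have hA := h.one_lt_A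
  have hA0 : 0 < A := by linarith
  obtain ⟨j, hj, hmax⟩ := (Set.toFinite G.crit).exists_maximalFor G.γ _
    (G.critZero_nonempty.mono G.critZero_subset)
  have hmax' : ∀ i ∈ G.crit, G.γ i ≤ G.γ j := fun i hi => by
    rcases le_total (G.γ i) (G.γ j) with h1 | h1
    · exact h1
    · exact hmax hi h1
  obtain ⟨C, hC, hlow⟩ := h.deriv_lower
  obtain ⟨g, hg⟩ : ∃ g : ℝ, g = G.γ j := ⟨_, rfl⟩
  have hg1 : 1 ≤ g := by rw [hg]; exact_mod_cast G.one_le_γ j hj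
  set α : ℝ := g / (1 + g) with hα
  have hα0 : 0 < α := by positivity
  have hα1 : α < 1 := by rw [hα, div_lt_one (by linarith)]; linarith
  set η := max (G.len G.i0) (G.len G.i1) with hη
  have hη0 : 0 < η := lt_max_of_lt_left (sub_pos.2 (G.lo_lt_hi _))
  refine ⟨α, ⟨hα0, hα1⟩, min 1 (C * (1 / A) ^ α), by positivity, A * (2 + g) * A ^ α,
    by positivity, min (1 / 2) (η / A), ⟨by positivity, min_le_left _ _⟩, j, fun ω => ?_⟩
  have hf := h.isMap ω
  have hends := hf.expand_ends hκ hA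
  refine ⟨fun i => (hf.contDiffOn i).continuousOn, hf.bijOn, fun i x => hf.hasDerivWithinAt i,
    hf.D_continuousOn, fun i x => hf.D_ne (by linarith), hf.deriv_le, hf.koebe (by linarith),
    hf.map_zero, hf.map_one, hends.1, fun u hu hfu => hends.2 u hu (hfu.trans (min_le_right _ _)),
    fun i x hx => ?_, ?_⟩
  · have hu := hf.mem_unit hx
    set e := min (T ω x) (1 - T ω x) with he
    have he0 : 0 ≤ e := le_min hu.1 (by linarith [hu.2])
    have he1 : e ≤ 1 := (min_le_left _ _).trans hu.2
    by_cases hi : i ∈ G.crit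
    · obtain ⟨n1, -, -⟩ := hf.nonflat' hA hi hx
      set s := |x - G.c i| with hs
      have hs0 : 0 ≤ s := abs_nonneg _
      have hev : e ≤ |T ω x - T ω (G.c i)| := by
        rcases hf.critValue hi with h0 | h0 <;> rw [h0]
        · rw [sub_zero, abs_of_nonneg hu.1]; exact min_le_left _ _
        · rw [abs_sub_comm, abs_of_nonneg (by linarith [hu.2])]; exact min_le_right _ _
      have hE : 1 / A * e ≤ s ^ (1 + G.γ i) := by
        rw [one_div, inv_mul_le_iff₀ hA0]; exact hev.trans n1
      have hE1 : 1 / A * e ≤ 1 := by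
        have : 1 / A ≤ 1 := by rw [div_le_one hA0]; exact hA.le
        nlinarith
      have hE0 : 0 ≤ 1 / A * e := by positivity
      have hgi : ((G.γ i : ℝ) / (1 + G.γ i)) ≤ α := by
        have : (G.γ i : ℝ) ≤ g := by rw [hg]; exact_mod_cast hmax' i hi
        rw [hα, div_le_div_iff₀ (by positivity) (by positivity)]; nlinarith
      have hgi1 : (1 : ℝ) ≤ G.γ i := by exact_mod_cast G.one_le_γ i hi
      have key : (1 / A * e) ^ α ≤ s ^ G.γ i := by
        calc (1 / A * e) ^ α ≤ (1 / A * e) ^ ((G.γ i : ℝ) / (1 + G.γ i)) :=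
              Real.rpow_le_rpow_of_exponent_ge_of_imp hE0 hE1 hgi
                (fun _ h0 => absurd h0 (by positivity))
          _ ≤ (s ^ (1 + G.γ i)) ^ ((G.γ i : ℝ) / (1 + G.γ i)) :=
              Real.rpow_le_rpow hE0 hE (by positivity)
          _ = s ^ G.γ i := by
              rw [← Real.rpow_natCast, ← Real.rpow_mul hs0, ← Real.rpow_natCast]
              congr 1
              push_cast; field_simp
      calc min 1 (C * (1 / A) ^ α) * e ^ α ≤ C * (1 / A) ^ α * e ^ α := by
            gcongr; exact min_le_right _ _
        _ = C * (1 / A * e) ^ α := by rw [Real.mul_rpow (by positivity) he0]; ring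
        _ ≤ C * s ^ G.γ i := by gcongr
        _ ≤ _ := hlow ω i hi x hx
    · calc min 1 (C * (1 / A) ^ α) * e ^ α ≤ 1 * 1 := by
            gcongr
            · exact min_le_left _ _
            · exact Real.rpow_le_one he0 he1 hα0.le
        _ ≤ κ := by linarith
        _ ≤ _ := hf.expanding i hi x hx
  · have key : ∀ x ∈ G.cell j,
        |G.D (T ω) j x| ≤ A * (2 + g) * A ^ α * |T ω x - T ω (G.c j)| ^ α := by
      intro x hx
      obtain ⟨-, n2, n3⟩ := hf.nonflat' hA hj hx
      refine n3.trans ?_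
      rw [← hg, mul_assoc (A * (2 + g)), ← Real.mul_rpow hA0.le (abs_nonneg _)]
      gcongr
      calc |x - G.c j| ^ G.γ j = (|x - G.c j| ^ (1 + G.γ j)) ^ α := by
            rw [← Real.rpow_natCast _ (1 + _), ← Real.rpow_mul (abs_nonneg _), ← Real.rpow_natCast]
            congr 1
            rw [hα, hg]; push_cast; field_simp
        _ ≤ _ := by gcongr
    -- If the critical value is 0, then j is not an end cell: by injectivity its critical point
    -- would be 0 or 1, where the derivative does not vanish.
    by_cases h0 : j ∈ G.critZero
    · have hv := hf.critValue_zero j h0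
      have hD0 : G.D (T ω) j (G.c j) = 0 := (hf.critical j hj _ (c_mem_cell hj)).2 rfl
      refine Or.inl ⟨?_, ?_, fun x hx => ?_⟩
      · intro hji
        have hc : G.c j = 0 := by
          refine hf.injOn j (c_mem_cell hj) (hji ▸ G.zero_mem_cell_i0) ?_
          rw [hv, hf.map_zero]
        have := hf.deriv_zero
        rw [hc, hji] at hD0
        rw [hD0] at this
        linarith
      · intro hji
        have hc : G.c j = 1 := by
          refine hf.injOn j (c_mem_cell hj) (hji ▸ G.one_mem_cell_i1) ?_
          rw [hv, hf.map_one]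
        have := hf.deriv_one
        rw [hc, hji] at hD0
        rw [hD0] at this
        linarith
      · have := key x hx
        rwa [hv, sub_zero, abs_of_nonneg (hf.mem_unit hx).1] at this
    · have hv := hf.critValue_one j ⟨hj, h0⟩
      refine Or.inr fun x hx => ?_
      have := key x hx
      rwa [hv, abs_sub_comm, abs_of_nonneg (sub_nonneg.2 (hf.mem_unit hx).2)] at this

/-! ### Random systems, cylinders and their distortion -/

/-- A random system of maps with the features of `BranchMap`, with constants that do not depend on
the base point, an exponent `t`, and a depth `r` beyond which cylinders at `0` are within `ρ`. -/
structure System (ι Ω : Type*) where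
  G : IntervalFamily ι
  θ : Ω → Ω
  T : Ω → ℝ → ℝ
  d : Ω → ι → ℝ → ℝ
  κ : ℝ
  A : ℝ
  α : ℝ
  c₀ : ℝ
  C₁ : ℝ
  ρ : ℝ
  t : ℝ
  j : ι
  r : ℕ
  one_lt_κ : 1 < κ
  one_lt_A : 1 < A
  α_pos : 0 < α
  α_lt_one : α < 1
  c₀_pos : 0 < c₀
  C₁_pos : 0 < C₁
  ρ_pos : 0 < ρ
  ρ_le : ρ ≤ 1 / 2
  t_pos : 0 < t
  depth : 1 ≤ κ ^ r * ρ
  branch : ∀ ω, BranchMap G κ A α c₀ C₁ ρ j (T ω) (d ω)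
  measurable_T : ∀ ω, Measurable (T ω)
  measurable_d : ∀ ω i, Measurable (d ω i)

theorem iter_succ' {Ω : Type*} (θ : Ω → Ω) (T : Ω → ℝ → ℝ) (n : ℕ) (ω : Ω) (x : ℝ) :
    iter θ T (n + 1) ω x = T (θ^[n] ω) (iter θ T n ω x) := by
  induction n generalizing ω x with
  | zero => rfl
  | succ n ih => exact ih (θ ω) (T ω x)

theorem iter_add {Ω : Type*} (θ : Ω → Ω) (T : Ω → ℝ → ℝ) (m n : ℕ) (ω : Ω) (x : ℝ) :
    iter θ T (m + n) ω x = iter θ T n (θ^[m] ω) (iter θ T m ω x) := by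
  induction m generalizing ω x with
  | zero => simp [iter]
  | succ m ih => rw [Nat.succ_add]; exact ih (θ ω) (T ω x)

namespace System
variable {ι Ω : Type*} (S : System ι Ω)

/-- The iterates of the system. -/
def it (n : ℕ) (ω : Ω) (x : ℝ) : ℝ := iter S.θ S.T n ω x

@[simp] theorem it_zero (ω : Ω) (x : ℝ) : S.it 0 ω x = x := rfl

theorem it_succ (n : ℕ) (ω : Ω) (x : ℝ) : S.it (n + 1) ω x = S.it n (S.θ ω) (S.T ω x) := rfl

theorem it_succ' (n : ℕ) (ω : Ω) (x : ℝ) : S.it (n + 1) ω x = S.T (S.θ^[n] ω) (S.it n ω x) :=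
  iter_succ' _ _ _ _ _

theorem it_add (m n : ℕ) (ω : Ω) (x : ℝ) :
    S.it (m + n) ω x = S.it n (S.θ^[m] ω) (S.it m ω x) := iter_add _ _ _ _ _ _

/-- The interior of a cell. -/
def ocell (i : ι) : Set ℝ := Ioo (S.G.lo i) (S.G.hi i)

/-- Closed cylinders. -/
def ccyl : List ι → Ω → Set ℝ
  | [], _ => Icc 0 1
  | i :: w, ω => {x ∈ S.G.cell i | S.T ω x ∈ ccyl w (S.θ ω)}

/-- Open cylinders. -/
def cyl : List ι → Ω → Set ℝ
  | [], _ => Ioo 0 1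
  | i :: w, ω => {x ∈ S.ocell i | S.T ω x ∈ cyl w (S.θ ω)}

/-- The (signed) derivative of the iterate along a cylinder. -/
def jac : List ι → Ω → ℝ → ℝ
  | [], _, _ => 1
  | i :: w, ω, x => S.d ω i x * jac w (S.θ ω) (S.T ω x)

/-- Points whose whole orbit stays in the open cells. -/
def reg (ω : Ω) : Set ℝ := {x | ∀ n, ∃ i, S.it n ω x ∈ S.ocell i}

theorem A_pos : 0 < S.A := zero_lt_one.trans S.one_lt_A
theorem κ_pos : 0 < S.κ := zero_lt_one.trans S.one_lt_κ

theorem ocell_subset (i : ι) : S.ocell i ⊆ S.G.cell i := Ioo_subset_Icc_self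

theorem ocell_subset_unit (i : ι) : S.ocell i ⊆ Ioo 0 1 := fun _ hx =>
  ⟨(S.G.lo_nonneg i).trans_lt hx.1, hx.2.trans_le (S.G.hi_le_one i)⟩

theorem ocell_inj {i k : ι} {x : ℝ} (hi : x ∈ S.ocell i) (hk : x ∈ S.ocell k) : i = k := by
  by_contra h
  exact (S.G.disjoint_interiors h).le_bot ⟨hi, hk⟩

theorem not_mem_cell {i k : ι} (h : i ≠ k) {x : ℝ} (hi : x ∈ S.ocell i) : x ∉ S.G.cell k := by
  intro hx
  have hd : Disjoint (Ioo (S.G.lo i) (S.G.hi i)) (Ioo (S.G.lo k) (S.G.hi k)) :=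
    S.G.disjoint_interiors h
  have h2 := S.G.lo_lt_hi k
  rw [Set.disjoint_iff_inter_eq_empty, Ioo_inter_Ioo, Ioo_eq_empty_iff] at hd
  apply hd
  exact max_lt (lt_min (hi.1.trans hi.2) (hi.1.trans_le hx.2)) (lt_min (hx.1.trans_lt hi.2) h2)

theorem strict (ω : Ω) (i : ι) :
    StrictMonoOn (S.T ω) (S.G.cell i) ∨ StrictAntiOn (S.T ω) (S.G.cell i) :=
  ((S.branch ω).continuousOn i).strictMonoOn_of_injOn_Icc' (S.G.lo_lt_hi i).le
    ((S.branch ω).bijOn i).injOn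

theorem T_mem_unit {ω : Ω} {i : ι} {x : ℝ} (hx : x ∈ S.G.cell i) : S.T ω x ∈ Icc (0 : ℝ) 1 :=
  ((S.branch ω).bijOn i).mapsTo hx

theorem strictMonoOn_i0 (ω : Ω) : StrictMonoOn (S.T ω) (S.G.cell S.G.i0) := by
  rcases S.strict ω S.G.i0 with hs | hs
  · exact hs
  · have h1 : (0 : ℝ) < S.G.hi S.G.i0 := by have := S.G.lo_lt_hi S.G.i0; rwa [S.G.lo_i0] at this
    have h2 : S.G.hi S.G.i0 ∈ S.G.cell S.G.i0 := right_mem_Icc.2 (S.G.lo_lt_hi _).le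
    have := hs S.G.zero_mem_cell_i0 h2 h1
    rw [(S.branch ω).map_zero] at this
    linarith [(S.T_mem_unit (ω := ω) h2).1]

/-- The properties of an iterate along a closed cylinder. -/
structure CylFacts (w : List ι) (ω : Ω) : Prop where
  ord : (S.ccyl w ω).OrdConnected
  closed : IsClosed (S.ccyl w ω)
  bij : BijOn (S.it w.length ω) (S.ccyl w ω) (Icc 0 1)
  strict : StrictMonoOn (S.it w.length ω) (S.ccyl w ω) ∨ StrictAntiOn (S.it w.length ω) (S.ccyl w ω)
  deriv : ∀ x ∈ S.ccyl w ω, HasDerivWithinAt (S.it w.length ω) (S.jac w ω x) (S.ccyl w ω) x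
  koebe : KoebeOn (S.it w.length ω) (S.jac w ω) (S.ccyl w ω)

/-- The quantity |f'(x)| (q−x)² / (f(q)−f(x))² is multiplicative under composition, so its
monotonicity towards q is inherited. -/
theorem _root_.CritFinite.KoebeOn.comp {f df g dg : ℝ → ℝ} {X Y : Set ℝ} (hf : KoebeOn f df X)
    (hg : KoebeOn g dg Y) (hXY : MapsTo f X Y) (hinj : InjOn f X)
    (hbt : ∀ x ∈ X, ∀ x' ∈ X, ∀ q ∈ X, x' ∈ uIcc x q → f x' ∈ uIcc (f x) (f q)) :
    KoebeOn (g ∘ f) (fun x => df x * dg (f x)) X := by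
  intro x hx x' hx' q hq hb
  rcases eq_or_ne x' q with rfl | h1
  · simp
  rcases eq_or_ne x q with rfl | h2
  · simp only [uIcc_self, mem_singleton_iff] at hb; exact absurd hb h1
  have a1 := hf x hx x' hx' q hq hb
  have a2 := hg _ (hXY hx) _ (hXY hx') _ (hXY hq) (hbt x hx x' hx' q hq hb)
  have e1 : 0 < (f q - f x') ^ 2 := by
    have : f q - f x' ≠ 0 := sub_ne_zero.2 fun h => h1 (hinj hx' hq h.symm)
    positivity
  have e2 : 0 < (f q - f x) ^ 2 := by
    have : f q - f x ≠ 0 := sub_ne_zero.2 fun h => h2 (hinj hx hq h.symm)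
    positivity
  have a3 := mul_le_mul a1 a2 (by positivity) (by positivity)
  simp only [Function.comp_apply, abs_mul]
  refine le_of_mul_le_mul_right ?_ (mul_pos e1 e2)
  calc _ = _ := ?_
    _ ≤ _ := a3
    _ = _ := ?_
  · ring
  · ring

theorem cylFacts (w : List ι) (ω : Ω) : S.CylFacts w ω := by
  induction w generalizing ω with
  | nil =>
    refine ⟨ordConnected_Icc, isClosed_Icc, bijOn_id _, Or.inl strictMonoOn_id,
      fun x _ => hasDerivWithinAt_id _ _, fun x _ x' _ q _ _ => ?_⟩
    simp only [jac, List.length_nil, it_zero]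
    apply le_of_eq; ring
  | cons i w ih =>
    have hw := ih (S.θ ω)
    have hB := S.branch ω
    have hsub : S.ccyl (i :: w) ω ⊆ S.G.cell i := fun x hx => hx.1
    have hmaps : MapsTo (S.T ω) (S.ccyl (i :: w) ω) (S.ccyl w (S.θ ω)) := fun x hx => hx.2
    have hbij : BijOn (S.T ω) (S.ccyl (i :: w) ω) (S.ccyl w (S.θ ω)) := by
      refine ⟨hmaps, (hB.bijOn i).injOn.mono hsub, fun y hy => ?_⟩
      have hy1 : y ∈ Icc (0 : ℝ) 1 := by
        cases w with
        | nil => exact hy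
        | cons k w => exact S.G.cell_subset k hy.1
      obtain ⟨x, hx, rfl⟩ := (hB.bijOn i).surjOn hy1
      exact ⟨x, ⟨hx, hy⟩, rfl⟩
    have hst := S.strict ω i
    have hbt : ∀ x ∈ S.G.cell i, ∀ x' ∈ S.G.cell i, ∀ q ∈ S.G.cell i, x' ∈ uIcc x q →
        S.T ω x' ∈ uIcc (S.T ω x) (S.T ω q) := by
      intro x hx x' hx' q hq hb
      rw [mem_uIcc] at hb ⊢
      rcases hst with h | h
      · rcases hb with ⟨h1, h2⟩ | ⟨h1, h2⟩
        · exact Or.inl ⟨h.monotoneOn hx hx' h1, h.monotoneOn hx' hq h2⟩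
        · exact Or.inr ⟨h.monotoneOn hq hx' h1, h.monotoneOn hx' hx h2⟩
      · rcases hb with ⟨h1, h2⟩ | ⟨h1, h2⟩
        · exact Or.inr ⟨h.antitoneOn hx' hq h2, h.antitoneOn hx hx' h1⟩
        · exact Or.inl ⟨h.antitoneOn hx' hx h2, h.antitoneOn hq hx' h1⟩
    refine ⟨?_, ?_, hw.bij.comp hbij, ?_, ?_, ?_⟩
    · refine ⟨fun x hx y hy z hz => ?_⟩
      have hzc : z ∈ S.G.cell i := ordConnected_Icc.out hx.1 hy.1 hz
      refine ⟨hzc, hw.ord.uIcc_subset hx.2 hy.2 ?_⟩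
      exact hbt x hx.1 z hzc y hy.1 (mem_uIcc.2 (Or.inl hz))
    · have := (hB.continuousOn i).preimage_isClosed_of_isClosed isClosed_Icc hw.closed
      exact this
    · rcases hst with h | h <;> rcases hw.strict with h' | h'
      · exact Or.inl (h'.comp (h.mono hsub) hmaps)
      · exact Or.inr (h'.comp_strictMonoOn (h.mono hsub) hmaps)
      · exact Or.inr (h'.comp_strictAntiOn (h.mono hsub) hmaps)
      · exact Or.inl (h'.comp (h.mono hsub) hmaps)
    · intro x hx
      have := (hw.deriv _ hx.2).comp x ((hB.hasDeriv i x hx.1).mono hsub) hmaps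
      refine this.congr_deriv ?_
      simp only [jac]; ring
    · have h1 : KoebeOn (S.T ω) (S.d ω i) (S.ccyl (i :: w) ω) :=
        fun x hx x' hx' q hq hb => hB.koebe i x hx.1 x' hx'.1 q hq.1 hb
      exact h1.comp hw.koebe hmaps hbij.injOn
        fun x hx x' hx' q hq hb => hbt x hx.1 x' hx'.1 q hq.1 hb

theorem ccyl_subset_unit (w : List ι) (ω : Ω) : S.ccyl w ω ⊆ Icc 0 1 := by
  cases w with
  | nil => exact subset_rfl
  | cons k w => exact fun x hx => S.G.cell_subset k hx.1

theorem cyl_subset_ccyl (w : List ι) (ω : Ω) : S.cyl w ω ⊆ S.ccyl w ω := by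
  induction w generalizing ω with
  | nil => exact Ioo_subset_Icc_self
  | cons k w ih => exact fun x hx => ⟨S.ocell_subset k hx.1, ih _ hx.2⟩

variable {S}

theorem CylFacts.between {w : List ι} {ω : Ω} (h : S.CylFacts w ω) {x y z : ℝ}
    (hx : x ∈ S.ccyl w ω) (hy : y ∈ S.ccyl w ω) (hz : z ∈ S.ccyl w ω) :
    z ∈ uIcc x y ↔ S.it w.length ω z ∈ uIcc (S.it w.length ω x) (S.it w.length ω y) := by
  rw [mem_uIcc, mem_uIcc]
  rcases h.strict with h | h
  · rw [h.le_iff_le hx hz, h.le_iff_le hz hy, h.le_iff_le hy hz, h.le_iff_le hz hx]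
  · rw [h.le_iff_ge hx hz, h.le_iff_ge hz hy, h.le_iff_ge hy hz, h.le_iff_ge hz hx]
    tauto

/-- The derivative of the iterate at `x'` dominates the one at points `x` on the far side of a
reference point `q`. -/
theorem CylFacts.jac_le {w : List ι} {ω : Ω} (h : S.CylFacts w ω) {δ x x' q : ℝ}
    (hδ : 0 < δ) (hx : x ∈ S.ccyl w ω) (hx' : x' ∈ S.ccyl w ω) (hq : q ∈ S.ccyl w ω)
    (hb : S.it w.length ω x' ∈ uIcc (S.it w.length ω x) (S.it w.length ω q))
    (hd : δ ≤ |S.it w.length ω q - S.it w.length ω x'|) :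
    δ ^ 2 * |S.jac w ω x| ≤ |S.jac w ω x'| := by
  have hb' := (h.between hx hq hx').2 hb
  have key := h.koebe x hx x' hx' q hq hb'
  have hxq : x ≠ q := by
    rintro rfl
    rw [uIcc_self, mem_singleton_iff] at hb
    rw [hb, sub_self, abs_zero] at hd
    linarith
  set F := S.it w.length ω
  have e1 : (q - x') ^ 2 ≤ (q - x) ^ 2 := by
    rw [sq_le_sq]
    rw [mem_uIcc] at hb'
    rcases hb' with ⟨h1, h2⟩ | ⟨h1, h2⟩
    · rw [abs_of_nonneg (by linarith), abs_of_nonneg (by linarith)]; linarith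
    · rw [abs_of_nonpos (by linarith), abs_of_nonpos (by linarith)]; linarith
  have e2 : (F q - F x) ^ 2 ≤ 1 := by
    rw [sq_le_one_iff_abs_le_one, abs_le]
    have h1 := h.bij.mapsTo hq
    have h2 := h.bij.mapsTo hx
    constructor <;> linarith [h1.1, h1.2, h2.1, h2.2]
  have e3 : δ ^ 2 ≤ (F q - F x') ^ 2 := by rw [← sq_abs (F q - F x')]; gcongr
  have e4 : 0 < (q - x) ^ 2 := by
    have := sub_ne_zero.2 hxq.symm
    positivity
  refine le_of_mul_le_mul_right ?_ e4
  calc δ ^ 2 * |S.jac w ω x| * (q - x) ^ 2 = |S.jac w ω x| * (q - x) ^ 2 * δ ^ 2 := by ring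
    _ ≤ |S.jac w ω x| * (q - x) ^ 2 * (F q - F x') ^ 2 := by gcongr
    _ ≤ _ := key
    _ ≤ |S.jac w ω x'| * (q - x) ^ 2 * 1 := by gcongr
    _ = _ := by ring

/-- The reference point is the preimage of the end of [0,1] on the other side of x' from x; the
image of x' is at distance at least δ from either end. -/
theorem CylFacts.distortion {w : List ι} {ω : Ω} (h : S.CylFacts w ω) {δ x x' : ℝ}
    (hδ : 0 < δ) (hx : x ∈ S.ccyl w ω) (hx' : x' ∈ S.ccyl w ω)
    (hd : S.it w.length ω x' ∈ Icc δ (1 - δ)) :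
    δ ^ 2 * |S.jac w ω x| ≤ |S.jac w ω x'| := by
  have hFx := h.bij.mapsTo hx
  rcases le_total (S.it w.length ω x) (S.it w.length ω x') with hle | hle
  · obtain ⟨q, hq, hFq⟩ := h.bij.surjOn (right_mem_Icc.2 zero_le_one)
    refine h.jac_le hδ hx hx' hq ?_ ?_
    · rw [hFq]; exact mem_uIcc.2 (Or.inl ⟨hle, by linarith [hd.2]⟩)
    · rw [hFq, abs_of_nonneg] <;> linarith [hd.2]
  · obtain ⟨q, hq, hFq⟩ := h.bij.surjOn (left_mem_Icc.2 zero_le_one)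
    refine h.jac_le hδ hx hx' hq ?_ ?_
    · rw [hFq]; exact mem_uIcc.2 (Or.inr ⟨by linarith [hd.1], hle⟩)
    · rw [hFq, zero_sub, abs_neg, abs_of_nonneg] <;> linarith [hd.1]

theorem CylFacts.abs_sub_le {w : List ι} {ω : Ω} (h : S.CylFacts w ω) {x y M : ℝ}
    (hx : x ∈ S.ccyl w ω) (hy : y ∈ S.ccyl w ω) (hM : ∀ z ∈ uIcc x y, |S.jac w ω z| ≤ M) :
    |S.it w.length ω y - S.it w.length ω x| ≤ M * |y - x| := by
  have hsub := h.ord.uIcc_subset hx hy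
  exact (convex_uIcc x y).norm_image_sub_le_of_norm_hasDerivWithin_le
    (fun z hz => (h.deriv z (hsub hz)).mono hsub) hM left_mem_uIcc right_mem_uIcc

theorem CylFacts.le_abs_sub {w : List ι} {ω : Ω} (h : S.CylFacts w ω) {x y M : ℝ}
    (hx : x ∈ S.ccyl w ω) (hy : y ∈ S.ccyl w ω) (hM : ∀ z ∈ uIcc x y, M ≤ |S.jac w ω z|) :
    M * |y - x| ≤ |S.it w.length ω y - S.it w.length ω x| := by
  wlog hxy : x < y generalizing x y
  · rcases eq_or_lt_of_le (not_lt.1 hxy) with rfl | hlt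
    · simp
    · rw [abs_sub_comm, abs_sub_comm (S.it _ _ y)]
      exact this hy hx (by rwa [uIcc_comm]) hlt
  have hsub : Icc x y ⊆ S.ccyl w ω := h.ord.out hx hy
  obtain ⟨z, hz, hz'⟩ := exists_hasDerivAt_eq_slope (S.it w.length ω) (S.jac w ω) hxy
    (fun z hz => (h.deriv z (hsub hz)).continuousWithinAt.mono hsub)
    (fun z hz => ((h.deriv z (hsub (Ioo_subset_Icc_self hz))).mono hsub).hasDerivAt
      (Icc_mem_nhds hz.1 hz.2))
  have h1 := hM z (by rw [uIcc_of_le hxy.le]; exact Ioo_subset_Icc_self hz)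
  have h2 : 0 < y - x := sub_pos.2 hxy
  rwa [hz', abs_div, abs_of_pos h2, le_div_iff₀ h2, ← abs_of_pos h2] at h1

end System
-- Itineraries, the set K, and growth along excursions near the ends
namespace System
variable {ι Ω : Type*} (S : System ι Ω)

theorem mem_reg_iff {ω : Ω} {x : ℝ} :
    x ∈ S.reg ω ↔ (∃ i, x ∈ S.ocell i) ∧ S.T ω x ∈ S.reg (S.θ ω) :=
  ⟨fun h => ⟨h 0, fun n => h (n + 1)⟩, fun h n => by
    cases n with
    | zero => exact h.1
    | succ n => exact h.2 n⟩

theorem it_mem_reg {ω : Ω} {x : ℝ} (h : x ∈ S.reg ω) (n : ℕ) :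
    S.it n ω x ∈ S.reg (S.θ^[n] ω) := fun k => by
  rw [← S.it_add]; exact h (n + k)

theorem reg_subset_unit (ω : Ω) : S.reg ω ⊆ Ioo 0 1 := fun _ hx =>
  let ⟨i, hi⟩ := hx 0
  S.ocell_subset_unit i hi

theorem cyl_subset_unit (w : List ι) (ω : Ω) : S.cyl w ω ⊆ Ioo 0 1 := by
  cases w with
  | nil => exact subset_rfl
  | cons k w => exact fun x hx => S.ocell_subset_unit k hx.1

open Classical in
/-- The index of the open cell containing a point. -/
def sym (x : ℝ) : ι := if h : ∃ i, x ∈ S.ocell i then h.choose else S.G.i0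

theorem sym_eq {i : ι} {x : ℝ} (h : x ∈ S.ocell i) : S.sym x = i := by
  have h' : ∃ i, x ∈ S.ocell i := ⟨i, h⟩
  rw [sym, dif_pos h']
  exact S.ocell_inj h'.choose_spec h

/-- The word of the first `n` cells visited by a point. -/
def itin : ℕ → Ω → ℝ → List ι
  | 0, _, _ => []
  | n + 1, ω, x => S.sym x :: itin n (S.θ ω) (S.T ω x)

@[simp] theorem length_itin (n : ℕ) (ω : Ω) (x : ℝ) : (S.itin n ω x).length = n := by
  induction n generalizing ω x with
  | zero => rfl
  | succ n ih => simp [itin, ih]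

theorem mem_cyl_itin {ω : Ω} {x : ℝ} (h : x ∈ S.reg ω) (n : ℕ) : x ∈ S.cyl (S.itin n ω x) ω := by
  induction n generalizing ω x with
  | zero => exact S.reg_subset_unit _ h
  | succ n ih =>
    obtain ⟨⟨i, hi⟩, h2⟩ := S.mem_reg_iff.1 h
    exact ⟨by rw [S.sym_eq hi]; exact hi, ih h2⟩

theorem itin_eq {w : List ι} {ω : Ω} {x : ℝ} (h : x ∈ S.cyl w ω) : S.itin w.length ω x = w := by
  induction w generalizing ω x with
  | nil => rfl
  | cons i w ih => simp only [List.length_cons, itin, S.sym_eq h.1, ih h.2]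

theorem itin_add (m n : ℕ) (ω : Ω) (x : ℝ) :
    S.itin (m + n) ω x = S.itin m ω x ++ S.itin n (S.θ^[m] ω) (S.it m ω x) := by
  induction m generalizing ω x with
  | zero => simp [itin]
  | succ m ih => rw [Nat.succ_add]; simp only [itin, ih]; rfl

theorem mem_cyl_append {u v : List ι} {ω : Ω} {x : ℝ} :
    x ∈ S.cyl (u ++ v) ω ↔ x ∈ S.cyl u ω ∧ S.it u.length ω x ∈ S.cyl v (S.θ^[u.length] ω) := by
  induction u generalizing ω x with
  | nil => exact ⟨fun h => ⟨S.cyl_subset_unit _ _ h, h⟩, fun h => h.2⟩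
  | cons i u ih => simp only [List.cons_append, cyl, mem_ofPred_eq, ih, and_assoc]; rfl

theorem mem_ccyl_append {u v : List ι} {ω : Ω} {x : ℝ} :
    x ∈ S.ccyl (u ++ v) ω ↔ x ∈ S.ccyl u ω ∧ S.it u.length ω x ∈ S.ccyl v (S.θ^[u.length] ω) := by
  induction u generalizing ω x with
  | nil => exact ⟨fun h => ⟨S.ccyl_subset_unit _ _ h, h⟩, fun h => h.2⟩
  | cons i u ih => simp only [List.cons_append, ccyl, mem_ofPred_eq, ih, and_assoc]; rfl

/-- The word `0ᵏ`. -/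
abbrev rep (k : ℕ) : List ι := List.replicate k S.G.i0

theorem zero_mem_ccyl (k : ℕ) (ω : Ω) : (0 : ℝ) ∈ S.ccyl (S.rep k) ω := by
  induction k generalizing ω with
  | zero => exact ⟨le_rfl, zero_le_one⟩
  | succ k ih => exact ⟨S.G.zero_mem_cell_i0, by rw [(S.branch ω).map_zero]; exact ih _⟩

theorem cyl_rep_anti {k l : ℕ} (h : k ≤ l) (ω : Ω) : S.cyl (S.rep l) ω ⊆ S.cyl (S.rep k) ω := by
  obtain ⟨m, rfl⟩ := Nat.exists_eq_add_of_le h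
  intro x hx
  rw [rep, List.replicate_add] at hx
  exact (S.mem_cyl_append.1 hx).1

/-- `a = αt`. -/
def a : ℝ := S.t * S.α

/-- `t - a`. -/
def β : ℝ := S.t * (1 - S.α)

theorem a_pos : 0 < S.a := mul_pos S.t_pos S.α_pos
theorem β_pos : 0 < S.β := mul_pos S.t_pos (sub_pos.2 S.α_lt_one)
theorem a_add_β : S.a + S.β = S.t := by unfold a β; ring

theorem κ_le_d_zero (ω : Ω) : S.κ ≤ |S.d ω S.G.i0 0| :=
  (S.branch ω).expand_zero 0 S.G.zero_mem_cell_i0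
    (by rw [(S.branch ω).map_zero]; exact S.G.zero_mem_cell_i0)

theorem d_zero_le (ω : Ω) : |S.d ω S.G.i0 0| ≤ S.A := (S.branch ω).deriv_le _ _ S.G.zero_mem_cell_i0

/-- The product of the derivatives at the fixed point `0`, to the power `t - a`. -/
def P (n : ℕ) (ω : Ω) : ℝ := ∏ k ∈ Finset.range n, |S.d (S.θ^[k] ω) S.G.i0 0| ^ S.β

theorem P_succ' (n : ℕ) (ω : Ω) : S.P (n + 1) ω = |S.d ω S.G.i0 0| ^ S.β * S.P n (S.θ ω) := by
  rw [P, Finset.prod_range_succ', mul_comm]; rfl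

theorem P_add (m n : ℕ) (ω : Ω) : S.P (m + n) ω = S.P m ω * S.P n (S.θ^[m] ω) := by
  rw [P, Finset.prod_range_add]
  simp only [P, ← Function.iterate_add_apply, add_comm]

theorem P_pos (n : ℕ) (ω : Ω) : 0 < S.P n ω := Finset.prod_pos fun _ _ =>
  Real.rpow_pos_of_pos (S.κ_pos.trans_le (S.κ_le_d_zero _)) _

theorem P_eq (n : ℕ) (ω : Ω) : S.P n ω = |S.jac (S.rep n) ω 0| ^ S.β := by
  induction n generalizing ω with
  | zero => simp [P, jac]
  | succ n ih =>
    rw [P_succ', ih, show S.rep (n + 1) = S.G.i0 :: S.rep n from rfl]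
    simp only [jac, (S.branch ω).map_zero]
    rw [abs_mul, Real.mul_rpow (abs_nonneg _) (abs_nonneg _)]

theorem P_succ_le (n : ℕ) (ω : Ω) : S.P (n + 1) ω ≤ S.A ^ S.β * S.P n (S.θ ω) := by
  rw [P_succ']
  have := S.P_pos n (S.θ ω)
  have := S.β_pos
  gcongr
  exact S.d_zero_le ω

variable {S}

theorem κ_mul_le {ω : Ω} {x : ℝ} (h1 : x ∈ S.G.cell S.G.i0) (h2 : S.T ω x ∈ S.G.cell S.G.i0) :
    S.κ * x ≤ S.T ω x := by
  have hw := S.cylFacts [S.G.i0] ω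
  have hmem : ∀ z ∈ S.G.cell S.G.i0, z ∈ S.ccyl [S.G.i0] ω := fun z hz => ⟨hz, S.T_mem_unit hz⟩
  have hx0 := (S.G.cell_subset _ h1).1
  have := hw.le_abs_sub (hmem 0 S.G.zero_mem_cell_i0) (hmem x h1) (M := S.κ) fun z hz => by
    rw [uIcc_of_le hx0] at hz
    have hz1 : z ∈ S.G.cell S.G.i0 := ordConnected_Icc.out S.G.zero_mem_cell_i0 h1 hz
    simp only [jac, mul_one]
    refine (S.branch ω).expand_zero z hz1 ⟨?_, ?_⟩
    · rw [S.G.lo_i0]; exact (S.T_mem_unit hz1).1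
    · exact ((S.strictMonoOn_i0 ω).monotoneOn hz1 h1 hz.2).trans h2.2
  simp only [List.length_singleton, it_succ, it_zero, (S.branch ω).map_zero, sub_zero] at this
  rwa [abs_of_nonneg hx0, abs_of_nonneg (S.T_mem_unit h1).1] at this

/-- A step expands by κ if the point and its image are both in Δ₀; hence k steps need k + 1 letters.
-/
theorem pow_mul_le_it {k : ℕ} {ω : Ω} {x : ℝ} (h : x ∈ S.ccyl (S.rep (k + 1)) ω) :
    S.κ ^ k * x ≤ S.it k ω x := by
  induction k generalizing ω x with
  | zero => simp
  | succ k ih =>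
    have h2 := ih h.2
    have h3 := κ_mul_le h.1 h.2.1
    have := S.κ_pos
    calc S.κ ^ (k + 1) * x = S.κ ^ k * (S.κ * x) := by ring
      _ ≤ S.κ ^ k * S.T ω x := by gcongr
      _ ≤ _ := h2

theorem pow_le_jac_rep {k : ℕ} {ω : Ω} {x : ℝ} (h : x ∈ S.ccyl (S.rep (k + 1)) ω) :
    S.κ ^ k ≤ |S.jac (S.rep k) ω x| := by
  induction k generalizing ω x with
  | zero => simp [jac]
  | succ k ih =>
    have h2 := ih h.2
    have h3 := (S.branch ω).expand_zero x h.1 h.2.1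
    have := S.κ_pos
    simp only [rep, List.replicate_succ, jac, abs_mul]
    rw [pow_succ']
    gcongr

theorem pow_mul_le_one {k : ℕ} {ω : Ω} {x : ℝ} (h : x ∈ S.ccyl (S.rep (k + 1)) ω) :
    S.κ ^ k * x ≤ 1 := by
  refine (pow_mul_le_it h).trans ?_
  rw [rep, List.replicate_succ', mem_ccyl_append, List.length_replicate] at h
  exact (S.G.cell_subset _ h.2.1).2

theorem le_ρ {ω : Ω} {x : ℝ} (h : x ∈ S.cyl (S.rep (S.r + 1)) ω) : x ≤ S.ρ := by
  have h1 := pow_mul_le_one (S.cyl_subset_ccyl _ _ h)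
  have h2 := S.depth
  have h3 : 0 < S.κ ^ S.r := pow_pos S.κ_pos _
  exact le_of_mul_le_mul_left (h1.trans h2) h3

theorem T_le_mul {ω : Ω} {i : ι} {x y : ℝ} (hx : x ∈ S.G.cell i) (hy : y ∈ S.G.cell i) :
    |S.T ω y - S.T ω x| ≤ S.A * |y - x| :=
  (convex_Icc _ _).norm_image_sub_le_of_norm_hasDerivWithin_le
    (fun _ hz => (S.branch ω).hasDeriv i _ hz) (fun z hz => (S.branch ω).deriv_le i z hz) hx hy

theorem T_le_mul_i0 {ω : Ω} {x : ℝ} (hx : x ∈ S.G.cell S.G.i0) : S.T ω x ≤ S.A * x := by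
  have := T_le_mul (ω := ω) S.G.zero_mem_cell_i0 hx
  rwa [(S.branch ω).map_zero, sub_zero, sub_zero, abs_of_nonneg (S.T_mem_unit hx).1,
    abs_of_nonneg (S.G.cell_subset _ hx).1] at this

theorem T_le_mul_i1 {ω : Ω} {x : ℝ} (hx : x ∈ S.G.cell S.G.i1) : S.T ω x ≤ S.A * (1 - x) := by
  have := T_le_mul (ω := ω) S.G.one_mem_cell_i1 hx
  rwa [(S.branch ω).map_one, sub_zero, abs_of_nonneg (S.T_mem_unit hx).1, abs_sub_comm,
    abs_of_nonneg (sub_nonneg.2 (S.G.cell_subset _ hx).2)] at this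

variable (S)

/-- Points close to `0`. -/
def bad0 (ω : Ω) : Set ℝ := S.cyl (S.rep (S.r + 3)) ω

/-- Points close to `1`. -/
def bad1 (ω : Ω) : Set ℝ := S.cyl (S.G.i1 :: S.rep (S.r + 3)) ω

/-- Points close to the ends of the unit interval. -/
def bad (ω : Ω) : Set ℝ := S.bad0 ω ∪ S.bad1 ω

/-- Regular points away from the ends of the unit interval. -/
def K (ω : Ω) : Set ℝ := S.reg ω \ S.bad ω

/-- The distance from `K` to the ends. -/
def δ : ℝ := min (1 / 2) (min (S.G.hi S.G.i0 / S.A ^ (S.r + 4)) (S.G.len S.G.i1))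

/-- The distance to the ends of the unit interval. -/
def e (y : ℝ) : ℝ := min y (1 - y)

variable {S}

theorem hi_i0_pos : 0 < S.G.hi S.G.i0 := by
  have := S.G.lo_lt_hi S.G.i0; rwa [S.G.lo_i0] at this

theorem δ_pos : 0 < S.δ := by
  have := S.A_pos
  have := hi_i0_pos (S := S)
  have h : 0 < S.G.len S.G.i1 := sub_pos.2 (S.G.lo_lt_hi _)
  unfold δ; positivity

theorem bad0_subset {ω : Ω} {x : ℝ} (h : x ∈ S.bad0 ω) : x ∈ S.ocell S.G.i0 ∧ x ≤ S.ρ :=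
  ⟨h.1, le_ρ (S.cyl_rep_anti (by omega) ω h)⟩

theorem T_bad1 {ω : Ω} {x : ℝ} (h : x ∈ S.bad1 ω) : S.T ω x ∈ S.bad0 (S.θ ω) := h.2

theorem T_bad0 {ω : Ω} {x : ℝ} (h : x ∈ S.bad0 ω) (h' : S.T ω x ∈ S.bad (S.θ ω)) :
    S.T ω x ∈ S.bad0 (S.θ ω) := by
  rcases h' with h' | h'
  · exact h'
  · exact absurd (S.ocell_inj h.2.1 h'.1) S.G.i0_ne_i1

theorem T_bad {ω : Ω} {x : ℝ} (h : x ∈ S.bad ω) (h' : S.T ω x ∈ S.bad (S.θ ω)) :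
    S.T ω x ∈ S.bad0 (S.θ ω) := h.elim (fun h => T_bad0 h h') T_bad1

/-- The distance to the fixed point 0 grows at most by the factor A per step, so a small enough
regular point stays k steps in Δ₀. -/
theorem mem_cyl_rep_of_small {k : ℕ} {ω : Ω} {x : ℝ} (hx : x ∈ S.reg ω)
    (h : S.A ^ k * x < S.G.hi S.G.i0) : x ∈ S.cyl (S.rep k) ω := by
  induction k generalizing ω x with
  | zero => exact S.reg_subset_unit _ hx
  | succ k ih =>
    have hx0 := (S.reg_subset_unit _ hx).1
    have hA := S.one_lt_A
    have h1 : x ∈ S.ocell S.G.i0 := by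
      refine ⟨by rw [S.G.lo_i0]; exact hx0, lt_of_le_of_lt ?_ h⟩
      exact le_mul_of_one_le_left hx0.le (one_le_pow₀ hA.le)
    refine ⟨h1, ih (S.mem_reg_iff.1 hx).2 (lt_of_le_of_lt ?_ h)⟩
    have := T_le_mul_i0 (ω := ω) (S.ocell_subset _ h1)
    rw [pow_succ, mul_assoc]
    gcongr

theorem K_subset (ω : Ω) : S.K ω ⊆ Icc S.δ (1 - S.δ) := by
  intro x hx
  have hA := S.A_pos
  have hA1 := S.one_lt_A
  have hu := S.reg_subset_unit _ hx.1
  -- The factor A beyond δ is what the bound at the other end needs: there the estimate is applied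
  -- to the image, and T x ≤ A (1 − x).
  have key : ∀ {ω : Ω} {y : ℝ}, y ∈ S.reg ω → y ∉ S.bad0 ω → S.A * S.δ ≤ y := by
    intro ω y hy hb
    by_contra hlt
    push Not at hlt
    apply hb
    refine mem_cyl_rep_of_small hy ?_
    have h1 : S.δ ≤ S.G.hi S.G.i0 / S.A ^ (S.r + 4) := (min_le_right _ _).trans (min_le_left _ _)
    rw [le_div_iff₀ (by positivity)] at h1
    calc S.A ^ (S.r + 3) * y < S.A ^ (S.r + 3) * (S.A * S.δ) := by gcongr
      _ = S.δ * S.A ^ (S.r + 4) := by ring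
      _ ≤ _ := h1
  have hδ := δ_pos (S := S)
  refine ⟨?_, ?_⟩
  · have := key hx.1 fun h => hx.2 (Or.inl h)
    nlinarith
  · obtain ⟨⟨i, hi⟩, h2⟩ := S.mem_reg_iff.1 hx.1
    by_cases h : i = S.G.i1
    · subst h
      have h1 := key h2 fun h => hx.2 (Or.inr ⟨hi, h⟩)
      have h3 := T_le_mul_i1 (ω := ω) (S.ocell_subset _ hi)
      have := le_of_mul_le_mul_left (h1.trans h3) hA
      linarith
    · have h1 : x ∉ S.G.cell S.G.i1 := S.not_mem_cell h hi
      have h2 : x < S.G.lo S.G.i1 := by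
        by_contra h3
        exact h1 ⟨not_lt.1 h3, by rw [S.G.hi_i1]; exact hu.2.le⟩
      have h3 : S.δ ≤ S.G.len S.G.i1 := (min_le_right _ _).trans (min_le_right _ _)
      unfold IntervalFamily.len at h3
      rw [S.G.hi_i1] at h3
      linarith

theorem it_mem_bad0 {ω : Ω} {x : ℝ} (h0 : x ∈ S.bad0 ω) {k : ℕ}
    (h : ∀ l ≤ k, S.it l ω x ∈ S.bad (S.θ^[l] ω)) : S.it k ω x ∈ S.bad0 (S.θ^[k] ω) := by
  induction k with
  | zero => exact h0
  | succ k ih =>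
    have h1 := ih fun l hl => h l (by omega)
    have h2 := h (k + 1) le_rfl
    rw [S.it_succ', Function.iterate_succ_apply'] at h2 ⊢
    exact T_bad0 h1 h2

theorem mem_cyl_rep {k : ℕ} {ω : Ω} {x : ℝ} (hx : x ∈ S.reg ω)
    (h : ∀ l ≤ k, S.it l ω x ∈ S.ocell S.G.i0) : x ∈ S.cyl (S.rep (k + 1)) ω := by
  induction k generalizing ω x with
  | zero => exact ⟨h 0 le_rfl, S.reg_subset_unit _ (S.mem_reg_iff.1 hx).2⟩
  | succ k ih => exact ⟨h 0 (by omega), ih (S.mem_reg_iff.1 hx).2 fun l hl => h (l + 1) (by omega)⟩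

theorem mem_bad_of_not_mem_K {ω : Ω} {x : ℝ} (hx : x ∈ S.reg ω) (h : x ∉ S.K ω) : x ∈ S.bad ω := by
  by_contra h'
  exact h ⟨hx, h'⟩

/-- An orbit that never meets K stays in Δ₀ from time 1 on, while expansion by κ pushes every
positive point out of Δ₀. -/
theorem exists_visit {ω : Ω} {x : ℝ} (hx : x ∈ S.reg ω) : ∃ n, S.it n ω x ∈ S.K (S.θ^[n] ω) := by
  by_contra! hK
  have hbad : ∀ n, S.it n ω x ∈ S.bad (S.θ^[n] ω) := fun n =>
    mem_bad_of_not_mem_K (S.it_mem_reg hx n) (hK n)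
  have h1 : S.T ω x ∈ S.bad0 (S.θ ω) := T_bad (hbad 0) (hbad 1)
  have hreg := (S.mem_reg_iff.1 hx).2
  have h2 : ∀ k, S.T ω x ∈ S.cyl (S.rep (k + 1)) (S.θ ω) := fun k =>
    mem_cyl_rep hreg fun _ _ => (it_mem_bad0 h1 fun l _ => hbad (l + 1)).1
  have h3 : 0 < S.T ω x := (S.reg_subset_unit _ hreg).1
  obtain ⟨n, hn⟩ := pow_unbounded_of_one_lt (1 / S.T ω x) S.one_lt_κ
  have h4 := pow_mul_le_one (S.cyl_subset_ccyl _ _ (h2 n))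
  rw [div_lt_iff₀ h3] at hn
  linarith

theorem exists_visit_ge {ω : Ω} {x : ℝ} (hx : x ∈ S.reg ω) (N : ℕ) :
    ∃ n ≥ N, S.it n ω x ∈ S.K (S.θ^[n] ω) := by
  obtain ⟨n, hn⟩ := exists_visit (S.it_mem_reg hx N)
  refine ⟨N + n, by omega, ?_⟩
  rw [S.it_add, add_comm N n, Function.iterate_add_apply]
  exact hn

theorem e_le_left (y : ℝ) : e y ≤ y := min_le_left _ _

theorem e_nonneg {y : ℝ} (hy : y ∈ Ioo (0 : ℝ) 1) : 0 ≤ e y := le_min hy.1.le (by linarith [hy.2])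

theorem e_pos {y : ℝ} (hy : y ∈ Ioo (0 : ℝ) 1) : 0 < e y := lt_min hy.1 (by linarith [hy.2])

theorem e_of_le {y : ℝ} (hy : y ≤ 1 / 2) : e y = y := min_eq_left (by linarith)

theorem e_of_ge {y : ℝ} (hy : 1 / 2 ≤ y) : e y = 1 - y := min_eq_right (by linarith)

theorem e_bad0 {ω : Ω} {x : ℝ} (h : x ∈ S.bad0 ω) : e x = x :=
  e_of_le ((bad0_subset h).2.trans S.ρ_le)

theorem bad1_facts {ω : Ω} {x : ℝ} (h : x ∈ S.bad1 ω) :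
    S.κ ≤ |S.d ω S.G.i1 x| ∧ 1 - x ≤ S.T ω x ∧ e x = 1 - x := by
  have h1 := (bad0_subset (T_bad1 h)).2
  obtain ⟨h2, h3⟩ := (S.branch ω).expand_one x (S.ocell_subset _ h.1) h1
  exact ⟨h2, h3, e_of_ge (by linarith [S.ρ_le])⟩

/-- Growth along the fixed point `0`. -/
theorem growth_rep {k : ℕ} {ω : Ω} {x : ℝ} (hx : x ∈ S.ccyl (S.rep k) ω) (hx0 : 0 < x)
    (hk : S.it k ω x ≤ 1 / 2) :
    4⁻¹ ^ S.t * (S.it k ω x ^ S.a * S.P k ω) ≤ |S.jac (S.rep k) ω x| ^ S.t * x ^ S.a := by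
  have hw := S.cylFacts (S.rep k) ω
  have h0 := S.zero_mem_ccyl k ω
  have hlen : (S.rep k).length = k := List.length_replicate
  have ha := S.a_pos
  have hβ := S.β_pos
  have hit0 : S.it k ω 0 = 0 := by
    clear hw h0 hk hx
    induction k generalizing ω with
    | zero => rfl
    | succ k ih =>
      rw [S.it_succ, (S.branch ω).map_zero]; exact ih List.length_replicate
  -- With the preimage q of 1 as reference point, images at most 1/2 are at distance at least 1/2
  -- from that of q, whence the constant 4.
  obtain ⟨q, hq, hFq⟩ := hw.bij.surjOn (right_mem_Icc.2 zero_le_one)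
  rw [hlen] at hFq
  have hFx := hw.bij.mapsTo hx
  rw [hlen] at hFx
  have key : ∀ ξ ∈ uIcc 0 x, |S.jac (S.rep k) ω ξ| ≤ 4 * |S.jac (S.rep k) ω x| := by
    intro ξ hξ
    have hξ' := hw.ord.uIcc_subset h0 hx hξ
    have h1 := (hw.between h0 hx hξ').1 hξ
    rw [hlen, hit0, uIcc_of_le hFx.1] at h1
    have := hw.jac_le (δ := 1 / 2) (by norm_num) hξ' hx hq
      (by rw [hlen, hFq, uIcc_of_le (by linarith [h1.2])]; exact ⟨h1.2, hFx.2⟩)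
      (by rw [hlen, hFq, abs_of_nonneg] <;> linarith)
    linarith
  have h1 := key 0 left_mem_uIcc
  have h2 := hw.abs_sub_le h0 hx key
  rw [hlen, hit0, sub_zero, sub_zero, abs_of_nonneg hFx.1, abs_of_pos hx0] at h2
  have hJ : 0 < |S.jac (S.rep k) ω x| := by
    have h3 := S.P_pos k ω
    rw [S.P_eq] at h3
    by_contra hneg
    have h4 : |S.jac (S.rep k) ω x| = 0 := le_antisymm (not_lt.1 hneg) (abs_nonneg _)
    rw [h4, mul_zero] at h1
    rw [le_antisymm h1 (abs_nonneg _), Real.zero_rpow hβ.ne'] at h3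
    exact lt_irrefl _ h3
  set J := |S.jac (S.rep k) ω x|
  set F := S.it k ω x
  -- The exponent is split as t = a + β: the power a turns x into its image by the mean value
  -- inequality, the power β is compared with the derivative at 0.
  rw [S.P_eq, ← S.a_add_β, Real.rpow_add hJ, Real.rpow_add (by norm_num)]
  have b1 : 4⁻¹ ^ S.a * F ^ S.a ≤ J ^ S.a * x ^ S.a := by
    rw [← Real.mul_rpow (by norm_num) hFx.1, ← Real.mul_rpow hJ.le hx0.le]
    refine Real.rpow_le_rpow (mul_nonneg (by norm_num) hFx.1) ?_ ha.le
    linarith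
  have b2 : 4⁻¹ ^ S.β * |S.jac (S.rep k) ω 0| ^ S.β ≤ J ^ S.β := by
    rw [← Real.mul_rpow (by norm_num) (abs_nonneg _)]
    refine Real.rpow_le_rpow (by positivity) ?_ hβ.le
    linarith
  calc _ = (4⁻¹ ^ S.a * F ^ S.a) * (4⁻¹ ^ S.β * |S.jac (S.rep k) ω 0| ^ S.β) := by ring
    _ ≤ (J ^ S.a * x ^ S.a) * J ^ S.β := by gcongr
    _ = _ := by ring

theorem itin_bad0 {ω : Ω} {z : ℝ} (hz : z ∈ S.reg ω) (h0 : z ∈ S.bad0 ω) {k : ℕ}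
    (h : ∀ l ≤ k, S.it l ω z ∈ S.bad (S.θ^[l] ω)) : z ∈ S.cyl (S.rep (k + 1)) ω :=
  mem_cyl_rep hz fun _ hl => (it_mem_bad0 h0 fun i hi => h i (hi.trans hl)).1

variable (S) in
/-- The two words along which a point of `bad` may stay in `bad`. -/
def badWord (k : ℕ) (b : Bool) : List ι := if b then S.rep k else (S.G.i1 :: S.rep k).take k

theorem length_badWord (k : ℕ) (b : Bool) : (S.badWord k b).length = k := by
  cases b <;> simp [badWord]

/-- Growth along orbits that stay near the ends of the unit interval. -/
theorem growth_bad {k : ℕ} {ω : Ω} {z : ℝ} (hz : z ∈ S.reg ω)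
    (h : ∀ l ≤ k, S.it l ω z ∈ S.bad (S.θ^[l] ω)) :
    ∃ b, z ∈ S.cyl (S.badWord k b) ω ∧
    4⁻¹ ^ S.t * S.A⁻¹ ^ S.t * (e (S.it k ω z) ^ S.a * S.P k ω) ≤
      |S.jac (S.badWord k b) ω z| ^ S.t * e z ^ S.a := by
  have ht := S.t_pos
  have hA := S.one_lt_A
  have hA0 := S.A_pos
  have ha := S.a_pos
  have hβ := S.β_pos
  have hA' : S.A⁻¹ ^ S.t ≤ 1 := Real.rpow_le_one (by positivity) (inv_le_one_of_one_le₀ hA.le) ht.le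
  have key : ∀ {k : ℕ} {ω : Ω} {z : ℝ}, z ∈ S.reg ω → z ∈ S.bad0 ω →
      (∀ l ≤ k, S.it l ω z ∈ S.bad (S.θ^[l] ω)) → z ∈ S.cyl (S.rep k) ω ∧
      4⁻¹ ^ S.t * (e (S.it k ω z) ^ S.a * S.P k ω) ≤ |S.jac (S.rep k) ω z| ^ S.t * e z ^ S.a := by
    intro k ω z hz h0 h
    have h1 := S.cyl_rep_anti (Nat.le_succ k) ω (itin_bad0 hz h0 h)
    have h2 := it_mem_bad0 h0 h
    refine ⟨h1, ?_⟩
    rw [e_bad0 h0, e_bad0 h2]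
    exact growth_rep (S.cyl_subset_ccyl _ _ h1) (S.reg_subset_unit _ hz).1
      ((bad0_subset h2).2.trans S.ρ_le)
  have hP := S.P_pos k ω
  have heit := e_nonneg (S.reg_subset_unit _ (S.it_mem_reg hz k))
  have hez := e_nonneg (S.reg_subset_unit _ hz)
  rcases h 0 (Nat.zero_le _) with h0 | h0
  · obtain ⟨h1, h2⟩ := key hz h0 h
    refine ⟨true, h1, le_trans ?_ h2⟩
    have : 0 ≤ e (S.it k ω z) ^ S.a * S.P k ω := by positivity
    have h4 : (0 : ℝ) ≤ 4⁻¹ ^ S.t := by positivity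
    nlinarith [mul_nonneg h4 this]
  · rw [it_zero] at h0
    cases k with
    | zero =>
      refine ⟨true, S.reg_subset_unit _ hz, ?_⟩
      have h4 : (4⁻¹ : ℝ) ^ S.t ≤ 1 := Real.rpow_le_one (by norm_num) (by norm_num) ht.le
      simp only [badWord, if_true, rep, List.replicate_zero, jac, it_zero, P, Finset.range_zero,
        Finset.prod_empty, abs_one, Real.one_rpow, mul_one]
      have : (4⁻¹ : ℝ) ^ S.t * S.A⁻¹ ^ S.t ≤ 1 * 1 := by gcongr
      rw [one_mul] at this
      gcongr
    | succ k =>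
      have hreg := (S.mem_reg_iff.1 hz).2
      obtain ⟨h1, h2⟩ := key (k := k) hreg (T_bad1 h0) fun l hl => h (l + 1) (by omega)
      have hw : S.badWord (k + 1) false = S.G.i1 :: S.rep k := by
        simp [badWord, List.take_replicate]
      refine ⟨false, by rw [hw]; exact ⟨h0.1, h1⟩, ?_⟩
      rw [hw]
      obtain ⟨f1, f2, f3⟩ := bad1_facts h0
      have hP' := S.P_succ_le k ω
      simp only [jac, abs_mul]
      have g1 : (1 : ℝ) ≤ |S.d ω S.G.i1 z| := S.one_lt_κ.le.trans f1
      -- The step from 1 to 0 loses at most A^(-a) in the distance to the ends, and P gains one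
      -- factor of at most A^β; together they cost A^(-t).
      have g2 : (S.A⁻¹ * e (S.T ω z)) ^ S.a ≤ e z ^ S.a := by
        refine Real.rpow_le_rpow (mul_nonneg (by positivity)
          (e_nonneg (S.reg_subset_unit _ hreg))) ?_ ha.le
        rw [f3, inv_mul_le_iff₀ hA0]
        exact (e_le_left _).trans (T_le_mul_i1 (S.ocell_subset _ h0.1))
      have hT0 := e_nonneg (S.reg_subset_unit _ hreg)
      rw [Real.mul_rpow (by positivity) hT0] at g2
      rw [S.it_succ] at heit ⊢
      have hPk := S.P_pos k (S.θ ω)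
      calc 4⁻¹ ^ S.t * S.A⁻¹ ^ S.t * (e (S.it k (S.θ ω) (S.T ω z)) ^ S.a * S.P (k + 1) ω)
          ≤ 4⁻¹ ^ S.t * S.A⁻¹ ^ S.t * (e (S.it k (S.θ ω) (S.T ω z)) ^ S.a *
            (S.A ^ S.β * S.P k (S.θ ω))) := by gcongr
        _ = S.A⁻¹ ^ S.a * (4⁻¹ ^ S.t * (e (S.it k (S.θ ω) (S.T ω z)) ^ S.a * S.P k (S.θ ω))) *
            (S.A⁻¹ * S.A) ^ S.β := by
            rw [Real.mul_rpow (by positivity) hA0.le,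
              show S.A⁻¹ ^ S.t = S.A⁻¹ ^ S.a * S.A⁻¹ ^ S.β by
                rw [← Real.rpow_add (by positivity), S.a_add_β]]
            ring
        _ = S.A⁻¹ ^ S.a * (4⁻¹ ^ S.t * (e (S.it k (S.θ ω) (S.T ω z)) ^ S.a * S.P k (S.θ ω))) := by
            rw [inv_mul_cancel₀ hA0.ne', Real.one_rpow, mul_one]
        _ ≤ S.A⁻¹ ^ S.a * (|S.jac (S.rep k) (S.θ ω) (S.T ω z)| ^ S.t * e (S.T ω z) ^ S.a) := by
            gcongr
        _ = |S.jac (S.rep k) (S.θ ω) (S.T ω z)| ^ S.t * (S.A⁻¹ ^ S.a * e (S.T ω z) ^ S.a) := by ring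
        _ ≤ |S.jac (S.rep k) (S.θ ω) (S.T ω z)| ^ S.t * e z ^ S.a := by gcongr
        _ ≤ (|S.d ω S.G.i1 z| * |S.jac (S.rep k) (S.θ ω) (S.T ω z)|) ^ S.t * e z ^ S.a := by
            gcongr
            exact le_mul_of_one_le_left (abs_nonneg _) g1

theorem rpow_le_d {ω : Ω} {i : ι} {x : ℝ} (hx : x ∈ S.G.cell i) :
    S.c₀ ^ S.t * e (S.T ω x) ^ S.a ≤ |S.d ω i x| ^ S.t := by
  have h := (S.branch ω).deriv_lower i x hx
  have hu := S.T_mem_unit (ω := ω) hx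
  have he : 0 ≤ e (S.T ω x) := le_min hu.1 (by linarith [hu.2])
  have hc := S.c₀_pos
  have := Real.rpow_le_rpow (by positivity) h S.t_pos.le
  change (S.c₀ * e (S.T ω x) ^ S.α) ^ S.t ≤ _ at this
  rwa [Real.mul_rpow hc.le (by positivity), ← Real.rpow_mul he, mul_comm S.α] at this

variable (S) in
/-- The constant in `growth_exit`. -/
def cG : ℝ := S.c₀ ^ S.t * (4⁻¹ ^ S.t * S.A⁻¹ ^ S.t) * S.A⁻¹ ^ S.β

theorem cG_pos : 0 < S.cG := by
  have := S.c₀_pos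
  have := S.A_pos
  unfold cG; positivity

/-- Growth along an excursion to the ends of the unit interval. -/
theorem growth_exit {k : ℕ} {ω : Ω} {y : ℝ} (hy : y ∈ S.reg ω)
    (h : ∀ l ≤ k, S.it (l + 1) ω y ∈ S.bad (S.θ^[l + 1] ω)) :
    ∃ i b, y ∈ S.cyl (i :: S.badWord k b) ω ∧
    S.cG * (e (S.it (k + 1) ω y) ^ S.a * S.P (k + 1) ω) ≤
      |S.jac (i :: S.badWord k b) ω y| ^ S.t := by
  obtain ⟨⟨i, hi⟩, hreg⟩ := S.mem_reg_iff.1 hy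
  obtain ⟨b, hb, hg⟩ := growth_bad hreg h
  refine ⟨i, b, ⟨hi, hb⟩, ?_⟩
  have hA0 := S.A_pos
  have hc := S.c₀_pos
  -- The possible loss of derivative at the step that leaves K, a factor e(T y)^a, is exactly what
  -- the right side of `growth_bad` makes up for.
  have h1 := rpow_le_d (ω := ω) (S.ocell_subset _ hi)
  have heit := e_nonneg (S.reg_subset_unit _ (S.it_mem_reg hreg k))
  have hT0 := e_nonneg (S.reg_subset_unit _ hreg)
  have hP := S.P_succ_le k ω
  simp only [jac, abs_mul]
  rw [Real.mul_rpow (abs_nonneg _) (abs_nonneg _), S.it_succ]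
  unfold cG
  calc _ ≤ S.c₀ ^ S.t * (4⁻¹ ^ S.t * S.A⁻¹ ^ S.t) * S.A⁻¹ ^ S.β *
        (e (S.it k (S.θ ω) (S.T ω y)) ^ S.a * (S.A ^ S.β * S.P k (S.θ ω))) := by gcongr
    _ = S.c₀ ^ S.t * (4⁻¹ ^ S.t * S.A⁻¹ ^ S.t *
        (e (S.it k (S.θ ω) (S.T ω y)) ^ S.a * S.P k (S.θ ω))) * (S.A⁻¹ * S.A) ^ S.β := by
        rw [Real.mul_rpow (by positivity) hA0.le]; ring
    _ = S.c₀ ^ S.t * (4⁻¹ ^ S.t * S.A⁻¹ ^ S.t *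
        (e (S.it k (S.θ ω) (S.T ω y)) ^ S.a * S.P k (S.θ ω))) := by
        rw [inv_mul_cancel₀ hA0.ne', Real.one_rpow, mul_one]
    _ ≤ S.c₀ ^ S.t * (|S.jac (S.badWord k b) (S.θ ω) (S.T ω y)| ^ S.t * e (S.T ω y) ^ S.a) := by
        gcongr
    _ = (S.c₀ ^ S.t * e (S.T ω y) ^ S.a) * |S.jac (S.badWord k b) (S.θ ω) (S.T ω y)| ^ S.t := by
        ring
    _ ≤ _ := by gcongr

end System
-- Cylinders around regular points shrink to points
namespace System
variable {ι Ω : Type*} {S : System ι Ω}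

/-- A monotone iterate that covers the gap between `F y` and an end `v` of the unit interval does so
on an interval of length comparable to the distance from `y` to a reference point `x`. -/
theorem CylFacts.gap {w : List ι} {ω : Ω} (h : S.CylFacts w ω) {δ ℓ x y q q' : ℝ} (hδ : 0 < δ)
    (hℓ : 0 < ℓ) (hx : x ∈ S.ccyl w ω) (hy : y ∈ S.ccyl w ω) (hxy : x ≠ y)
    (hq : q ∈ S.ccyl w ω) (hq' : q' ∈ S.ccyl w ω)
    (hqq' : S.it w.length ω q = 1 ∧ S.it w.length ω q' = 0 ∨
      S.it w.length ω q = 0 ∧ S.it w.length ω q' = 1)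
    (hb : S.it w.length ω y ∈ uIcc (S.it w.length ω x) (S.it w.length ω q))
    (hyℓ : ℓ ≤ |S.it w.length ω q - S.it w.length ω y|)
    (hxδ : δ ≤ |S.it w.length ω q' - S.it w.length ω x|) :
    ∃ u ∈ S.ccyl w ω, |S.it w.length ω q - S.it w.length ω u| = ℓ ∧
      ℓ ^ 3 * δ ^ 2 * |y - x| ≤ |q - u| := by
  set F := S.it w.length ω with hF
  have hFx := h.bij.mapsTo hx
  have hFy := h.bij.mapsTo hy
  -- Seen from q, the derivative between x and y is at least ℓ² times that at x, so |y − x| is at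
  -- most of order 1/|J(x)|.
  have hJx : ∀ ξ ∈ uIcc x y, ℓ ^ 2 * |S.jac w ω x| ≤ |S.jac w ω ξ| := by
    intro ξ hξ
    have hξ' := h.ord.uIcc_subset hx hy hξ
    have h1 := (h.between hx hy hξ').1 hξ
    have h2 := h.bij.mapsTo hξ'
    rw [← hF] at h1 h2 hFx hFy
    refine h.jac_le hℓ hx hξ' hq ?_ ?_
    · rw [← hF]; exact uIcc_subset_uIcc left_mem_uIcc hb h1
    · rw [← hF]
      rcases hqq' with ⟨e1, e2⟩ | ⟨e1, e2⟩
      · rw [e1] at hyℓ hb ⊢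
        rw [uIcc_of_le hFx.2] at hb
        rw [uIcc_of_le hb.1] at h1
        rw [abs_of_nonneg (by linarith [hFy.2])] at hyℓ
        rw [abs_of_nonneg (by linarith [h2.2])]
        linarith [h1.2]
      · rw [e1] at hyℓ hb ⊢
        rw [uIcc_of_ge hFx.1] at hb
        rw [uIcc_of_ge hb.2] at h1
        rw [zero_sub, abs_neg, abs_of_nonneg hFy.1] at hyℓ
        rw [zero_sub, abs_neg, abs_of_nonneg h2.1]
        linarith [h1.1]
  have hA := h.le_abs_sub hx hy hJx
  have hA1 : ℓ ^ 2 * |S.jac w ω x| * |y - x| ≤ 1 := by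
    refine hA.trans ?_
    rw [abs_le]; constructor <;> linarith [hFx.1, hFx.2, hFy.1, hFy.2]
  have hℓ1 : ℓ ≤ 1 := by
    refine hyℓ.trans ?_
    rcases hqq' with ⟨e1, e2⟩ | ⟨e1, e2⟩ <;> rw [e1] <;> rw [abs_le] <;>
      constructor <;> linarith [hFy.1, hFy.2]
  obtain ⟨u, hu, hFu⟩ : ∃ u ∈ S.ccyl w ω, F u = if F q = 1 then 1 - ℓ else ℓ :=
    h.bij.surjOn (by split_ifs <;> constructor <;> linarith)
  have hqu : |F q - F u| = ℓ := by
    rcases hqq' with ⟨e1, e2⟩ | ⟨e1, e2⟩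
    · rw [hFu, e1, if_pos rfl, sub_sub_cancel, abs_of_pos hℓ]
    · rw [hFu, e1, if_neg zero_ne_one, zero_sub, abs_neg, abs_of_pos hℓ]
  refine ⟨u, hu, hqu, ?_⟩
  -- Seen from the other end q', the derivative between u and q is at most that at x divided by δ²,
  -- so |q − u| is at least of order 1/|J(x)|.
  have hJu : ∀ ξ ∈ uIcc u q, |S.jac w ω ξ| ≤ |S.jac w ω x| / δ ^ 2 := by
    intro ξ hξ
    have hξ' := h.ord.uIcc_subset hu hq hξ
    have h1 := (h.between hu hq hξ').1 hξ
    have h2 := h.bij.mapsTo hξ'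
    rw [le_div_iff₀ (by positivity), mul_comm]
    refine h.jac_le hδ hξ' hx hq' ?_ hxδ
    rw [← hF] at h1 h2 hFx hFy ⊢
    rcases hqq' with ⟨e1, e2⟩ | ⟨e1, e2⟩
    · rw [e1, if_pos rfl] at hFu
      rw [e1, hFu, uIcc_of_le (by linarith)] at h1
      rw [e1] at hyℓ hb
      rw [uIcc_of_le hFx.2] at hb
      rw [abs_of_nonneg (by linarith [hFy.2])] at hyℓ
      rw [e2, uIcc_of_ge h2.1]
      exact ⟨hFx.1, by linarith [h1.1, hb.1]⟩
    · rw [e1, if_neg zero_ne_one] at hFu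
      rw [e1, hFu, uIcc_of_ge hℓ.le] at h1
      rw [e1] at hyℓ hb
      rw [uIcc_of_ge hFx.1] at hb
      rw [zero_sub, abs_neg, abs_of_nonneg hFy.1] at hyℓ
      rw [e2, uIcc_of_le h2.2]
      exact ⟨by linarith [h1.2, hb.2], hFx.2⟩
  have hB := h.abs_sub_le hu hq hJu
  rw [← hF, hqu] at hB
  have hJ0 : 0 ≤ |S.jac w ω x| := abs_nonneg _
  have h3 : ℓ * δ ^ 2 ≤ |S.jac w ω x| * |q - u| := by
    have := mul_le_mul_of_nonneg_right hB (by positivity : 0 ≤ δ ^ 2)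
    calc _ ≤ _ := this
      _ = _ := by field_simp
  calc ℓ ^ 3 * δ ^ 2 * |y - x| = ℓ ^ 2 * |y - x| * (ℓ * δ ^ 2) := by ring
    _ ≤ ℓ ^ 2 * |y - x| * (|S.jac w ω x| * |q - u|) := by gcongr
    _ = ℓ ^ 2 * |S.jac w ω x| * |y - x| * |q - u| := by ring
    _ ≤ 1 * |q - u| := by gcongr
    _ = _ := one_mul _

theorem ccyl_itin_anti (ω : Ω) (x : ℝ) : Antitone fun n => S.ccyl (S.itin n ω x) ω :=
  antitone_nat_of_succ_le fun n y hy => by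
    simp only [itin_add] at hy
    exact (S.mem_ccyl_append.1 hy).1

theorem mem_ccyl_itin_succ {n : ℕ} {ω : Ω} {x y : ℝ} (h : y ∈ S.ccyl (S.itin (n + 1) ω x) ω) :
    S.it n ω y ∈ S.G.cell (S.sym (S.it n ω x)) := by
  simp only [itin_add] at h
  have := (S.mem_ccyl_append.1 h).2
  rw [length_itin] at this
  exact this.1

variable (S) in
/-- The smaller of the lengths of the two end cells. -/
def ℓ : ℝ := min (S.G.len S.G.i0) (S.G.len S.G.i1)

theorem ℓ_pos : 0 < S.ℓ := lt_min (sub_pos.2 (S.G.lo_lt_hi _)) (sub_pos.2 (S.G.lo_lt_hi _))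

/-- The drop of length of a nested sequence of cylinders at a visit to `K`. -/
theorem volume_drop {n : ℕ} {ω : Ω} {x₀ x y₁ y₂ η : ℝ} (hx₀ : S.it n ω x₀ ∈ S.reg (S.θ^[n] ω))
    (hx : S.it n ω x ∈ S.K (S.θ^[n] ω)) (h1 : y₁ ∈ S.ccyl (S.itin (n + 1) ω x₀) ω)
    (h2 : y₂ ∈ S.ccyl (S.itin (n + 1) ω x₀) ω) (hη : 0 < η) (e1 : x - y₁ = η) (e2 : y₂ - x = η) :
    volume (S.ccyl (S.itin (n + 1) ω x₀) ω) + ENNReal.ofReal (S.ℓ ^ 3 * S.δ ^ 2 * η) ≤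
      volume (S.ccyl (S.itin n ω x₀) ω) := by
  have hδ := δ_pos (S := S)
  have hℓ := ℓ_pos (S := S)
  set w := S.itin n ω x₀ with hw
  have hlen : w.length = n := S.length_itin _ _ _
  have hf := S.cylFacts w ω
  have hf' := S.cylFacts (S.itin (n + 1) ω x₀) ω
  have hsub : S.ccyl (S.itin (n + 1) ω x₀) ω ⊆ S.ccyl w ω := ccyl_itin_anti ω x₀ (Nat.le_succ n)
  have hxm' : x ∈ S.ccyl (S.itin (n + 1) ω x₀) ω := hf'.ord.out h1 h2 ⟨by linarith, by linarith⟩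
  have hxm := hsub hxm'
  have hKx := S.K_subset _ hx
  obtain ⟨q₁, hq₁, hFq₁⟩ := hf.bij.surjOn (right_mem_Icc.2 zero_le_one)
  obtain ⟨q₀, hq₀, hFq₀⟩ := hf.bij.surjOn (left_mem_Icc.2 zero_le_one)
  obtain ⟨i, hi⟩ := hx₀ 0
  rw [it_zero] at hi
  have hcell : ∀ y ∈ S.ccyl (S.itin (n + 1) ω x₀) ω, S.it n ω y ∈ S.G.cell i := fun y hy => by
    have := mem_ccyl_itin_succ hy
    rwa [S.sym_eq hi] at this
  -- the conclusion from a gap next to the end `q`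
  have concl : ∀ u ∈ S.ccyl w ω, ∀ q ∈ S.ccyl w ω, S.ℓ ^ 3 * S.δ ^ 2 * η ≤ |q - u| →
      (∀ z, S.it n ω z ∈ uIcc (S.it n ω u) (S.it n ω q) → S.it n ω z ≠ S.it n ω u →
        S.it n ω z ∉ S.G.cell i) →
      volume (S.ccyl (S.itin (n + 1) ω x₀) ω) + ENNReal.ofReal (S.ℓ ^ 3 * S.δ ^ 2 * η) ≤
      volume (S.ccyl w ω) := by
    intro u hu q hq hlow hout
    have hdisj : Disjoint (S.ccyl (S.itin (n + 1) ω x₀) ω) (uIoo u q) := by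
      rw [Set.disjoint_left]
      intro z hz hz'
      have hz1 := (hf.between hu hq (hsub hz)).1 (Ioo_subset_Icc_self hz')
      rw [hlen] at hz1
      refine hout z hz1 (fun heq => ?_) (hcell z hz)
      rw [← hlen] at heq
      rw [hf.bij.injOn (hsub hz) hu heq] at hz'
      rw [uIoo] at hz'
      rcases le_total u q with h | h
      · rw [min_eq_left h] at hz'; exact lt_irrefl _ hz'.1
      · rw [max_eq_left h] at hz'; exact lt_irrefl _ hz'.2
    have hvol : ENNReal.ofReal |q - u| = volume (uIoo u q) := by
      rw [Real.volume_uIoo]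
    calc _ ≤ volume (S.ccyl (S.itin (n + 1) ω x₀) ω) + volume (uIoo u q) := by
          rw [← hvol]; gcongr
      _ = volume (S.ccyl (S.itin (n + 1) ω x₀) ω ∪ uIoo u q) :=
          (measure_union hdisj isOpen_Ioo.measurableSet).symm
      _ ≤ _ := measure_mono (union_subset hsub
          (Ioo_subset_Icc_self.trans (hf.ord.uIcc_subset hu hq)))
  have hu0 := hf.bij.mapsTo hxm
  have hux : ∀ y ∈ S.ccyl w ω, S.it n ω y ∈ Icc (0 : ℝ) 1 := fun y hy => by
    have := hf.bij.mapsTo hy; rwa [hlen] at this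
  -- one of the two points lies on either side of the reference point
  have hmono : (∃ y ∈ S.ccyl (S.itin (n + 1) ω x₀) ω, x ≠ y ∧ |y - x| = η ∧ S.it n ω x ≤ S.it n ω y) ∧
      ∃ y ∈ S.ccyl (S.itin (n + 1) ω x₀) ω, x ≠ y ∧ |y - x| = η ∧ S.it n ω y ≤ S.it n ω x := by
    have a1 : x ≠ y₁ := by intro h; rw [h, sub_self] at e1; exact hη.ne e1
    have a2 : x ≠ y₂ := by intro h; rw [h, sub_self] at e2; exact hη.ne e2
    have b1 : |y₁ - x| = η := by rw [abs_sub_comm, e1, abs_of_pos hη]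
    have b2 : |y₂ - x| = η := by rw [e2, abs_of_pos hη]
    have hst := hf.strict
    rw [hlen] at hst
    rcases hst with h | h
    · exact ⟨⟨y₂, h2, a2, b2, h.monotoneOn hxm (hsub h2) (by linarith)⟩,
        ⟨y₁, h1, a1, b1, h.monotoneOn (hsub h1) hxm (by linarith)⟩⟩
    · exact ⟨⟨y₁, h1, a1, b1, h.antitoneOn (hsub h1) hxm (by linarith)⟩,
        ⟨y₂, h2, a2, b2, h.antitoneOn hxm (hsub h2) (by linarith)⟩⟩
  rw [hlen] at hFq₁ hFq₀
  -- The next cylinder omits the part of the present one that is mapped to within ℓ of an end: the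
  -- end 0 if the next letter is the last cell, and the end 1 otherwise.
  by_cases hi1 : i = S.G.i1
  · obtain ⟨-, y, hy, hxy, habs, hle⟩ := hmono
    have hFy := hcell y hy
    have hux' := hux y (hsub hy)
    have hlo : S.ℓ ≤ S.it n ω y := by
      have h3 : S.G.hi S.G.i0 ≤ S.G.lo i := by
        have hd : Disjoint (Ioo (S.G.lo S.G.i0) (S.G.hi S.G.i0)) (Ioo (S.G.lo i) (S.G.hi i)) :=
          S.G.disjoint_interiors (by rw [hi1]; exact S.G.i0_ne_i1)
        rw [Set.disjoint_iff_inter_eq_empty, Ioo_inter_Ioo, Ioo_eq_empty_iff] at hd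
        by_contra hlt
        push Not at hlt
        apply hd
        rw [S.G.lo_i0, max_eq_right (S.G.lo_nonneg i), hi1, S.G.hi_i1,
          min_eq_left (S.G.hi_le_one _)]
        rwa [hi1] at hlt
      refine (min_le_left _ _).trans ?_
      unfold IntervalFamily.len
      rw [S.G.lo_i0]
      linarith [hFy.1]
    obtain ⟨u, hu, hu1, hu2⟩ := hf.gap hδ hℓ hxm (hsub hy) hxy hq₀ hq₁
      (Or.inr ⟨by rw [hlen]; exact hFq₀, by rw [hlen]; exact hFq₁⟩)
      (by rw [hlen, hFq₀, uIcc_of_ge (hux x hxm).1]; exact ⟨hux'.1, hle⟩)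
      (by rw [hlen, hFq₀, zero_sub, abs_neg, abs_of_nonneg hux'.1]; exact hlo)
      (by rw [hlen, hFq₁, abs_of_nonneg] <;> linarith [hKx.2])
    rw [hlen, hFq₀, zero_sub, abs_neg, abs_of_nonneg (hux u hu).1] at hu1
    refine concl u hu q₀ hq₀ (by rwa [habs] at hu2) fun z hz hne hzc => ?_
    rw [hFq₀, hu1, uIcc_of_ge hℓ.le] at hz
    rw [hu1] at hne
    have h4 := lt_of_le_of_ne hz.2 hne
    have h3 := S.G.disjoint_interiors S.G.i0_ne_i1
    refine S.not_mem_cell (i := S.G.i0) (k := i) (x := (S.it n ω z + S.ℓ) / 2)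
      (by rw [hi1]; exact S.G.i0_ne_i1) ⟨?_, ?_⟩ ⟨?_, ?_⟩
    · rw [S.G.lo_i0]; linarith [hz.1]
    · have : S.ℓ ≤ S.G.len S.G.i0 := min_le_left _ _
      unfold IntervalFamily.len at this
      rw [S.G.lo_i0] at this; linarith
    · linarith [hzc.1]
    · have : S.ℓ ≤ S.it n ω y := hlo
      linarith [hFy.2]
  · obtain ⟨⟨y, hy, hxy, habs, hle⟩, -⟩ := hmono
    have hFy := hcell y hy
    have hux' := hux y (hsub hy)
    have h3 : S.G.hi i ≤ S.G.lo S.G.i1 := by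
      have hd : Disjoint (Ioo (S.G.lo i) (S.G.hi i)) (Ioo (S.G.lo S.G.i1) (S.G.hi S.G.i1)) :=
        S.G.disjoint_interiors hi1
      rw [Set.disjoint_iff_inter_eq_empty, Ioo_inter_Ioo, Ioo_eq_empty_iff] at hd
      by_contra hlt
      push Not at hlt
      apply hd
      rw [S.G.hi_i1, min_eq_left (S.G.hi_le_one i)]
      exact max_lt (S.G.lo_lt_hi i) hlt
    have hlo1 : S.ℓ ≤ 1 - S.G.lo S.G.i1 := by
      have : S.ℓ ≤ S.G.len S.G.i1 := min_le_right _ _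
      unfold IntervalFamily.len at this
      rwa [S.G.hi_i1] at this
    obtain ⟨u, hu, hu1, hu2⟩ := hf.gap hδ hℓ hxm (hsub hy) hxy hq₁ hq₀
      (Or.inl ⟨by rw [hlen]; exact hFq₁, by rw [hlen]; exact hFq₀⟩)
      (by rw [hlen, hFq₁, uIcc_of_le (hux x hxm).2]; exact ⟨hle, hux'.2⟩)
      (by rw [hlen, hFq₁, abs_of_nonneg (by linarith [hux'.2])]; linarith [hFy.2])
      (by rw [hlen, hFq₀, zero_sub, abs_neg, abs_of_nonneg (hux x hxm).1]; exact hKx.1)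
    rw [hlen, hFq₁, abs_of_nonneg (by linarith [(hux u hu).2])] at hu1
    refine concl u hu q₁ hq₁ (by rwa [habs] at hu2) fun z hz hne hzc => ?_
    rw [hFq₁, uIcc_of_le (hux u hu).2] at hz
    have h4 := lt_of_le_of_ne hz.1 hne.symm
    linarith [hzc.2]

theorem volume_ccyl_le_one (w : List ι) (ω : Ω) : volume (S.ccyl w ω) ≤ 1 := by
  refine (measure_mono (S.ccyl_subset_unit w ω)).trans ?_
  simp

/-- The images of x are interior to the cells and those of y lie in the same closed cells, so images
strictly before those of y are interior. -/
theorem mem_reg_between {ω : Ω} {x y z : ℝ} (hx : x ∈ S.reg ω)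
    (hy : ∀ n, y ∈ S.ccyl (S.itin n ω x) ω) (hz : z ∈ uIcc x y) (hne : z ≠ y) : z ∈ S.reg ω := by
  intro n
  obtain ⟨i, hi⟩ := hx n
  have hf := S.cylFacts (S.itin n ω x) ω
  have hlen : (S.itin n ω x).length = n := S.length_itin _ _ _
  have hxm := S.cyl_subset_ccyl _ _ (S.mem_cyl_itin hx n)
  have hzm := hf.ord.uIcc_subset hxm (hy n) hz
  have h1 := (hf.between hxm (hy n) hzm).1 hz
  have h2 := mem_ccyl_itin_succ (hy (n + 1))
  rw [S.sym_eq hi] at h2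
  rw [hlen] at h1
  have hne' : S.it n ω z ≠ S.it n ω y := by
    intro h
    rw [← hlen] at h
    exact hne (hf.bij.injOn hzm (hy n) h)
  refine ⟨i, ?_⟩
  rw [mem_uIcc] at h1
  rcases h1 with h1 | h1
  · exact ⟨hi.1.trans_le h1.1, (lt_of_le_of_ne h1.2 hne').trans_le h2.2⟩
  · exact ⟨h2.1.trans_lt (lt_of_le_of_ne h1.1 hne'.symm), h1.2.trans_lt hi.2⟩

/-- There are no wandering intervals. An interval common to all the cylinders has a regular
midpoint, which visits K infinitely often; by `volume_drop` each visit shortens the cylinder by a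
fixed amount, whereas the lengths converge. -/
theorem eq_of_forall_mem_ccyl {ω : Ω} {x y : ℝ} (hx : x ∈ S.reg ω)
    (hy : ∀ n, y ∈ S.ccyl (S.itin n ω x) ω) : y = x := by
  by_contra hne
  set z := (x + y) / 2 with hz
  have hzr : z ∈ S.reg ω := by
    refine mem_reg_between hx hy ?_ (fun h => hne (by rw [hz] at h; linarith))
    rw [mem_uIcc]
    rcases le_total x y with h | h
    · left; constructor <;> linarith
    · right; constructor <;> linarith
  have hxm : ∀ n, x ∈ S.ccyl (S.itin n ω x) ω := fun n =>
    S.cyl_subset_ccyl _ _ (S.mem_cyl_itin hx n)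
  obtain ⟨y₁, y₂, η, hy1, hy2, hη, e1, e2⟩ : ∃ y₁ y₂ η, (∀ n, y₁ ∈ S.ccyl (S.itin n ω x) ω) ∧
      (∀ n, y₂ ∈ S.ccyl (S.itin n ω x) ω) ∧ 0 < η ∧ z - y₁ = η ∧ y₂ - z = η := by
    rcases lt_or_gt_of_ne hne with h | h
    · exact ⟨y, x, (x - y) / 2, hy, hxm, by linarith, by rw [hz]; ring, by rw [hz]; ring⟩
    · exact ⟨x, y, (y - x) / 2, hxm, hy, by linarith, by rw [hz]; ring, by rw [hz]; ring⟩
  set c := S.ℓ ^ 3 * S.δ ^ 2 * η with hc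
  have hcpos : 0 < c := by
    have := ℓ_pos (S := S); have := δ_pos (S := S); positivity
  have hfin : ∀ n, volume (S.ccyl (S.itin n ω x) ω) ≠ ⊤ := fun n =>
    ne_top_of_le_ne_top ENNReal.one_ne_top (volume_ccyl_le_one _ _)
  set a : ℕ → ℝ := fun n => (volume (S.ccyl (S.itin n ω x) ω)).toReal with ha
  have hanti : Antitone a := fun m n hmn =>
    ENNReal.toReal_mono (hfin m) (measure_mono (ccyl_itin_anti ω x hmn))
  have hlim := tendsto_atTop_ciInf hanti ⟨0, by rintro _ ⟨n, rfl⟩; exact ENNReal.toReal_nonneg⟩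
  have hdiff : Tendsto (fun n => a n - a (n + 1)) atTop (𝓝 0) := by
    have := hlim.sub (hlim.comp (tendsto_add_atTop_nat 1))
    simpa using this
  obtain ⟨N, hN⟩ := eventually_atTop.1 (hdiff.eventually (gt_mem_nhds hcpos))
  obtain ⟨n, hn, hK⟩ := exists_visit_ge hzr N
  have hd := volume_drop (S.it_mem_reg hx n) hK (hy1 _) (hy2 _) hη e1 e2
  have := ENNReal.toReal_mono (hfin n) hd
  rw [ENNReal.toReal_add (hfin _) ENNReal.ofReal_ne_top, ENNReal.toReal_ofReal hcpos.le] at this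
  have h5 := hN n hn
  simp only [ha] at h5
  linarith

theorem eventually_ccyl_subset {ω : Ω} {x : ℝ} (hx : x ∈ S.reg ω) {U : Set ℝ} (hU : IsOpen U)
    (hxU : x ∈ U) : ∃ N, ∀ n ≥ N, S.ccyl (S.itin n ω x) ω ⊆ U := by
  have hcomp : ∀ n, IsCompact (S.ccyl (S.itin n ω x) ω) := fun n =>
    isCompact_Icc.of_isClosed_subset (S.cylFacts _ _).closed (S.ccyl_subset_unit _ _)
  obtain ⟨N, hN⟩ := exists_subset_nhds_of_isCompact' (ccyl_itin_anti ω x).directed_ge hcomp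
    (fun n => (hcomp n).isClosed) (U := U) (fun y hy => by
      rw [eq_of_forall_mem_ccyl hx (mem_iInter.1 hy)]
      exact hU.mem_nhds hxU)
  exact ⟨N, fun n hn => (ccyl_itin_anti ω x hn).trans hN⟩

end System
-- Conformal families and the launch estimate
namespace System
variable {ι Ω : Type*} {S : System ι Ω}

theorem measurable_it (S : System ι Ω) (n : ℕ) (ω : Ω) : Measurable (S.it n ω) := by
  induction n generalizing ω with
  | zero => exact measurable_id
  | succ n ih => exact (ih _).comp (S.measurable_T ω)

theorem measurableSet_cyl (S : System ι Ω) (w : List ι) (ω : Ω) : MeasurableSet (S.cyl w ω) := by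
  induction w generalizing ω with
  | nil => exact measurableSet_Ioo
  | cons i w ih => exact measurableSet_Ioo.inter (S.measurable_T ω (ih _))

theorem measurable_jac (S : System ι Ω) (w : List ι) (ω : Ω) : Measurable (S.jac w ω) := by
  induction w generalizing ω with
  | nil => exact measurable_const
  | cons i w ih => exact (S.measurable_d ω i).mul ((ih _).comp (S.measurable_T ω))

theorem measurableSet_reg [Countable ι] (S : System ι Ω) (ω : Ω) : MeasurableSet (S.reg ω) := by
  have : S.reg ω = ⋂ n, ⋃ i, S.it n ω ⁻¹' S.ocell i := by ext; simp [reg]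
  rw [this]
  exact MeasurableSet.iInter fun n => MeasurableSet.iUnion fun i =>
    S.measurable_it n ω measurableSet_Ioo

theorem measurableSet_bad (S : System ι Ω) (ω : Ω) : MeasurableSet (S.bad ω) :=
  (S.measurableSet_cyl _ _).union (S.measurableSet_cyl _ _)

theorem measurableSet_K [Countable ι] (S : System ι Ω) (ω : Ω) : MeasurableSet (S.K ω) :=
  (S.measurableSet_reg ω).diff (S.measurableSet_bad ω)

theorem measurable_e : Measurable e := measurable_id.min (measurable_const.sub measurable_id)

/-- The weight `e⁻ᵃ`. -/
def wt (S : System ι Ω) (x : ℝ) : ENNReal := ENNReal.ofReal (e x ^ (-S.a))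

theorem measurable_wt (S : System ι Ω) : Measurable S.wt :=
  (measurable_e.pow_const _).ennreal_ofReal

/-- A family of probability measures on the regular points, with the change of variables formula
on every cell. -/
structure Conf (S : System ι Ω) (ν : Ω → Measure ℝ) (lam : Ω → ℝ) : Prop where
  prob : ∀ ω, IsProbabilityMeasure (ν ω)
  supp : ∀ ω, ν ω (S.reg ω)ᶜ = 0
  pos : ∀ ω, 0 < lam ω
  fwd : ∀ ω i (φ : ℝ → ENNReal), Measurable φ → ∫⁻ y, φ y ∂ν (S.θ ω) =
    ∫⁻ x in S.ocell i, φ (S.T ω x) * ENNReal.ofReal (lam ω * |S.d ω i x| ^ S.t) ∂ν ω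

/-- The products of `lam`. -/
def Λ (S : System ι Ω) (lam : Ω → ℝ) (n : ℕ) (ω : Ω) : ℝ := cocycle S.θ lam n ω

theorem Λ_succ' (lam : Ω → ℝ) (n : ℕ) (ω : Ω) :
    S.Λ lam (n + 1) ω = lam ω * S.Λ lam n (S.θ ω) := by
  rw [Λ, cocycle, Finset.prod_range_succ', mul_comm]; rfl

theorem Λ_add (lam : Ω → ℝ) (m n : ℕ) (ω : Ω) :
    S.Λ lam (m + n) ω = S.Λ lam m ω * S.Λ lam n (S.θ^[m] ω) := by
  rw [Λ, cocycle, Finset.prod_range_add]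
  simp only [Λ, cocycle, ← Function.iterate_add_apply, add_comm]

namespace Conf

variable {ν : Ω → Measure ℝ} {lam : Ω → ℝ} (h : S.Conf ν lam)

include h

theorem Λ_pos (n : ℕ) (ω : Ω) : 0 < S.Λ lam n ω := by
  unfold Λ cocycle; exact Finset.prod_pos fun _ _ => h.pos _

theorem Λ_ne_zero (n : ℕ) (ω : Ω) : ENNReal.ofReal (S.Λ lam n ω) ≠ 0 :=
  (ENNReal.ofReal_pos.2 (h.Λ_pos n ω)).ne'

theorem measure_inter_reg (ω : Ω) (B : Set ℝ) : ν ω (B ∩ S.reg ω) = ν ω B :=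
  measure_inter_conull (h.supp ω)

theorem measure_le_of_inter {ω : Ω} {B B' : Set ℝ} (hB : B ∩ S.reg ω ⊆ B') : ν ω B ≤ ν ω B' :=
  (h.measure_inter_reg ω B).symm.le.trans (measure_mono hB)

theorem fwd_word (w : List ι) (ω : Ω) {φ : ℝ → ENNReal} (hφ : Measurable φ) :
    ∫⁻ y, φ y ∂ν (S.θ^[w.length] ω) = ENNReal.ofReal (S.Λ lam w.length ω) *
      ∫⁻ x in S.cyl w ω, φ (S.it w.length ω x) * ENNReal.ofReal (|S.jac w ω x| ^ S.t) ∂ν ω := by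
  induction w generalizing ω with
  | nil =>
    have h1 : ν ω (S.cyl [] ω)ᶜ = 0 :=
      measure_mono_null (compl_subset_compl.2 (S.reg_subset_unit ω)) (h.supp ω)
    simp only [List.length_nil, Function.iterate_zero, id_eq, Λ, cocycle, Finset.range_zero,
      Finset.prod_empty, ENNReal.ofReal_one, one_mul, it_zero, jac, abs_one, Real.one_rpow, mul_one]
    rw [← lintegral_add_compl φ (S.measurableSet_cyl [] ω),
      Measure.restrict_eq_zero.2 h1, lintegral_zero_measure, add_zero]
  | cons i w ih =>
    have hm := S.measurableSet_cyl w (S.θ ω)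
    have hmeas : Measurable fun y => φ (S.it w.length (S.θ ω) y) *
        ENNReal.ofReal (|S.jac w (S.θ ω) y| ^ S.t) :=
      (hφ.comp (S.measurable_it _ _)).mul
        (((S.measurable_jac _ _).abs.pow_const _).ennreal_ofReal)
    have hset : S.cyl (i :: w) ω = S.T ω ⁻¹' S.cyl w (S.θ ω) ∩ S.ocell i := by
      ext x; exact and_comm
    rw [List.length_cons, Function.iterate_succ_apply, ih, ← lintegral_indicator hm,
      h.fwd ω i _ (hmeas.indicator hm), Λ_succ', mul_comm (lam ω),
      ENNReal.ofReal_mul (h.Λ_pos _ _).le, mul_assoc, hset,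
      ← Measure.restrict_restrict (S.measurable_T ω hm), ← lintegral_indicator (S.measurable_T ω hm)]
    congr 1
    rw [← lintegral_const_mul]
    · congr 1
      ext x
      by_cases hx : S.T ω x ∈ S.cyl w (S.θ ω)
      · rw [indicator_of_mem hx, indicator_of_mem (show x ∈ S.T ω ⁻¹' _ from hx)]
        simp only [jac, abs_mul]
        rw [Real.mul_rpow (abs_nonneg _) (abs_nonneg _), ENNReal.ofReal_mul (Real.rpow_nonneg (abs_nonneg _) _),
          ENNReal.ofReal_mul (h.pos ω).le, it_succ]
        ring
      · rw [indicator_of_notMem hx, indicator_of_notMem (show x ∉ S.T ω ⁻¹' _ from hx)]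
        simp
    · refine Measurable.indicator ?_ (S.measurable_T ω hm)
      exact (hφ.comp (S.measurable_it _ _)).mul
        (((S.measurable_jac _ _).abs.pow_const _).ennreal_ofReal)

theorem lintegral_le (w : List ι) {n : ℕ} (hn : w.length = n) {ω : Ω} {X : Set ℝ}
    (hX : X ⊆ S.cyl w ω) {g u : ℝ → ENNReal} (hg : Measurable g)
    (hu : ∀ x ∈ X, u x ≤ g (S.it n ω x) * ENNReal.ofReal (|S.jac w ω x| ^ S.t)) :
    ENNReal.ofReal (S.Λ lam n ω) * ∫⁻ x in X, u x ∂ν ω ≤ ∫⁻ y, g y ∂ν (S.θ^[n] ω) := by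
  subst hn
  rw [h.fwd_word w ω hg]
  gcongr ENNReal.ofReal _ * ?_
  refine (setLIntegral_mono ?_ hu).trans (lintegral_mono_set hX)
  exact (hg.comp (S.measurable_it _ _)).mul (((S.measurable_jac _ _).abs.pow_const _).ennreal_ofReal)

theorem le_lintegral (w : List ι) {n : ℕ} (hn : w.length = n) {ω : Ω} {g u : ℝ → ENNReal}
    (hg : Measurable g)
    (hu : ∀ x ∈ S.cyl w ω, g (S.it n ω x) * ENNReal.ofReal (|S.jac w ω x| ^ S.t) ≤ u x) :
    ∫⁻ y, g y ∂ν (S.θ^[n] ω) ≤ ENNReal.ofReal (S.Λ lam n ω) * ∫⁻ x in S.cyl w ω, u x ∂ν ω := by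
  subst hn
  rw [h.fwd_word w ω hg]
  gcongr ENNReal.ofReal _ * ?_
  exact setLIntegral_mono' (S.measurableSet_cyl _ _) hu

end Conf

theorem one_le_wt {x : ℝ} (hx : x ∈ Ioo (0 : ℝ) 1) : 1 ≤ S.wt x := by
  rw [wt, ← ENNReal.ofReal_one]
  refine ENNReal.ofReal_le_ofReal ?_
  exact Real.one_le_rpow_of_pos_of_le_one_of_nonpos (e_pos hx) ((e_le_left _).trans hx.2.le)
    (neg_nonpos.2 S.a_pos.le)

variable (S) in
/-- The constant in `launch_bound`. -/
def C3 : ℝ := 2 * (S.A ^ (2 * S.a) * (S.A * S.C₁) ^ S.t)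

theorem C3_pos : 0 < S.C3 := by
  have := S.A_pos; have := S.C₁_pos; unfold C3; positivity

theorem wt_le_of_le {x y : ℝ} (hx : 0 < e x) (hy : 0 < y) (hxy : y ≤ S.A ^ 2 * e x) :
    S.wt x ≤ ENNReal.ofReal (S.A ^ (2 * S.a)) * ENNReal.ofReal (y ^ (-S.a)) := by
  have hA := S.A_pos
  rw [← ENNReal.ofReal_mul (by positivity), wt]
  refine ENNReal.ofReal_le_ofReal ?_
  have h1 : (S.A ^ 2 * e x) ^ (-S.a) ≤ y ^ (-S.a) :=
    Real.rpow_le_rpow_of_nonpos hy hxy (neg_nonpos.2 S.a_pos.le)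
  rw [Real.mul_rpow (by positivity) hx.le] at h1
  have h2 : S.A ^ (2 * S.a) * (S.A ^ 2) ^ (-S.a) = 1 := by
    rw [← Real.rpow_natCast, ← Real.rpow_mul hA.le, ← Real.rpow_add hA]
    norm_num
  calc e x ^ (-S.a) = S.A ^ (2 * S.a) * ((S.A ^ 2) ^ (-S.a) * e x ^ (-S.a)) := by
        rw [← mul_assoc, h2, one_mul]
    _ ≤ _ := by gcongr

theorem it_two (ω : Ω) (x : ℝ) : S.it 2 ω x = S.T (S.θ ω) (S.T ω x) := rfl

/-- Of the r + 3 letters that define `bad0`, two steps leave r + 1, which still puts the image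
within ρ of 0. -/
theorem lower_bad0 {ω : Ω} {x : ℝ} (hx : x ∈ S.bad0 ω) :
    x ∈ S.cyl [S.G.i0, S.G.i0] ω ∧ S.it 2 ω x ∈ S.cyl (S.rep (S.r + 1)) (S.θ (S.θ ω)) ∧
    1 ≤ |S.jac [S.G.i0, S.G.i0] ω x| ∧
    S.wt x ≤ ENNReal.ofReal (S.A ^ (2 * S.a)) * ENNReal.ofReal (S.it 2 ω x ^ (-S.a)) := by
  have h2 : S.it 2 ω x ∈ S.cyl (S.rep (S.r + 1)) (S.θ (S.θ ω)) := hx.2.2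
  have hu := S.cyl_subset_unit _ _ h2
  have hc1 := S.ocell_subset _ hx.1
  have hc2 := S.ocell_subset _ hx.2.1
  have hc3 : S.it 2 ω x ∈ S.G.cell S.G.i0 := S.ocell_subset _ h2.1
  have hA := S.A_pos
  refine ⟨⟨hx.1, hx.2.1, hu⟩, h2, ?_, ?_⟩
  · have h3 := (S.branch ω).expand_zero x hc1 hc2
    have h4 := (S.branch (S.θ ω)).expand_zero _ hc2 hc3
    simp only [jac, mul_one, abs_mul]
    have := S.one_lt_κ
    nlinarith
  · have hx0 : 0 < x := (S.ocell_subset_unit _ hx.1).1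
    have he := e_bad0 hx
    refine wt_le_of_le (by rw [he]; exact hx0) hu.1 ?_
    rw [he, it_two]
    have h3 := T_le_mul_i0 (ω := ω) hc1
    have h4 := T_le_mul_i0 (ω := S.θ ω) hc2
    nlinarith

theorem lower_bad1 {ω : Ω} {x : ℝ} (hx : x ∈ S.bad1 ω) :
    x ∈ S.cyl [S.G.i1, S.G.i0] ω ∧ S.it 2 ω x ∈ S.cyl (S.rep (S.r + 1)) (S.θ (S.θ ω)) ∧
    1 ≤ |S.jac [S.G.i1, S.G.i0] ω x| ∧
    S.wt x ≤ ENNReal.ofReal (S.A ^ (2 * S.a)) * ENNReal.ofReal (S.it 2 ω x ^ (-S.a)) := by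
  have h2' : S.it 2 ω x ∈ S.cyl (S.rep (S.r + 2)) (S.θ (S.θ ω)) := hx.2.2
  have h2 := S.cyl_rep_anti (Nat.le_succ (S.r + 1)) _ h2'
  have hu := S.cyl_subset_unit _ _ h2
  have hc1 := S.ocell_subset _ hx.1
  have hc2 := S.ocell_subset _ hx.2.1
  have hc3 : S.it 2 ω x ∈ S.G.cell S.G.i0 := S.ocell_subset _ h2.1
  have hA := S.A_pos
  obtain ⟨f1, f2, f3⟩ := bad1_facts hx
  refine ⟨⟨hx.1, hx.2.1, hu⟩, h2, ?_, ?_⟩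
  · have h4 := (S.branch (S.θ ω)).expand_zero _ hc2 hc3
    simp only [jac, mul_one, abs_mul]
    have := S.one_lt_κ
    nlinarith
  · have hx0 : x < 1 := (S.ocell_subset_unit _ hx.1).2
    refine wt_le_of_le (by rw [f3]; linarith) hu.1 ?_
    rw [f3, it_two]
    have h3 := T_le_mul_i1 (ω := ω) hc1
    have h4 := T_le_mul_i0 (ω := S.θ ω) hc2
    nlinarith

/-- A cell with a critical point of the highest order is launched close to `0` in two steps. -/
theorem exists_launch (ω : Ω) : ∃ s, S.cyl [S.j, s] ω ∩ S.reg ω ⊆ S.K ω ∧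
    ∀ x ∈ S.cyl [S.j, s] ω, S.it 2 ω x ∈ S.cyl (S.rep (S.r + 1)) (S.θ (S.θ ω)) →
      |S.jac [S.j, s] ω x| ≤ S.A * S.C₁ * S.it 2 ω x ^ S.α := by
  have hA := S.A_pos
  have hC := S.C₁_pos
  have hα := S.α_pos
  have key : ∀ s x, x ∈ S.cyl [S.j, s] ω → ∀ v, 0 ≤ v → v ≤ S.it 2 ω x →
      |S.d ω S.j x| ≤ S.C₁ * v ^ S.α →
      |S.jac [S.j, s] ω x| ≤ S.A * S.C₁ * S.it 2 ω x ^ S.α := by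
    intro s x hx v hv0 hv hd
    have h1 := (S.branch (S.θ ω)).deriv_le s _ (S.ocell_subset _ hx.2.1)
    simp only [jac, mul_one, abs_mul]
    have h2 : v ^ S.α ≤ S.it 2 ω x ^ S.α := by gcongr
    calc _ ≤ (S.C₁ * v ^ S.α) * S.A := by gcongr
      _ ≤ (S.C₁ * S.it 2 ω x ^ S.α) * S.A := by gcongr
      _ = _ := by ring
  -- If the critical value is 0, the second letter is the cell of 0; if it is 1, the second letter
  -- is the cell of 1, which brings points near 1 to points near 0. In either case the word is not
  -- the beginning of a word of `bad`.
  rcases (S.branch ω).launch with ⟨hj0, hj1, hl⟩ | hl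
  · refine ⟨S.G.i0, fun x hx => ⟨hx.2, ?_⟩, fun x hx h2 => ?_⟩
    · rintro (hb | hb)
      · exact hj0 (S.ocell_inj hx.1.1 hb.1)
      · exact hj1 (S.ocell_inj hx.1.1 hb.1)
    · have hc2 := S.ocell_subset _ hx.2.1
      have hT0 := (S.G.cell_subset _ hc2).1
      refine key _ x hx _ hT0 ?_ (hl x (S.ocell_subset _ hx.1))
      have := κ_mul_le hc2 (S.ocell_subset _ h2.1)
      rw [it_two]
      nlinarith [S.one_lt_κ]
  · refine ⟨S.G.i1, fun x hx => ⟨hx.2, ?_⟩, fun x hx h2 => ?_⟩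
    · have h1 := hx.1.2.1
      rintro (hb | hb)
      · exact S.G.i0_ne_i1 (S.ocell_inj hb.2.1 h1)
      · exact S.G.i0_ne_i1 (S.ocell_inj hb.2.1 h1)
    · have hc2 := S.ocell_subset _ hx.2.1
      refine key _ x hx (1 - S.T ω x) (by linarith [(S.G.cell_subset _ hc2).2]) ?_
        (hl x (S.ocell_subset _ hx.1))
      exact ((S.branch (S.θ ω)).expand_one _ hc2 (le_ρ h2)).2

namespace Conf
variable {ν : Ω → Measure ℝ} {lam : Ω → ℝ} (h : S.Conf ν lam)
include h

/-- Two steps later both sides are compared with the integral of y^(-a) over the same set V near 0.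
From `bad` one arrives with derivative at least 1 and with weight at most of order y^(-a). On the
cylinder of `exists_launch`, which lies in K up to irregular points, the t-th power of the
derivative is at most of order y^a and cancels y^(-a). Since H is pulled back from the fibre two
steps ahead, it can be any event of the future. -/
theorem launch_bound (ω : Ω) {H : Set ℝ} (hH : MeasurableSet H) :
    ∫⁻ x in S.bad ω ∩ S.it 2 ω ⁻¹' H, S.wt x ∂ν ω ≤
      ENNReal.ofReal S.C3 * ν ω (S.K ω ∩ S.it 2 ω ⁻¹' H) := by
  have hA := S.A_pos
  have hC := S.C₁_pos
  set V := H ∩ S.cyl (S.rep (S.r + 1)) (S.θ (S.θ ω)) with hV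
  have hVm : MeasurableSet V := hH.inter (S.measurableSet_cyl _ _)
  set φ : ℝ → ENNReal := V.indicator fun y => ENNReal.ofReal (y ^ (-S.a)) with hφ
  have hφm : Measurable φ := ((measurable_id.pow_const _).ennreal_ofReal).indicator hVm
  set a2 := ENNReal.ofReal (S.A ^ (2 * S.a)) with ha2
  have part : ∀ (X : Set ℝ) (i k : ι), (∀ x ∈ X, x ∈ S.cyl [i, k] ω ∧
      S.it 2 ω x ∈ S.cyl (S.rep (S.r + 1)) (S.θ (S.θ ω)) ∧ 1 ≤ |S.jac [i, k] ω x| ∧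
      S.wt x ≤ a2 * ENNReal.ofReal (S.it 2 ω x ^ (-S.a))) →
      ENNReal.ofReal (S.Λ lam 2 ω) * ∫⁻ x in X ∩ S.it 2 ω ⁻¹' H, S.wt x ∂ν ω ≤
        a2 * ∫⁻ y, φ y ∂ν (S.θ^[2] ω) := by
    intro X i k hX
    rw [← lintegral_const_mul _ hφm]
    refine h.lintegral_le [i, k] (n := 2) rfl (fun x hx => (hX x hx.1).1) (hφm.const_mul _) fun x hx => ?_
    obtain ⟨-, h2, h3, h4⟩ := hX x hx.1
    rw [hφ, indicator_of_mem (show S.it 2 ω x ∈ V from ⟨hx.2, h2⟩)]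
    refine h4.trans (le_mul_of_one_le_right' ?_)
    rw [← ENNReal.ofReal_one]
    exact ENNReal.ofReal_le_ofReal (Real.one_le_rpow h3 S.t_pos.le)
  have p0 := part _ _ _ fun x (hx : x ∈ S.bad0 ω) => lower_bad0 hx
  have p1 := part _ _ _ fun x (hx : x ∈ S.bad1 ω) => lower_bad1 hx
  obtain ⟨s, hsK, hs⟩ := S.exists_launch ω
  have hup : ∫⁻ y, φ y ∂ν (S.θ^[2] ω) ≤ ENNReal.ofReal (S.Λ lam 2 ω) *
      (ENNReal.ofReal ((S.A * S.C₁) ^ S.t) * ν ω (S.K ω ∩ S.it 2 ω ⁻¹' H)) := by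
    refine (h.le_lintegral [S.j, s] (n := 2) rfl hφm (u := (S.it 2 ω ⁻¹' H).indicator fun _ =>
      ENNReal.ofReal ((S.A * S.C₁) ^ S.t)) fun x hx => ?_).trans ?_
    · by_cases hxV : S.it 2 ω x ∈ V
      · rw [hφ, indicator_of_mem hxV, indicator_of_mem (show x ∈ S.it 2 ω ⁻¹' H from hxV.1)]
        have hy := (S.cyl_subset_unit _ _ hxV.2).1
        have hy' : 0 < S.it 2 ω x ^ (-S.a) := Real.rpow_pos_of_pos hy _
        rw [← ENNReal.ofReal_mul hy'.le]
        refine ENNReal.ofReal_le_ofReal ?_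
        have h5 := Real.rpow_le_rpow (abs_nonneg _) (hs x hx hxV.2) S.t_pos.le
        rw [Real.mul_rpow (by positivity) (Real.rpow_nonneg hy.le _), ← Real.rpow_mul hy.le,
          mul_comm S.α] at h5
        calc _ ≤ S.it 2 ω x ^ (-S.a) * ((S.A * S.C₁) ^ S.t * S.it 2 ω x ^ S.a) := by
              gcongr; exact h5
          _ = (S.A * S.C₁) ^ S.t * (S.it 2 ω x ^ (-S.a) * S.it 2 ω x ^ S.a) := by ring
          _ = _ := by rw [← Real.rpow_add hy, neg_add_cancel, Real.rpow_zero, mul_one]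
      · rw [hφ, indicator_of_notMem hxV]; simp
    · gcongr
      rw [lintegral_indicator (S.measurable_it 2 ω hH), lintegral_const,
        Measure.restrict_apply MeasurableSet.univ, univ_inter,
        Measure.restrict_apply (S.measurable_it 2 ω hH)]
      gcongr ENNReal.ofReal _ * ?_
      exact h.measure_le_of_inter fun x hx => mem_inter (hsK ⟨hx.1.2, hx.2⟩) hx.1.1
  have hne := h.Λ_ne_zero 2 ω
  refine (ENNReal.mul_le_mul_iff_right hne ENNReal.ofReal_ne_top).1 ?_
  calc ENNReal.ofReal (S.Λ lam 2 ω) * ∫⁻ x in S.bad ω ∩ S.it 2 ω ⁻¹' H, S.wt x ∂ν ω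
      ≤ ENNReal.ofReal (S.Λ lam 2 ω) * (∫⁻ x in S.bad0 ω ∩ S.it 2 ω ⁻¹' H, S.wt x ∂ν ω +
          ∫⁻ x in S.bad1 ω ∩ S.it 2 ω ⁻¹' H, S.wt x ∂ν ω) := by
        gcongr
        rw [bad, union_inter_distrib_right]
        exact lintegral_union_le _ _ _
    _ ≤ a2 * ∫⁻ y, φ y ∂ν (S.θ^[2] ω) + a2 * ∫⁻ y, φ y ∂ν (S.θ^[2] ω) := by
        rw [mul_add]; gcongr
    _ ≤ a2 * (ENNReal.ofReal (S.Λ lam 2 ω) *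
        (ENNReal.ofReal ((S.A * S.C₁) ^ S.t) * ν ω (S.K ω ∩ S.it 2 ω ⁻¹' H))) +
        a2 * (ENNReal.ofReal (S.Λ lam 2 ω) *
        (ENNReal.ofReal ((S.A * S.C₁) ^ S.t) * ν ω (S.K ω ∩ S.it 2 ω ⁻¹' H))) := by gcongr
    _ = _ := by
        rw [C3, ENNReal.ofReal_mul two_pos.le, ENNReal.ofReal_mul (by positivity),
          ENNReal.ofReal_ofNat]
        ring

end Conf

end System
-- Uniform mass bounds, reference derivatives and last visits to K
namespace System
variable {ι Ω : Type*} {S : System ι Ω}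

variable (S) in
/-- A bound for the integral of the weight. -/
def Cw : ℝ := S.C3 + S.δ ^ (-S.a)

theorem Cw_pos : 0 < S.Cw := by
  have := S.C3_pos; have := S.δ_pos; unfold Cw; positivity

variable (S) in
/-- An upper bound for `lam`. -/
def M : ℝ := Nat.card ι * S.Cw / S.c₀ ^ S.t

namespace Conf
variable {ν : Ω → Measure ℝ} {lam : Ω → ℝ} (h : S.Conf ν lam)
include h

theorem measure_reg (ω : Ω) : ν ω (S.reg ω) = 1 := by
  have := h.prob ω
  rw [← h.measure_inter_reg ω univ |>.trans measure_univ, univ_inter]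

theorem lintegral_bad_le (ω : Ω) :
    ∫⁻ x in S.bad ω, S.wt x ∂ν ω ≤ ENNReal.ofReal S.C3 * ν ω (S.K ω) := by
  simpa using h.launch_bound ω MeasurableSet.univ

/-- The weight is at least 1, so the launch estimate already bounds the mass of `bad` by a multiple
of the mass of K. -/
theorem one_le_measure_K (ω : Ω) : 1 ≤ ENNReal.ofReal (1 + S.C3) * ν ω (S.K ω) := by
  have h1 : ν ω (S.bad ω) ≤ ∫⁻ x in S.bad ω, S.wt x ∂ν ω := by
    rw [← setLIntegral_one]
    refine setLIntegral_mono' (S.measurableSet_bad ω) fun x hx => one_le_wt ?_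
    rcases hx with hx | hx <;> exact S.cyl_subset_unit _ _ hx
  have h2 : ν ω (S.reg ω) ≤ ν ω (S.K ω) + ν ω (S.bad ω) := by
    refine (measure_mono ?_).trans (measure_union_le _ _)
    intro x hx
    by_cases hb : x ∈ S.bad ω
    · exact Or.inr hb
    · exact Or.inl ⟨hx, hb⟩
  rw [h.measure_reg] at h2
  rw [ENNReal.ofReal_add zero_le_one S.C3_pos.le, ENNReal.ofReal_one, add_mul, one_mul]
  exact h2.trans (by gcongr; exact h1.trans (h.lintegral_bad_le ω))

theorem lintegral_wt_le (ω : Ω) : ∫⁻ x, S.wt x ∂ν ω ≤ ENNReal.ofReal S.Cw := by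
  have := h.prob ω
  have hδ := S.δ_pos
  have h1 : ∫⁻ x in S.K ω, S.wt x ∂ν ω ≤ ENNReal.ofReal (S.δ ^ (-S.a)) := by
    calc _ ≤ ∫⁻ x in S.K ω, ENNReal.ofReal (S.δ ^ (-S.a)) ∂ν ω := by
          refine setLIntegral_mono measurable_const fun x hx => ENNReal.ofReal_le_ofReal ?_
          have hx' := S.K_subset _ hx
          refine Real.rpow_le_rpow_of_nonpos hδ (le_min hx'.1 (by linarith [hx'.2]))
            (neg_nonpos.2 S.a_pos.le)
      _ ≤ ENNReal.ofReal (S.δ ^ (-S.a)) * 1 := by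
          rw [setLIntegral_const]; gcongr; exact prob_le_one
      _ = _ := mul_one _
  have h2 : ∫⁻ x, S.wt x ∂ν ω ≤ ∫⁻ x in S.bad ω ∪ S.K ω, S.wt x ∂ν ω := by
    rw [← setLIntegral_univ]
    refine lintegral_mono' (Measure.le_iff.2 fun s hs => ?_) le_rfl
    rw [Measure.restrict_apply hs, Measure.restrict_apply hs]
    refine h.measure_le_of_inter fun x hx => ⟨hx.1.1, ?_⟩
    by_cases hb : x ∈ S.bad ω
    · exact Or.inl hb
    · exact Or.inr ⟨hx.2, hb⟩
  calc _ ≤ _ := h2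
    _ ≤ _ := lintegral_union_le _ _ _
    _ ≤ ENNReal.ofReal S.C3 * 1 + ENNReal.ofReal (S.δ ^ (-S.a)) := by
        gcongr
        refine (h.lintegral_bad_le ω).trans ?_
        gcongr; exact prob_le_one
    _ = _ := by rw [mul_one, Cw, ENNReal.ofReal_add S.C3_pos.le (by positivity)]

theorem one_le_Λ_mul (w : List ι) {n : ℕ} (hn : w.length = n) (ω : Ω) :
    1 ≤ ENNReal.ofReal (S.Λ lam n ω) * (ENNReal.ofReal ((S.A ^ n) ^ S.t) * ν ω (S.cyl w ω)) := by
  have := h.prob (S.θ^[n] ω)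
  have hA := S.A_pos
  have hJ : ∀ (w : List ι) (ω : Ω), ∀ x ∈ S.cyl w ω, |S.jac w ω x| ≤ S.A ^ w.length := by
    intro w
    induction w with
    | nil => intro ω x _; simp [jac]
    | cons i w ih =>
      intro ω x hx
      simp only [jac, abs_mul, List.length_cons]
      rw [pow_succ']
      have h1 := ih _ _ hx.2
      have h2 := (S.branch ω).deriv_le i x (S.ocell_subset _ hx.1)
      gcongr
  have h1 := h.le_lintegral w hn (ω := ω) (g := fun _ => 1)
    (u := fun _ => ENNReal.ofReal ((S.A ^ n) ^ S.t)) measurable_const fun x hx => by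
      rw [one_mul]
      refine ENNReal.ofReal_le_ofReal (Real.rpow_le_rpow (abs_nonneg _) ?_ S.t_pos.le)
      subst hn
      exact hJ w ω x hx
  rwa [lintegral_one, measure_univ, setLIntegral_const] at h1

theorem one_le_lam (ω : Ω) : 1 ≤ lam ω * S.A ^ S.t := by
  have := h.prob ω
  have hA := S.A_pos
  have h1 := h.one_le_Λ_mul [S.G.i0] (n := 1) rfl ω
  have h2 : S.Λ lam 1 ω = lam ω := by simp [Λ, cocycle]
  rw [h2, pow_one, ← mul_assoc, ← ENNReal.ofReal_mul (h.pos ω).le] at h1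
  have h3 : 1 ≤ ENNReal.ofReal (lam ω * S.A ^ S.t) := by
    refine h1.trans ?_
    calc _ ≤ ENNReal.ofReal (lam ω * S.A ^ S.t) * 1 := by gcongr; exact prob_le_one
      _ = _ := mul_one _
  rwa [ENNReal.one_le_ofReal] at h3

/-- On each cell the weight at the image makes up for a vanishing derivative, so λ times the mass of
the cell is at most a constant multiple of the bounded weighted mass of the next fibre. The cells
together carry all the mass. -/
theorem lam_le [Finite ι] (ω : Ω) : lam ω ≤ S.M := by
  have := Fintype.ofFinite ι
  have hc := S.c₀_pos
  have h2 : S.Λ lam 1 ω = lam ω := by simp [Λ, cocycle]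
  have h1 : ∀ i, ENNReal.ofReal (lam ω) * (ENNReal.ofReal (S.c₀ ^ S.t) * ν ω (S.cyl [i] ω)) ≤
      ENNReal.ofReal S.Cw := by
    intro i
    have h3 := h.lintegral_le [i] (n := 1) rfl (ω := ω) (X := S.cyl [i] ω) subset_rfl (g := S.wt)
      (u := fun _ => ENNReal.ofReal (S.c₀ ^ S.t)) S.measurable_wt fun x hx => by
        have he := e_pos hx.2
        rw [wt, ← ENNReal.ofReal_mul (by positivity)]
        refine ENNReal.ofReal_le_ofReal ?_
        have h4 := rpow_le_d (ω := ω) (S.ocell_subset i hx.1)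
        simp only [jac, mul_one]
        calc S.c₀ ^ S.t = e (S.T ω x) ^ (-S.a) * (S.c₀ ^ S.t * e (S.T ω x) ^ S.a) := by
              rw [mul_left_comm, ← Real.rpow_add he, neg_add_cancel, Real.rpow_zero, mul_one]
          _ ≤ _ := mul_le_mul_of_nonneg_left h4 (Real.rpow_nonneg he.le _)
    rw [h2, setLIntegral_const] at h3
    exact h3.trans (h.lintegral_wt_le _)
  have h3 : (1 : ENNReal) ≤ ∑ i, ν ω (S.cyl [i] ω) := by
    rw [← h.measure_reg ω]
    refine (measure_mono fun x hx => ?_).trans (measure_iUnion_fintype_le _ _)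
    obtain ⟨⟨i, hi⟩, hT⟩ := S.mem_reg_iff.1 hx
    exact mem_iUnion.2 ⟨i, hi, S.reg_subset_unit _ hT⟩
  have h4 : ENNReal.ofReal (lam ω * S.c₀ ^ S.t) ≤ ENNReal.ofReal (Nat.card ι * S.Cw) := by
    calc ENNReal.ofReal (lam ω * S.c₀ ^ S.t)
        ≤ ENNReal.ofReal (lam ω * S.c₀ ^ S.t) * ∑ i, ν ω (S.cyl [i] ω) := le_mul_of_one_le_right' h3
      _ = ∑ i, ENNReal.ofReal (lam ω) * (ENNReal.ofReal (S.c₀ ^ S.t) * ν ω (S.cyl [i] ω)) := by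
          rw [Finset.mul_sum, ENNReal.ofReal_mul (h.pos ω).le]
          simp only [mul_assoc]
      _ ≤ ∑ _i : ι, ENNReal.ofReal S.Cw := Finset.sum_le_sum fun i _ => h1 i
      _ = _ := by
          rw [Finset.sum_const, Finset.card_univ, Nat.card_eq_fintype_card, nsmul_eq_mul,
            ENNReal.ofReal_mul (Nat.cast_nonneg _), ENNReal.ofReal_natCast]
  rw [ENNReal.ofReal_le_ofReal_iff (mul_nonneg (Nat.cast_nonneg _) Cw_pos.le)] at h4
  rw [M, le_div_iff₀ (by positivity)]
  exact h4

theorem Λ_le [Finite ι] (n : ℕ) (ω : Ω) : S.Λ lam n ω ≤ S.M ^ n := by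
  rw [Λ, cocycle]
  refine (Finset.prod_le_prod (fun k _ => (h.pos _).le) (fun k _ => h.lam_le _)).trans ?_
  simp

/-- Cylinders of a given depth have mass bounded below. -/
theorem le_measure_cyl [Finite ι] {w : List ι} {n : ℕ} (hn : w.length = n) (ω : Ω) :
    1 ≤ ENNReal.ofReal (S.M ^ n * (S.A ^ n) ^ S.t) * ν ω (S.cyl w ω) := by
  have hM : 0 ≤ S.M := (h.pos ω).le.trans (h.lam_le ω)
  refine (h.one_le_Λ_mul w hn ω).trans ?_
  rw [ENNReal.ofReal_mul (by positivity), mul_assoc]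
  gcongr
  exact h.Λ_le n ω

end Conf

theorem exists_ref (S : System ι Ω) (w : List ι) (ω : Ω) :
    ∃ x ∈ S.ccyl w ω, S.it w.length ω x = 1 / 2 :=
  (S.cylFacts w ω).bij.surjOn ⟨by norm_num, by norm_num⟩

/-- The reference value of the Jacobian on a cylinder. -/
def ref (S : System ι Ω) (w : List ι) (ω : Ω) : ℝ := |S.jac w ω (S.exists_ref w ω).choose| ^ S.t

theorem ref_le {w : List ι} {ω : Ω} {x : ℝ} (hx : x ∈ S.ccyl w ω)
    (hd : S.it w.length ω x ∈ Icc S.δ (1 - S.δ)) :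
    (S.δ ^ 2) ^ S.t * S.ref w ω ≤ |S.jac w ω x| ^ S.t := by
  have h1 := (S.cylFacts w ω).distortion S.δ_pos (S.exists_ref w ω).choose_spec.1 hx hd
  rw [ref, ← Real.mul_rpow (by positivity) (abs_nonneg _)]
  exact Real.rpow_le_rpow (by positivity) h1 S.t_pos.le

theorem le_ref {w : List ι} {ω : Ω} {x : ℝ} (hx : x ∈ S.ccyl w ω) :
    |S.jac w ω x| ^ S.t ≤ 4 ^ S.t * S.ref w ω := by
  have hs := (S.exists_ref w ω).choose_spec
  have h1 := (S.cylFacts w ω).distortion (δ := 1 / 2) (by norm_num) hx hs.1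
    (by rw [hs.2]; norm_num)
  rw [ref, ← Real.mul_rpow (by positivity) (abs_nonneg _)]
  exact Real.rpow_le_rpow (by positivity) (by linarith) S.t_pos.le

theorem ref_pos (w : List ι) (ω : Ω) : 0 < S.ref w ω := by
  refine Real.rpow_pos_of_pos ((abs_nonneg _).lt_of_ne' fun h0 => ?_) _
  have hf := S.cylFacts w ω
  have hs := (S.exists_ref w ω).choose_spec
  obtain ⟨q₁, hq₁, hFq₁⟩ := hf.bij.surjOn (right_mem_Icc.2 zero_le_one)
  obtain ⟨q₀, hq₀, hFq₀⟩ := hf.bij.surjOn (left_mem_Icc.2 zero_le_one)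
  have := hf.abs_sub_le hq₀ hq₁ (M := 0) fun z hz => by
    have h1 := hf.distortion (δ := 1 / 2) (by norm_num) (hf.ord.uIcc_subset hq₀ hq₁ hz) hs.1
      (by rw [hs.2]; norm_num)
    rw [h0] at h1
    linarith
  rw [hFq₁, hFq₀] at this
  norm_num at this

/-- The sum of the reference values of `J⁻ᵗ` over the words of length `n`. -/
def γ (S : System ι Ω) (n : ℕ) (ω : Ω) : ENNReal :=
  ∑' w : {w : List ι // w.length = n}, (ENNReal.ofReal (S.ref w ω))⁻¹

namespace Conf
variable {ν : Ω → Measure ℝ} {lam : Ω → ℝ} (h : S.Conf ν lam)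
include h

theorem word_le {w : List ι} {n : ℕ} (hn : w.length = n) {ω : Ω} {B : Set ℝ}
    (hB : MeasurableSet B) (hBδ : B ⊆ Icc S.δ (1 - S.δ)) :
    ENNReal.ofReal (S.Λ lam n ω) * (ENNReal.ofReal ((S.δ ^ 2) ^ S.t * S.ref w ω) *
      ν ω (S.cyl w ω ∩ S.it n ω ⁻¹' B)) ≤ ν (S.θ^[n] ω) B := by
  have h1 := h.lintegral_le w hn (ω := ω) (X := S.cyl w ω ∩ S.it n ω ⁻¹' B)
    (g := B.indicator 1) (u := fun _ => ENNReal.ofReal ((S.δ ^ 2) ^ S.t * S.ref w ω))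
    inter_subset_left (measurable_one.indicator hB) fun x hx => by
      rw [indicator_of_mem (show S.it n ω x ∈ B from hx.2), Pi.one_apply, one_mul]
      refine ENNReal.ofReal_le_ofReal (ref_le (S.cyl_subset_ccyl _ _ hx.1) ?_)
      rw [hn]; exact hBδ hx.2
  rwa [lintegral_indicator_one hB, setLIntegral_const] at h1

theorem le_word {w : List ι} {n : ℕ} (hn : w.length = n) {ω : Ω} {B : Set ℝ}
    (hB : MeasurableSet B) :
    ν (S.θ^[n] ω) B ≤ ENNReal.ofReal (S.Λ lam n ω) * (ENNReal.ofReal (4 ^ S.t * S.ref w ω) *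
      ν ω (S.cyl w ω ∩ S.it n ω ⁻¹' B)) := by
  have h1 := h.le_lintegral w hn (ω := ω) (g := B.indicator 1)
    (u := (S.it n ω ⁻¹' B).indicator fun _ => ENNReal.ofReal (4 ^ S.t * S.ref w ω))
    (measurable_one.indicator hB) fun x hx => by
      by_cases hxB : S.it n ω x ∈ B
      · rw [indicator_of_mem hxB, indicator_of_mem (show x ∈ S.it n ω ⁻¹' B from hxB),
          Pi.one_apply, one_mul]
        exact ENNReal.ofReal_le_ofReal (le_ref (S.cyl_subset_ccyl _ _ hx))
      · rw [indicator_of_notMem hxB]; simp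
  have hm := S.measurable_it n ω hB
  rwa [lintegral_indicator_one hB, lintegral_indicator hm, lintegral_const,
    Measure.restrict_apply MeasurableSet.univ, univ_inter, Measure.restrict_apply hm,
    inter_comm] at h1

/-- On each n-cylinder the derivative at the preimages of B is comparable with the reference value,
so the mass of the preimage is the mass of B times the sum of inverse reference values, divided by
the product of the λ's. That sum is the same for all conformal families. -/
theorem preimage_le [Countable ι] {n : ℕ} {ω : Ω} {B : Set ℝ} (hB : MeasurableSet B)
    (hBδ : B ⊆ Icc S.δ (1 - S.δ)) :
    ENNReal.ofReal ((S.δ ^ 2) ^ S.t) * (ENNReal.ofReal (S.Λ lam n ω) * ν ω (S.it n ω ⁻¹' B)) ≤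
      S.γ n ω * ν (S.θ^[n] ω) B := by
  have hδ := S.δ_pos
  calc _ ≤ ENNReal.ofReal ((S.δ ^ 2) ^ S.t) * (ENNReal.ofReal (S.Λ lam n ω) *
        ∑' w : {w : List ι // w.length = n}, ν ω (S.cyl w ω ∩ S.it n ω ⁻¹' B)) := by
        gcongr
        refine le_trans (h.measure_le_of_inter fun x hx => ?_) (measure_iUnion_le _)
        exact mem_iUnion.2 ⟨⟨S.itin n ω x, S.length_itin _ _ _⟩, S.mem_cyl_itin hx.2 n, hx.1⟩
    _ = ∑' w : {w : List ι // w.length = n}, ENNReal.ofReal ((S.δ ^ 2) ^ S.t) *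
        (ENNReal.ofReal (S.Λ lam n ω) * ν ω (S.cyl w ω ∩ S.it n ω ⁻¹' B)) := by
        rw [ENNReal.tsum_mul_left, ENNReal.tsum_mul_left]
    _ ≤ ∑' w : {w : List ι // w.length = n},
        (ENNReal.ofReal (S.ref w ω))⁻¹ * ν (S.θ^[n] ω) B := by
        refine ENNReal.tsum_le_tsum fun w => ?_
        have hr := ENNReal.ofReal_pos.2 (S.ref_pos w.1 ω)
        have h1 := h.word_le w.2 (ω := ω) hB hBδ
        calc _ = (ENNReal.ofReal (S.ref w ω))⁻¹ * (ENNReal.ofReal (S.Λ lam n ω) *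
              (ENNReal.ofReal ((S.δ ^ 2) ^ S.t * S.ref w ω) *
              ν ω (S.cyl w ω ∩ S.it n ω ⁻¹' B))) := by
              rw [ENNReal.ofReal_mul (by positivity)]
              calc _ = ((ENNReal.ofReal (S.ref w ω))⁻¹ * ENNReal.ofReal (S.ref w ω)) *
                    (ENNReal.ofReal ((S.δ ^ 2) ^ S.t) *
                    (ENNReal.ofReal (S.Λ lam n ω) * ν ω (S.cyl w ω ∩ S.it n ω ⁻¹' B))) := by
                    rw [ENNReal.inv_mul_cancel hr.ne' ENNReal.ofReal_ne_top, one_mul]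
                _ = _ := by ring
          _ ≤ _ := by gcongr
    _ = _ := ENNReal.tsum_mul_right

/-- B is arbitrary here: the reference value, taken at the preimage of 1/2, bounds the derivative
from above on the whole cylinder. -/
theorem le_preimage [Countable ι] {n : ℕ} {ω : Ω} {B : Set ℝ} (hB : MeasurableSet B) :
    S.γ n ω * ν (S.θ^[n] ω) B ≤
      ENNReal.ofReal (4 ^ S.t) * (ENNReal.ofReal (S.Λ lam n ω) * ν ω (S.it n ω ⁻¹' B)) := by
  calc _ = ∑' w : {w : List ι // w.length = n},
        (ENNReal.ofReal (S.ref w ω))⁻¹ * ν (S.θ^[n] ω) B := ENNReal.tsum_mul_right.symm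
    _ ≤ ∑' w : {w : List ι // w.length = n}, ENNReal.ofReal (4 ^ S.t) *
        (ENNReal.ofReal (S.Λ lam n ω) * ν ω (S.cyl w ω ∩ S.it n ω ⁻¹' B)) := by
        refine ENNReal.tsum_le_tsum fun w => ?_
        have hr := ENNReal.ofReal_pos.2 (S.ref_pos w.1 ω)
        have h1 := h.le_word w.2 (ω := ω) hB
        calc _ ≤ (ENNReal.ofReal (S.ref w ω))⁻¹ * (ENNReal.ofReal (S.Λ lam n ω) *
              (ENNReal.ofReal (4 ^ S.t * S.ref w ω) * ν ω (S.cyl w ω ∩ S.it n ω ⁻¹' B))) := by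
              gcongr
          _ = ((ENNReal.ofReal (S.ref w ω))⁻¹ * ENNReal.ofReal (S.ref w ω)) *
              (ENNReal.ofReal (4 ^ S.t) *
              (ENNReal.ofReal (S.Λ lam n ω) * ν ω (S.cyl w ω ∩ S.it n ω ⁻¹' B))) := by
              rw [ENNReal.ofReal_mul (by positivity)]; ring
          _ = _ := by rw [ENNReal.inv_mul_cancel hr.ne' ENNReal.ofReal_ne_top, one_mul]
    _ = ENNReal.ofReal (4 ^ S.t) * (ENNReal.ofReal (S.Λ lam n ω) *
        ∑' w : {w : List ι // w.length = n}, ν ω (S.cyl w ω ∩ S.it n ω ⁻¹' B)) := by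
        rw [ENNReal.tsum_mul_left, ENNReal.tsum_mul_left]
    _ ≤ _ := by
        gcongr ENNReal.ofReal _ * (ENNReal.ofReal _ * ?_)
        refine (tsum_meas_le_meas_iUnion_of_disjoint _ (fun w =>
          (S.measurableSet_cyl _ _).inter (S.measurable_it n ω hB)) ?_).trans
          (measure_mono (iUnion_subset fun w => inter_subset_right))
        intro w w' hww
        refine Set.disjoint_left.2 fun x hx hx' => hww (Subtype.ext ?_)
        rw [← S.itin_eq hx.1, ← S.itin_eq hx'.1, w.2, w'.2]

theorem γ_ne_top [Countable ι] (n : ℕ) (ω : Ω) : S.γ n ω ≠ ⊤ := by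
  have := h.prob ω
  intro htop
  have h1 := h.le_preimage (n := n) (ω := ω) (S.measurableSet_K (S.θ^[n] ω))
  have h2 : ν (S.θ^[n] ω) (S.K (S.θ^[n] ω)) ≠ 0 := fun h0 => by
    have := h.one_le_measure_K (S.θ^[n] ω)
    rw [h0, mul_zero] at this
    exact absurd this (by norm_num)
  rw [htop, ENNReal.top_mul h2, top_le_iff] at h1
  exact ENNReal.mul_ne_top ENNReal.ofReal_ne_top
    (ENNReal.mul_ne_top ENNReal.ofReal_ne_top (measure_ne_top _ _)) h1

end Conf

/-- Points whose last visit to `K` before time `m + (k + 1)` happens at time `m`, and which are in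
`B` at time `m + (k + 1)`. -/
def lastVisit (S : System ι Ω) (m k : ℕ) (ω : Ω) (B : Set ℝ) : Set ℝ :=
  {x | S.it m ω x ∈ S.K (S.θ^[m] ω) ∧
    (∀ l ≤ k, S.it (l + 1) (S.θ^[m] ω) (S.it m ω x) ∈ S.bad (S.θ^[l + 1] (S.θ^[m] ω))) ∧
    S.it (k + 1) (S.θ^[m] ω) (S.it m ω x) ∈ B}

variable (S) in
/-- The constant in `lastVisit_le`. -/
def C2 : ENNReal := ENNReal.ofReal (S.cG * (S.δ ^ 2) ^ S.t)

namespace Conf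
variable {ν : Ω → Measure ℝ} {lam : Ω → ℝ} (h : S.Conf ν lam)
include h

/-- Up to time m this is `preimage_le`. On the excursion `growth_exit` applies along one of at most
|ι × Bool| words, a number independent of k. The factor e^a in the growth cancels against the
weight, and P is multiplicative along the orbit. -/
theorem lastVisit_le [Finite ι] (m k : ℕ) (ω : Ω) {B : Set ℝ} (hB : MeasurableSet B) :
    S.C2 * (ENNReal.ofReal (S.Λ lam (m + (k + 1)) ω * S.P (m + (k + 1)) ω) *
      ν ω (S.lastVisit m k ω B)) ≤
    (Nat.card (ι × Bool) : ENNReal) * ((S.γ m ω * ENNReal.ofReal (S.P m ω)) *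
      ∫⁻ y in B, S.wt y ∂ν (S.θ^[m + (k + 1)] ω)) := by
  have := Fintype.ofFinite ι
  have hδ := S.δ_pos
  have hcG := S.cG_pos
  set η := S.θ^[m] ω with hη
  have hθ : S.θ^[m + (k + 1)] ω = S.θ^[k + 1] η := by
    rw [hη, add_comm, Function.iterate_add_apply]
  set E : Set ℝ := {y | y ∈ S.K η ∧ (∀ l ≤ k, S.it (l + 1) η y ∈ S.bad (S.θ^[l + 1] η)) ∧
    S.it (k + 1) η y ∈ B} with hE
  have hEm : MeasurableSet E := by
    have : E = S.K η ∩ ((⋂ l, ⋂ (_ : l ≤ k), S.it (l + 1) η ⁻¹' S.bad (S.θ^[l + 1] η)) ∩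
        S.it (k + 1) η ⁻¹' B) := by
      ext; simp only [hE, mem_ofPred_eq, mem_inter_iff, mem_iInter, mem_preimage]
    rw [this]
    exact (S.measurableSet_K η).inter ((MeasurableSet.iInter fun l => MeasurableSet.iInter fun _ =>
      S.measurable_it _ _ (S.measurableSet_bad _)).inter (S.measurable_it _ _ hB))
  have hlv : S.lastVisit m k ω B = S.it m ω ⁻¹' E := rfl
  set Z := ∫⁻ y in B, S.wt y ∂ν (S.θ^[m + (k + 1)] ω) with hZ
  set L := ENNReal.ofReal (S.Λ lam (k + 1) η) with hL
  set c := ENNReal.ofReal (S.cG * S.P (k + 1) η) with hc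
  have part : ∀ ib : ι × Bool, L * (c * ν η {y ∈ E | y ∈ S.cyl (ib.1 :: S.badWord k ib.2) η ∧
      S.cG * (e (S.it (k + 1) η y) ^ S.a * S.P (k + 1) η) ≤
        |S.jac (ib.1 :: S.badWord k ib.2) η y| ^ S.t}) ≤ Z := by
    rintro ⟨i, b⟩
    have h1 := h.lintegral_le (i :: S.badWord k b) (n := k + 1)
      (by rw [List.length_cons, length_badWord]) (ω := η)
      (X := {y ∈ E | y ∈ S.cyl (i :: S.badWord k b) η ∧
      S.cG * (e (S.it (k + 1) η y) ^ S.a * S.P (k + 1) η) ≤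
        |S.jac (i :: S.badWord k b) η y| ^ S.t}) (fun y hy => hy.2.1)
      (g := B.indicator S.wt) (u := fun _ => c) (S.measurable_wt.indicator hB) fun y hy => by
        rw [indicator_of_mem hy.1.2.2, wt, hc]
        have he := e_pos (S.reg_subset_unit _ (S.it_mem_reg hy.1.1.1 (k + 1)))
        rw [← ENNReal.ofReal_mul (by positivity)]
        refine ENNReal.ofReal_le_ofReal ?_
        calc S.cG * S.P (k + 1) η = e (S.it (k + 1) η y) ^ (-S.a) *
              (S.cG * (e (S.it (k + 1) η y) ^ S.a * S.P (k + 1) η)) := by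
              rw [mul_left_comm, mul_left_comm (e _ ^ _), ← mul_assoc (e _ ^ _),
                ← Real.rpow_add he, add_neg_cancel, Real.rpow_zero, one_mul]
          _ ≤ _ := mul_le_mul_of_nonneg_left hy.2.2 (Real.rpow_nonneg he.le _)
    rw [lintegral_indicator hB, setLIntegral_const, ← hθ] at h1
    exact h1
  have hEle : L * (c * ν η E) ≤ (Nat.card (ι × Bool) : ENNReal) * Z := by
    calc L * (c * ν η E) ≤ L * (c * ∑ ib : ι × Bool, ν η {y ∈ E |
          y ∈ S.cyl (ib.1 :: S.badWord k ib.2) η ∧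
          S.cG * (e (S.it (k + 1) η y) ^ S.a * S.P (k + 1) η) ≤
          |S.jac (ib.1 :: S.badWord k ib.2) η y| ^ S.t}) := by
          gcongr L * (c * ?_)
          refine (measure_mono fun y hy => ?_).trans (measure_iUnion_fintype_le _ _)
          obtain ⟨i, b, h1, h2⟩ := growth_exit hy.1.1 hy.2.1
          exact mem_iUnion.2 ⟨(i, b), hy, h1, h2⟩
      _ ≤ ∑ _ib : ι × Bool, Z := by
          rw [Finset.mul_sum, Finset.mul_sum]
          exact Finset.sum_le_sum fun ib _ => part ib
      _ = _ := by
          rw [Finset.sum_const, Finset.card_univ, Nat.card_eq_fintype_card, nsmul_eq_mul]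
  have hpre := h.preimage_le (n := m) (ω := ω) hEm fun y hy => S.K_subset _ hy.1
  rw [hlv, S.Λ_add, S.P_add, ← hη, C2, ENNReal.ofReal_mul hcG.le]
  have hP := S.P_pos m ω
  have hP' := S.P_pos (k + 1) η
  have hΛ := h.Λ_pos m ω
  have hΛ' := h.Λ_pos (k + 1) η
  calc _ = (ENNReal.ofReal ((S.δ ^ 2) ^ S.t) * (ENNReal.ofReal (S.Λ lam m ω) *
        ν ω (S.it m ω ⁻¹' E))) * (L * c) * ENNReal.ofReal (S.P m ω) := by
        rw [hL, hc, ENNReal.ofReal_mul (by positivity), ENNReal.ofReal_mul hΛ.le,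
          ENNReal.ofReal_mul hP.le, ENNReal.ofReal_mul hcG.le]
        ring
    _ ≤ (S.γ m ω * ν η E) * (L * c) * ENNReal.ofReal (S.P m ω) := by gcongr
    _ = S.γ m ω * ENNReal.ofReal (S.P m ω) * (L * (c * ν η E)) := by ring
    _ ≤ S.γ m ω * ENNReal.ofReal (S.P m ω) * ((Nat.card (ι × Bool) : ENNReal) * Z) := by gcongr
    _ = _ := by ring

end Conf

end System
-- Comparison of two conformal families at visits to K
namespace System
variable {ι Ω : Type*} {S : System ι Ω}

theorem itin_take {m n : ℕ} (h : m ≤ n) (ω : Ω) (x : ℝ) :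
    (S.itin n ω x).take m = S.itin m ω x := by
  obtain ⟨k, rfl⟩ := Nat.exists_eq_add_of_le h
  rw [itin_add]
  exact List.take_left' (S.length_itin _ _ _)

theorem itin_congr {m n : ℕ} (h : m ≤ n) {ω : Ω} {x y : ℝ} (hxy : S.itin n ω x = S.itin n ω y) :
    S.itin m ω x = S.itin m ω y := by
  rw [← itin_take h, ← itin_take h, hxy]

theorem mem_cyl_congr {n : ℕ} {ω : Ω} {x y : ℝ} (hx : x ∈ S.reg ω)
    (hxy : S.itin n ω x = S.itin n ω y) {w : List ι} (hw : w.length ≤ n) (h : y ∈ S.cyl w ω) :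
    x ∈ S.cyl w ω := by
  have h1 := S.itin_eq h
  rw [← itin_congr hw hxy] at h1
  have h2 := S.mem_cyl_itin hx w.length
  rwa [h1] at h2

/-- The set `bad` is a union of cylinders of length at most r + 4, so for regular points membership
in K is decided by the first r + 4 letters. -/
theorem mem_K_congr {n : ℕ} {ω : Ω} {x y : ℝ} (hx : x ∈ S.K ω) (hy : y ∈ S.reg ω)
    (hxy : S.itin n ω x = S.itin n ω y) (hn : S.r + 4 ≤ n) : y ∈ S.K ω := by
  refine ⟨hy, fun hb => hx.2 ?_⟩
  rcases hb with hb | hb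
  · exact Or.inl (mem_cyl_congr hx.1 hxy (by simp; omega) hb)
  · exact Or.inr (mem_cyl_congr hx.1 hxy (by simp; omega) hb)

theorem itin_it_congr {m n : ℕ} {ω : Ω} {x y : ℝ} (hxy : S.itin (m + n) ω x = S.itin (m + n) ω y) :
    S.itin n (S.θ^[m] ω) (S.it m ω x) = S.itin n (S.θ^[m] ω) (S.it m ω y) := by
  rw [itin_add, itin_add] at hxy
  exact (List.append_inj hxy (by simp)).2

variable (S) in
/-- The constant in `cover_le`. -/
def Cq : ℝ := S.M ^ (S.r + 4) * (S.A ^ (S.r + 4)) ^ S.t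

namespace Conf
variable {ν₁ ν₂ : Ω → Measure ℝ} {lam₁ lam₂ : Ω → ℝ} (h₁ : S.Conf ν₁ lam₁) (h₂ : S.Conf ν₂ lam₂)
include h₁

theorem M_pos [Finite ι] (ω : Ω) : 0 < S.M := (h₁.pos ω).trans_le (h₁.lam_le ω)

include h₂

/-- Comparison of two conformal families on a cylinder ending with a visit to `K`. -/
theorem cyl_le [Finite ι] {ω : Ω} {x : ℝ} {n : ℕ} {s : ℝ} (hs : 0 < s)
    (hK : S.it n ω x ∈ S.K (S.θ^[n] ω)) (hQ : S.Λ lam₂ n ω ≤ s * S.Λ lam₁ n ω) :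
    ENNReal.ofReal ((S.δ ^ 2) ^ S.t) * ν₁ ω (S.cyl (S.itin (n + (S.r + 4)) ω x) ω) ≤
      ENNReal.ofReal (S.Cq * 4 ^ S.t * s) * ν₂ ω (S.cyl (S.itin (n + (S.r + 4)) ω x) ω) := by
  have := h₁.prob (S.θ^[n] ω)
  have hδ := S.δ_pos
  have hM := h₁.M_pos ω
  have hA := S.A_pos
  have hCq : 0 < S.Cq := by unfold Cq; positivity
  set u := S.itin n ω x with hu
  have hlen : u.length = n := S.length_itin _ _ _
  set v := S.itin (S.r + 4) (S.θ^[n] ω) (S.it n ω x) with hv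
  have hlenv : v.length = S.r + 4 := S.length_itin _ _ _
  set B := S.cyl v (S.θ^[n] ω) ∩ S.reg (S.θ^[n] ω) with hB
  have hBm : MeasurableSet B := (S.measurableSet_cyl _ _).inter (S.measurableSet_reg _)
  have hBK : B ⊆ S.K (S.θ^[n] ω) := fun y hy => mem_K_congr hK hy.2 (n := S.r + 4)
    (by rw [← hv, ← S.itin_eq hy.1, hlenv]) le_rfl
  have hw : S.itin (n + (S.r + 4)) ω x = u ++ v := S.itin_add _ _ _ _
  have hcyl : ∀ y, y ∈ S.cyl (u ++ v) ω ↔ y ∈ S.cyl u ω ∧ S.it n ω y ∈ S.cyl v (S.θ^[n] ω) := by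
    intro y; rw [S.mem_cyl_append, hlen]
  rw [hw]
  have e1 : ν₁ ω (S.cyl (u ++ v) ω) ≤ ν₁ ω (S.cyl u ω ∩ S.it n ω ⁻¹' B) :=
    h₁.measure_le_of_inter fun y hy =>
      ⟨((hcyl y).1 hy.1).1, ((hcyl y).1 hy.1).2, S.it_mem_reg hy.2 n⟩
  have e2 : ν₂ ω (S.cyl u ω ∩ S.it n ω ⁻¹' B) ≤ ν₂ ω (S.cyl (u ++ v) ω) :=
    measure_mono fun y hy => (hcyl y).2 ⟨hy.1, hy.2.1⟩
  have a1 := h₁.word_le hlen (ω := ω) hBm (hBK.trans (S.K_subset _))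
  have a2 := h₂.le_word hlen (ω := ω) hBm
  have a3 := h₂.le_measure_cyl hlenv (S.θ^[n] ω)
  have a4 : ν₂ (S.θ^[n] ω) (S.cyl v (S.θ^[n] ω)) = ν₂ (S.θ^[n] ω) B :=
    (h₂.measure_inter_reg _ _).symm
  rw [a4] at a3
  have hΛ := h₁.Λ_pos n ω
  have href := S.ref_pos u ω
  have hne : ENNReal.ofReal (S.Λ lam₁ n ω * S.ref u ω) ≠ 0 :=
    (ENNReal.ofReal_pos.2 (by positivity)).ne'
  refine (ENNReal.mul_le_mul_iff_right hne ENNReal.ofReal_ne_top).1 ?_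
  calc ENNReal.ofReal (S.Λ lam₁ n ω * S.ref u ω) *
      (ENNReal.ofReal ((S.δ ^ 2) ^ S.t) * ν₁ ω (S.cyl (u ++ v) ω))
      ≤ ENNReal.ofReal (S.Λ lam₁ n ω * S.ref u ω) *
      (ENNReal.ofReal ((S.δ ^ 2) ^ S.t) * ν₁ ω (S.cyl u ω ∩ S.it n ω ⁻¹' B)) := by gcongr
    _ = ENNReal.ofReal (S.Λ lam₁ n ω) * (ENNReal.ofReal ((S.δ ^ 2) ^ S.t * S.ref u ω) *
        ν₁ ω (S.cyl u ω ∩ S.it n ω ⁻¹' B)) := by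
        rw [ENNReal.ofReal_mul hΛ.le, ENNReal.ofReal_mul (by positivity)]; ring
    _ ≤ 1 := a1.trans prob_le_one
    _ ≤ ENNReal.ofReal S.Cq * ν₂ (S.θ^[n] ω) B := a3
    _ ≤ ENNReal.ofReal S.Cq * (ENNReal.ofReal (S.Λ lam₂ n ω) *
        (ENNReal.ofReal (4 ^ S.t * S.ref u ω) * ν₂ ω (S.cyl u ω ∩ S.it n ω ⁻¹' B))) := by gcongr
    _ ≤ ENNReal.ofReal S.Cq * (ENNReal.ofReal (s * S.Λ lam₁ n ω) *
        (ENNReal.ofReal (4 ^ S.t * S.ref u ω) * ν₂ ω (S.cyl (u ++ v) ω))) := by gcongr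
    _ = _ := by
        rw [ENNReal.ofReal_mul hΛ.le, ENNReal.ofReal_mul (by positivity : (0:ℝ) ≤ 4 ^ S.t),
          ENNReal.ofReal_mul hs.le, ENNReal.ofReal_mul (by positivity : 0 ≤ S.Cq * 4 ^ S.t),
          ENNReal.ofReal_mul hCq.le]
        ring

/-- Comparison of two conformal families on the points with infinitely many visits to `K` at times
at which the ratio of the eigenvalue products is bounded. -/
theorem cover_le [Finite ι] {ω : Ω} {X : Set ℝ} (hX : X ⊆ S.reg ω) {s : ℝ} (hs : 0 < s)
    (hQ : ∀ x ∈ X, ∃ᶠ n in atTop, S.it n ω x ∈ S.K (S.θ^[n] ω) ∧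
      S.Λ lam₂ n ω ≤ s * S.Λ lam₁ n ω) :
    ENNReal.ofReal ((S.δ ^ 2) ^ S.t) * ν₁ ω X ≤
      ENNReal.ofReal (S.Cq * 4 ^ S.t * s) * ν₂ ω X := by
  classical
  have := h₂.prob ω
  have hM := h₁.M_pos ω
  have hA := S.A_pos
  have hCq : 0 < S.Cq := by unfold Cq; positivity
  set C := ENNReal.ofReal (S.Cq * 4 ^ S.t * s) with hC
  have hC0 : C ≠ 0 := (ENNReal.ofReal_pos.2 (by positivity)).ne'
  set D := ENNReal.ofReal ((S.δ ^ 2) ^ S.t) with hD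
  -- X need not be measurable; outer regularity reduces the claim to open neighbourhoods.
  suffices hU : ∀ U, X ⊆ U → IsOpen U → D * ν₁ ω X ≤ C * ν₂ ω U by
    rw [mul_comm C, ← ENNReal.div_le_iff hC0 ENNReal.ofReal_ne_top, X.measure_eq_iInf_isOpen (ν₂ ω)]
    refine le_iInf₂ fun U hXU => le_iInf fun hUo => ?_
    rw [ENNReal.div_le_iff hC0 ENNReal.ofReal_ne_top, mul_comm _ C]
    exact hU U hXU hUo
  intro U hXU hUo
  set Pr : ℕ → ℝ → Prop := fun n x => S.it n ω x ∈ S.K (S.θ^[n] ω) ∧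
    S.Λ lam₂ n ω ≤ s * S.Λ lam₁ n ω ∧ S.ccyl (S.itin n ω x) ω ⊆ U with hPr
  have hex : ∀ x ∈ X, ∃ n, Pr n x := by
    intro x hx
    obtain ⟨N, hN⟩ := eventually_ccyl_subset (hX hx) hUo (hXU hx)
    obtain ⟨n, hn, hK, hl⟩ := (frequently_atTop.1 (hQ x hx)) N
    exact ⟨n, hK, hl, hN n hn⟩
  -- Whether k ≤ n is an admissible time depends only on the first n + r + 4 letters, so the first
  -- admissible time is a stopping time.
  have hcongr : ∀ {n k : ℕ} {x y : ℝ}, x ∈ S.reg ω → y ∈ S.reg ω →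
      S.itin (n + (S.r + 4)) ω x = S.itin (n + (S.r + 4)) ω y → k ≤ n → Pr k x → Pr k y := by
    intro n k x y hx hy hxy hk hP
    have h3 : S.itin (k + (S.r + 4)) ω x = S.itin (k + (S.r + 4)) ω y := itin_congr (by omega) hxy
    refine ⟨mem_K_congr hP.1 (S.it_mem_reg hy k) (itin_it_congr h3) le_rfl, hP.2.1, ?_⟩
    rw [← itin_congr (by omega) h3]
    exact hP.2.2
  -- The cylinders up to the first admissible time, extended by r + 4 letters. They cover X and are
  -- pairwise disjoint on regular points because of the stopping property.
  set W : Set (List ι) := {w | ∃ x ∈ X, ∃ n, Pr n x ∧ (∀ k < n, ¬ Pr k x) ∧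
    w = S.itin (n + (S.r + 4)) ω x} with hW
  have hWc : W.Countable := to_countable W
  have hdisj : W.PairwiseDisjoint fun w => S.cyl w ω ∩ S.reg ω := by
    rintro w ⟨x, hx, n, hP, hmin, rfl⟩ w' ⟨x', hx', n', hP', hmin', rfl⟩ hne
    refine Set.disjoint_left.2 fun z hz hz' => hne ?_
    have i1 := S.itin_eq hz.1
    have i2 := S.itin_eq hz'.1
    rw [length_itin] at i1 i2
    have hn : n = n' := by
      rcases lt_trichotomy n n' with hlt | heq | hlt
      · exact absurd (hcongr hz.2 (hX hx') i2 hlt.le (hcongr (hX hx) hz.2 i1.symm le_rfl hP))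
          (hmin' n hlt)
      · exact heq
      · exact absurd (hcongr hz.2 (hX hx) i1 hlt.le (hcongr (hX hx') hz.2 i2.symm le_rfl hP'))
          (hmin n' hlt)
    subst hn
    rw [← i1, ← i2]
  calc D * ν₁ ω X ≤ D * ∑' w : W, ν₁ ω (S.cyl w ω) := by
        gcongr D * ?_
        refine (measure_mono fun x hx => ?_).trans (measure_biUnion_le _ hWc fun w => S.cyl w ω)
        have hn := hex x hx
        refine mem_biUnion (x := S.itin (Nat.find hn + (S.r + 4)) ω x)
          ⟨x, hx, Nat.find hn, Nat.find_spec hn, fun k hk => Nat.find_min hn hk, rfl⟩ ?_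
        exact S.mem_cyl_itin (hX hx) _
    _ = ∑' w : W, D * ν₁ ω (S.cyl w ω) := ENNReal.tsum_mul_left.symm
    _ ≤ ∑' w : W, C * ν₂ ω (S.cyl w ω ∩ S.reg ω) := by
        refine ENNReal.tsum_le_tsum fun w => ?_
        obtain ⟨x, hx, n, hP, -, hw⟩ := w.2
        rw [h₂.measure_inter_reg, hw]
        exact h₁.cyl_le h₂ hs hP.1 hP.2.1
    _ = C * ∑' w : W, ν₂ ω (S.cyl w ω ∩ S.reg ω) := ENNReal.tsum_mul_left
    _ = C * ν₂ ω (⋃ w ∈ W, S.cyl w ω ∩ S.reg ω) := by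
        rw [measure_biUnion hWc hdisj fun w _ =>
          (S.measurableSet_cyl _ _).inter (S.measurableSet_reg _)]
    _ ≤ C * ν₂ ω U := by
        gcongr
        refine iUnion₂_subset fun w hw => ?_
        obtain ⟨x, hx, n, hP, -, rfl⟩ := hw
        intro z hz
        refine hP.2.2 (S.cyl_subset_ccyl _ _ ?_)
        have := hz.1
        rw [itin_add] at this
        exact (S.mem_cyl_append.1 this).1

end Conf

/-- A discrete Gronwall inequality: the partial sums satisfy Γ_{n+1} ≤ (1 + C p_n) Γ_n ≤ exp(C p_n)
Γ_n. -/
theorem summable_of_le_mul_sum {b p : ℕ → ℝ} {C L : ℝ} {N : ℕ} (hb : ∀ n, 0 ≤ b n)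
    (hp : ∀ n, 0 ≤ p n) (hC : 0 ≤ C) (hL : ∀ n, ∑ k ∈ Finset.range n, p k ≤ L)
    (h : ∀ n ≥ N, b n ≤ C * (∑ k ∈ Finset.range n, b k) * p n) : Summable b := by
  set Γ : ℕ → ℝ := fun n => ∑ k ∈ Finset.range n, b k with hΓ
  have hΓ0 : ∀ n, 0 ≤ Γ n := fun n => Finset.sum_nonneg fun k _ => hb k
  have hmono : Monotone Γ := fun m n hmn =>
    Finset.sum_le_sum_of_subset_of_nonneg (Finset.range_mono hmn) fun k _ _ => hb k
  have key : ∀ n ≥ N, Γ n ≤ Γ N * Real.exp (C * ∑ k ∈ Finset.range n, p k) := by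
    intro n hn
    induction n, hn using Nat.le_induction with
    | base =>
      refine le_mul_of_one_le_right (hΓ0 _) (Real.one_le_exp ?_)
      exact mul_nonneg hC (Finset.sum_nonneg fun k _ => hp k)
    | succ n hn ih =>
      have h1 := h n hn
      have h2 : Γ (n + 1) = Γ n + b n := Finset.sum_range_succ _ _
      rw [h2, Finset.sum_range_succ, mul_add, Real.exp_add, ← mul_assoc]
      calc Γ n + b n ≤ Γ n * (C * p n + 1) := by linarith
        _ ≤ Γ n * Real.exp (C * p n) := by gcongr; exacts [hΓ0 _, Real.add_one_le_exp _]
        _ ≤ _ := by gcongr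
  refine summable_of_sum_range_le (c := Γ N * Real.exp (C * L)) hb fun n => ?_
  calc Γ n ≤ Γ (max n N) := hmono (le_max_left _ _)
    _ ≤ _ := key _ (le_max_right _ _)
    _ ≤ _ := by
      gcongr
      · exact hΓ0 _
      · exact hL _

/-- Points of the fibre at time `n` that do not visit `K` at times in `R`. -/
def avoid (S : System ι Ω) (R : Set ℕ) (n : ℕ) (ω : Ω) : Set ℝ :=
  {y | y ∈ S.reg (S.θ^[n] ω) ∧ ∀ i, n + i ∈ R → S.it i (S.θ^[n] ω) y ∉ S.K (S.θ^[n + i] ω)}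

theorem measurableSet_avoid [Countable ι] (R : Set ℕ) (n : ℕ) (ω : Ω) :
    MeasurableSet (S.avoid R n ω) := by
  have : S.avoid R n ω = S.reg (S.θ^[n] ω) ∩ ⋂ i, ⋂ (_ : n + i ∈ R),
      S.it i (S.θ^[n] ω) ⁻¹' (S.K (S.θ^[n + i] ω))ᶜ := by ext; simp [avoid]
  rw [this]
  exact (S.measurableSet_reg _).inter (MeasurableSet.iInter fun i => MeasurableSet.iInter fun _ =>
    S.measurable_it _ _ (S.measurableSet_K _).compl)

theorem it_mem_avoid {R : Set ℕ} {n : ℕ} {ω : Ω} {x : ℝ} (hx : x ∈ S.reg ω)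
    (h : ∀ k ≥ n, k ∈ R → S.it k ω x ∉ S.K (S.θ^[k] ω)) {l : ℕ} (hl : n ≤ l) :
    S.it l ω x ∈ S.avoid R l ω :=
  ⟨S.it_mem_reg hx l, fun i hi hK => h (l + i) (by omega) hi (by rwa [S.it_add])⟩

/-- Points that stay near the ends of the unit interval from time `m` to time `n`. -/
def stay (S : System ι Ω) (m n : ℕ) (ω : Ω) : Set ℝ :=
  {x | x ∈ S.reg ω ∧ ∀ l, m ≤ l → l ≤ n → S.it l ω x ∈ S.bad (S.θ^[l] ω)}

/-- A point of the fibre at time `n` in the tail of an orbit that is in `bad` at time `n` either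
stays in `bad` or has a last visit to `K`. -/
theorem mem_stay_or_lastVisit {m n : ℕ} {ω : Ω} {x : ℝ} (hx : x ∈ S.reg ω) {B : Set ℝ}
    (hb : S.it n ω x ∈ S.bad (S.θ^[n] ω)) (hB : S.it n ω x ∈ B) :
    x ∈ S.stay m n ω ∨ ∃ l ∈ Finset.Ico m n, x ∈ S.lastVisit l (n - l - 1) ω B := by
  by_cases hs : x ∈ S.stay m n ω
  · exact Or.inl hs
  right
  have hex : ∃ l, m ≤ l ∧ l ≤ n ∧ S.it l ω x ∈ S.K (S.θ^[l] ω) := by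
    by_contra! hne
    exact hs ⟨hx, fun l h1 h2 => mem_bad_of_not_mem_K (S.it_mem_reg hx l) (hne l h1 h2)⟩
  classical
  obtain ⟨l₀, hl₀⟩ := hex
  set Pd : ℕ → Prop := fun l => m ≤ l ∧ S.it l ω x ∈ S.K (S.θ^[l] ω) with hPd
  have hPd0 : Pd l₀ := ⟨hl₀.1, hl₀.2.2⟩
  set l := Nat.findGreatest Pd n with hl
  have hspec : Pd l := Nat.findGreatest_spec hl₀.2.1 hPd0
  have hle : l ≤ n := Nat.findGreatest_le n
  have hlt : l < n := lt_of_le_of_ne hle fun heq => (heq ▸ hspec).2.2 hb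
  refine ⟨l, Finset.mem_Ico.2 ⟨hspec.1, hlt⟩, hspec.2, fun i hi => ?_, ?_⟩
  · rw [← S.it_add, ← Function.iterate_add_apply, add_comm (i + 1) l]
    refine mem_bad_of_not_mem_K (S.it_mem_reg hx _) fun hK => ?_
    exact Nat.findGreatest_is_greatest (P := Pd) (n := n) (k := l + (i + 1)) (by omega) (by omega)
      ⟨by have := hspec.1; omega, hK⟩
  · rw [← S.it_add, show l + (n - l - 1 + 1) = n by omega]
    exact hB

variable (S) in
/-- The summands of the growth series. -/
def bs (ω : Ω) (n : ℕ) : ENNReal := S.γ n ω * ENNReal.ofReal (S.P n ω)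

namespace Conf
variable {ν : Ω → Measure ℝ} {lam : Ω → ℝ} (h : S.Conf ν lam)
include h

theorem tendsto_stay [Countable ι] (m : ℕ) (ω : Ω) :
    Tendsto (fun n => ν ω (S.stay m n ω)) atTop (𝓝 0) := by
  have := h.prob ω
  have hmeas : ∀ n, MeasurableSet (S.stay m n ω) := by
    intro n
    have : S.stay m n ω = S.reg ω ∩ ⋂ l, ⋂ (_ : m ≤ l), ⋂ (_ : l ≤ n),
        S.it l ω ⁻¹' S.bad (S.θ^[l] ω) := by ext; simp [stay]
    rw [this]
    exact (S.measurableSet_reg _).inter (MeasurableSet.iInter fun l => MeasurableSet.iInter fun _ =>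
      MeasurableSet.iInter fun _ => S.measurable_it _ _ (S.measurableSet_bad _))
  have hanti : Antitone fun n => S.stay m n ω := fun n n' hn x hx =>
    ⟨hx.1, fun l h1 h2 => hx.2 l h1 (h2.trans hn)⟩
  have hempty : ⋂ n, S.stay m n ω = ∅ := by
    refine eq_empty_of_forall_notMem fun x hx => ?_
    rw [mem_iInter] at hx
    obtain ⟨n, hn, hK⟩ := exists_visit_ge (hx 0).1 m
    exact hK.2 ((hx n).2 n hn le_rfl)
  have := tendsto_measure_iInter_atTop (μ := ν ω) (fun n => (hmeas n).nullMeasurableSet) hanti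
    ⟨0, measure_ne_top _ _⟩
  rwa [hempty, measure_empty] at this

/-- At a time n in R the points of X are in `bad`. As orbits cannot stay there forever, for large n
all but half of the mass of X has a last visit to K at some l in [m, n); the bounds of
`lastVisit_le` are summed over l. The future of X is recorded in the domain of integration for the
launch estimate. -/
theorem le_sum_bs [Finite ι] {R : Set ℕ} {N : ℕ} {ω : Ω} {X : Set ℝ} (hX : X ⊆ S.reg ω)
    (hR : ∀ x ∈ X, ∀ k ≥ N, k ∈ R → S.it k ω x ∉ S.K (S.θ^[k] ω)) (hpos : ν ω X ≠ 0) (m : ℕ) :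
    ∀ᶠ n in atTop, n ∈ R → S.C2 * (ENNReal.ofReal (S.Λ lam n ω * S.P n ω) * (ν ω X / 2)) ≤
      (Nat.card (ι × Bool) : ENNReal) * ((∑ l ∈ Finset.Ico m n, S.bs ω l) *
        ∫⁻ y in S.bad (S.θ^[n] ω) ∩ S.it 2 (S.θ^[n] ω) ⁻¹' S.avoid R (n + 2) ω,
          S.wt y ∂ν (S.θ^[n] ω)) := by
  have := h.prob ω
  have hev := (h.tendsto_stay m ω).eventually_le_const (ENNReal.half_pos hpos)
  filter_upwards [hev, eventually_ge_atTop N] with n hn hnN hnR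
  set B := S.bad (S.θ^[n] ω) ∩ S.it 2 (S.θ^[n] ω) ⁻¹' S.avoid R (n + 2) ω with hB
  have hBm : MeasurableSet B := (S.measurableSet_bad _).inter
    (S.measurable_it _ _ (measurableSet_avoid _ _ _))
  have hsub : X ⊆ S.stay m n ω ∪ ⋃ l ∈ Finset.Ico m n, S.lastVisit l (n - l - 1) ω B := by
    intro x hx
    have hreg := hX hx
    have hb : S.it n ω x ∈ S.bad (S.θ^[n] ω) :=
      mem_bad_of_not_mem_K (S.it_mem_reg hreg n) (hR x hx n hnN hnR)
    have hBx : S.it n ω x ∈ B := by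
      refine ⟨hb, ?_⟩
      rw [mem_preimage, ← S.it_add]
      exact it_mem_avoid hreg (hR x hx) (by omega)
    rcases mem_stay_or_lastVisit (m := m) hreg hb hBx with h1 | ⟨l, hl, h1⟩
    · exact Or.inl h1
    · exact Or.inr (mem_biUnion (t := fun l => S.lastVisit l (n - l - 1) ω B) hl h1)
  have hsum : ν ω X / 2 ≤ ∑ l ∈ Finset.Ico m n, ν ω (S.lastVisit l (n - l - 1) ω B) := by
    have h1 : ν ω X ≤ ν ω X / 2 + ∑ l ∈ Finset.Ico m n, ν ω (S.lastVisit l (n - l - 1) ω B) :=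
      (measure_mono hsub).trans ((measure_union_le _ _).trans
        (add_le_add hn (measure_biUnion_finset_le _ _)))
    have h2 : ν ω X / 2 ≠ ⊤ := ENNReal.div_ne_top (measure_ne_top _ _) two_ne_zero
    refine (ENNReal.add_le_add_iff_left h2).1 ?_
    rwa [ENNReal.add_halves]
  calc _ ≤ S.C2 * (ENNReal.ofReal (S.Λ lam n ω * S.P n ω) *
        ∑ l ∈ Finset.Ico m n, ν ω (S.lastVisit l (n - l - 1) ω B)) := by gcongr
    _ = ∑ l ∈ Finset.Ico m n, S.C2 * (ENNReal.ofReal (S.Λ lam n ω * S.P n ω) *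
        ν ω (S.lastVisit l (n - l - 1) ω B)) := by rw [Finset.mul_sum, Finset.mul_sum]
    _ ≤ ∑ l ∈ Finset.Ico m n, (Nat.card (ι × Bool) : ENNReal) * (S.bs ω l *
        ∫⁻ y in B, S.wt y ∂ν (S.θ^[n] ω)) := by
        refine Finset.sum_le_sum fun l hl => ?_
        have hl' := Finset.mem_Ico.1 hl
        have := h.lastVisit_le l (n - l - 1) ω hBm
        rwa [show l + (n - l - 1 + 1) = n by omega] at this
    _ = _ := by rw [← Finset.mul_sum, Finset.sum_mul]

theorem bs_ne_top [Countable ι] (ω : Ω) (n : ℕ) : S.bs ω n ≠ ⊤ :=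
  ENNReal.mul_ne_top (h.γ_ne_top n ω) ENNReal.ofReal_ne_top

end Conf

end System
-- Growth along avoided times and failure of absolute continuity
namespace System
variable {ι Ω : Type*} {S : System ι Ω}

/-- Points that visit `K` at time `n`, and from time `n + 2` on do not do so at times in `R`. -/
def visitAvoid (S : System ι Ω) (R : Set ℕ) (n : ℕ) (ω : Ω) : Set ℝ :=
  S.it n ω ⁻¹' (S.K (S.θ^[n] ω) ∩ S.it 2 (S.θ^[n] ω) ⁻¹' S.avoid R (n + 2) ω)

theorem measurableSet_visitAvoid [Countable ι] (R : Set ℕ) (n : ℕ) (ω : Ω) :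
    MeasurableSet (S.visitAvoid R n ω) :=
  S.measurable_it _ _ ((S.measurableSet_K _).inter
    (S.measurable_it _ _ (measurableSet_avoid _ _ _)))

theorem disjoint_visitAvoid {R : Set ℕ} {m n : ℕ} {ω : Ω} (hn : n ∈ R) (hmn : m + 2 ≤ n) :
    Disjoint (S.visitAvoid R m ω) (S.visitAvoid R n ω) := by
  refine Set.disjoint_left.2 fun x hx hx' => ?_
  have h1 := hx.2.2 (n - (m + 2)) (by rwa [show m + 2 + (n - (m + 2)) = n by omega])
  rw [← S.it_add, ← S.it_add, show m + 2 + (n - (m + 2)) = n by omega] at h1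
  exact h1 hx'.1

namespace Conf
variable {ν : Ω → Measure ℝ} {lam : Ω → ℝ} (h : S.Conf ν lam)
include h

/-- Two of these sets at times that differ by at least 2 are disjoint, as the earlier one forbids
the later visit. Even and odd times each contribute at most 1. -/
theorem sum_visitAvoid_le [Countable ι] (R : Set ℕ) (ω : Ω) (F : Finset ℕ) (hF : ∀ n ∈ F, n ∈ R) :
    ∑ n ∈ F, ν ω (S.visitAvoid R n ω) ≤ 2 := by
  have := h.prob ω
  have key : ∀ F : Finset ℕ, (∀ n ∈ F, n ∈ R) → (∀ m ∈ F, ∀ n ∈ F, m < n → m + 2 ≤ n) →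
      ∑ n ∈ F, ν ω (S.visitAvoid R n ω) ≤ 1 := by
    intro F hF hsep
    rw [← measure_biUnion_finset _ fun n _ => measurableSet_visitAvoid R n ω]
    · exact prob_le_one
    · intro m hm n hn hmn
      rcases lt_or_gt_of_ne hmn with hlt | hlt
      · exact disjoint_visitAvoid (hF n hn) (hsep m hm n hn hlt)
      · exact (disjoint_visitAvoid (hF m hm) (hsep n hn m hm hlt)).symm
  rw [← Finset.sum_filter_add_sum_filter_not F Even, ← one_add_one_eq_two]
  refine add_le_add (key _ (fun n hn => hF n (Finset.mem_filter.1 hn).1) ?_)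
    (key _ (fun n hn => hF n (Finset.mem_filter.1 hn).1) ?_)
  · intro m hm n hn hlt
    obtain ⟨k, hk⟩ := (Finset.mem_filter.1 hm).2
    obtain ⟨l, hl⟩ := (Finset.mem_filter.1 hn).2
    omega
  · intro m hm n hn hlt
    obtain ⟨k, hk⟩ := Nat.not_even_iff_odd.1 (Finset.mem_filter.1 hm).2
    obtain ⟨l, hl⟩ := Nat.not_even_iff_odd.1 (Finset.mem_filter.1 hn).2
    omega

/-- Growth along a set `R` of times that a set of positive measure eventually avoids. -/
theorem growth_of_avoid [Finite ι] {R : Set ℕ} {N : ℕ} {ω : Ω} {X : Set ℝ} (hX : X ⊆ S.reg ω)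
    (hR : ∀ x ∈ X, ∀ k ≥ N, k ∈ R → S.it k ω x ∉ S.K (S.θ^[k] ω)) (hpos : ν ω X ≠ 0) :
    ∃ C ≥ 0, ∃ p : ℕ → ℝ, (∀ n, 0 ≤ p n) ∧ (∀ n, ∑ k ∈ Finset.range n, p k ≤ 2) ∧
      (∀ᶠ n in atTop, n ∈ R → (S.bs ω n).toReal ≤
        C * (∑ k ∈ Finset.range n, (S.bs ω k).toReal) * p n) ∧
      ∀ m, ∀ᶠ n in atTop, n ∈ R →
        S.P n ω * S.Λ lam n ω ≤ C * ∑ k ∈ Finset.Ico m n, (S.bs ω k).toReal := by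
  classical
  have := h.prob ω
  have hδ := S.δ_pos
  have hcG := S.cG_pos
  set g := ν ω X / 2 with hg
  have hg0 : g ≠ 0 := (ENNReal.half_pos hpos).ne'
  have hgt : g ≠ ⊤ := ENNReal.div_ne_top (measure_ne_top _ _) two_ne_zero
  have hC20 : S.C2 ≠ 0 := (ENNReal.ofReal_pos.2 (by positivity)).ne'
  have hC2t : S.C2 ≠ ⊤ := ENNReal.ofReal_ne_top
  set c := (S.C2 * g).toReal with hc
  have hc0 : 0 < c := ENNReal.toReal_pos (mul_ne_zero hC20 hg0) (ENNReal.mul_ne_top hC2t hgt)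
  set Nc : ENNReal := (Nat.card (ι × Bool) : ENNReal) with hNc
  have hNct : Nc ≠ ⊤ := ENNReal.natCast_ne_top _
  have hsumt : ∀ F : Finset ℕ, ∑ k ∈ F, S.bs ω k ≠ ⊤ := fun F =>
    ENNReal.sum_ne_top.2 fun k _ => h.bs_ne_top ω k
  have hsum : ∀ F : Finset ℕ, (∑ k ∈ F, S.bs ω k).toReal = ∑ k ∈ F, (S.bs ω k).toReal := fun F =>
    ENNReal.toReal_sum fun k _ => h.bs_ne_top ω k
  set D₁ := (Nc * (ENNReal.ofReal S.C3 * ENNReal.ofReal (4 ^ S.t))).toReal / c with hD₁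
  set D₂ := (Nc * ENNReal.ofReal S.Cw).toReal / c with hD₂
  have hD₁0 : 0 ≤ D₁ := by positivity
  have hD₂0 : 0 ≤ D₂ := by positivity
  set p : ℕ → ℝ := fun n => if n ∈ R then (ν ω (S.visitAvoid R n ω)).toReal else 0 with hp
  have hp0 : ∀ n, 0 ≤ p n := fun n => by
    simp only [hp]; split_ifs <;> positivity
  refine ⟨max D₁ D₂, le_max_of_le_left hD₁0, p, hp0, fun n => ?_, ?_, fun m => ?_⟩
  · simp only [hp]
    rw [← Finset.sum_filter, ← ENNReal.toReal_sum fun k _ => measure_ne_top _ _]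
    have := h.sum_visitAvoid_le R ω ((Finset.range n).filter (· ∈ R))
      fun n hn => (Finset.mem_filter.1 hn).2
    exact ENNReal.toReal_le_of_le_ofReal two_pos.le (by rwa [ENNReal.ofReal_ofNat])
  · filter_upwards [h.le_sum_bs hX hR hpos 0] with n hn hnR
    have h1 := hn hnR
    rw [← hg, ← hNc, Nat.Ico_zero_eq_range] at h1
    have hl := h.launch_bound (S.θ^[n] ω) (measurableSet_avoid (S := S) R (n + 2) ω)
    have hpre := h.le_preimage (n := n) (ω := ω) ((S.measurableSet_K (S.θ^[n] ω)).inter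
      (S.measurable_it 2 (S.θ^[n] ω) (measurableSet_avoid (S := S) R (n + 2) ω)))
    set V := S.K (S.θ^[n] ω) ∩ S.it 2 (S.θ^[n] ω) ⁻¹' S.avoid R (n + 2) ω with hV
    have hΛ := h.Λ_pos n ω
    -- After multiplication by the sum γ, the launch estimate moves the integral over `bad` to K,
    -- and `le_preimage` turns it into the mass of `visitAvoid` on the initial fibre times the
    -- product of the λ's, which cancels.
    have h2 : S.C2 * g * S.bs ω n ≤ Nc * (ENNReal.ofReal S.C3 * ENNReal.ofReal (4 ^ S.t)) *
        (∑ l ∈ Finset.range n, S.bs ω l) * ν ω (S.visitAvoid R n ω) := by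
      refine (ENNReal.mul_le_mul_iff_right (h.Λ_ne_zero n ω) ENNReal.ofReal_ne_top).1 ?_
      calc _ = S.γ n ω * (S.C2 * (ENNReal.ofReal (S.Λ lam n ω * S.P n ω) * g)) := by
            rw [ENNReal.ofReal_mul hΛ.le, bs]; ring
        _ ≤ S.γ n ω * (Nc * ((∑ l ∈ Finset.range n, S.bs ω l) *
            (ENNReal.ofReal S.C3 * ν (S.θ^[n] ω) V))) := by
            gcongr S.γ n ω * ?_
            exact h1.trans (by gcongr)
        _ = Nc * ((∑ l ∈ Finset.range n, S.bs ω l) *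
            (ENNReal.ofReal S.C3 * (S.γ n ω * ν (S.θ^[n] ω) V))) := by ring
        _ ≤ Nc * ((∑ l ∈ Finset.range n, S.bs ω l) * (ENNReal.ofReal S.C3 *
            (ENNReal.ofReal (4 ^ S.t) * (ENNReal.ofReal (S.Λ lam n ω) *
            ν ω (S.it n ω ⁻¹' V))))) := by gcongr
        _ = _ := by rw [visitAvoid]; ring
    have h3 := ENNReal.toReal_mono (ENNReal.mul_ne_top (ENNReal.mul_ne_top (ENNReal.mul_ne_top hNct
      (ENNReal.mul_ne_top ENNReal.ofReal_ne_top ENNReal.ofReal_ne_top)) (hsumt _))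
      (measure_ne_top _ _)) h2
    rw [ENNReal.toReal_mul, ENNReal.toReal_mul (b := ν ω _), ENNReal.toReal_mul
      (b := ∑ l ∈ Finset.range n, S.bs ω l), hsum, ← hc] at h3
    have hpn : p n = (ν ω (S.visitAvoid R n ω)).toReal := if_pos hnR
    have hs0 : 0 ≤ ∑ k ∈ Finset.range n, (S.bs ω k).toReal :=
      Finset.sum_nonneg fun k _ => ENNReal.toReal_nonneg
    calc (S.bs ω n).toReal ≤ D₁ * (∑ k ∈ Finset.range n, (S.bs ω k).toReal) * p n := by
          rw [hD₁, hpn, div_mul_eq_mul_div, div_mul_eq_mul_div, le_div_iff₀ hc0, mul_comm _ c]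
          exact h3
      _ ≤ _ := by
          have := hp0 n
          gcongr; exact le_max_left _ _
  · filter_upwards [h.le_sum_bs hX hR hpos m] with n hn hnR
    have h1 := hn hnR
    rw [← hg, ← hNc] at h1
    have hΛ := h.Λ_pos n ω
    have hP := S.P_pos n ω
    have h2 : S.C2 * g * ENNReal.ofReal (S.P n ω * S.Λ lam n ω) ≤
        Nc * ENNReal.ofReal S.Cw * ∑ l ∈ Finset.Ico m n, S.bs ω l := by
      calc _ = S.C2 * (ENNReal.ofReal (S.Λ lam n ω * S.P n ω) * g) := by
            rw [mul_comm (S.P n ω)]; ring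
        _ ≤ _ := h1
        _ ≤ Nc * ((∑ l ∈ Finset.Ico m n, S.bs ω l) * ENNReal.ofReal S.Cw) := by
            gcongr
            exact (setLIntegral_le_lintegral _ _).trans (h.lintegral_wt_le _)
        _ = _ := by ring
    have h3 := ENNReal.toReal_mono (ENNReal.mul_ne_top
      (ENNReal.mul_ne_top hNct ENNReal.ofReal_ne_top) (hsumt _)) h2
    rw [ENNReal.toReal_mul, ENNReal.toReal_mul (b := ∑ l ∈ Finset.Ico m n, S.bs ω l), hsum, ← hc,
      ENNReal.toReal_ofReal (by positivity)] at h3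
    have hs0 : 0 ≤ ∑ k ∈ Finset.Ico m n, (S.bs ω k).toReal :=
      Finset.sum_nonneg fun k _ => ENNReal.toReal_nonneg
    calc S.P n ω * S.Λ lam n ω ≤ D₂ * ∑ k ∈ Finset.Ico m n, (S.bs ω k).toReal := by
          rw [hD₂, div_mul_eq_mul_div, le_div_iff₀ hc0, mul_comm _ c]
          exact h3
      _ ≤ _ := by gcongr; exact le_max_right _ _

omit h in
theorem exists_eventually_avoid {ω : Ω} {μ : Measure ℝ} {X : Set ℝ} {R : Set ℕ} (hμ : μ X ≠ 0)
    (hX : ∀ x ∈ X, ¬ ∃ᶠ n in atTop, S.it n ω x ∈ S.K (S.θ^[n] ω) ∧ n ∈ R) :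
    ∃ N, μ {x ∈ X | ∀ k ≥ N, k ∈ R → S.it k ω x ∉ S.K (S.θ^[k] ω)} ≠ 0 := by
  by_contra! hN
  refine hμ (measure_mono_null (fun x hx => ?_) (measure_iUnion_null hN))
  have h1 := hX x hx
  rw [not_frequently, eventually_atTop] at h1
  obtain ⟨N, hN⟩ := h1
  exact mem_iUnion.2 ⟨N, hx, fun k hk hkR hK => hN k hk ⟨hK, hkR⟩⟩

variable {ν₂ : Ω → Measure ℝ} {lam₂ : Ω → ℝ}

/-- If two conformal families are not comparable, the eigenvalue products decay relative to the
derivatives at the fixed point. -/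
theorem tendsto_of_not_absolutelyContinuous [Finite ι] (h₂ : S.Conf ν₂ lam₂) {ω : Ω}
    (hne : ¬ ν ω ≪ ν₂ ω) : Tendsto (fun n => S.P n ω * S.Λ lam n ω) atTop (𝓝 0) := by
  have hp₁ := h.prob ω
  have hp₂ := h₂.prob ω
  have hδ := S.δ_pos
  have hM := h.M_pos ω
  have hA := S.A_pos
  have hCq : 0 < S.Cq := by unfold Cq; positivity
  set D := (S.δ ^ 2) ^ S.t with hD
  have hD0 : 0 < D := by positivity
  -- If almost every point for ν₂ visited K at infinitely many red times, `cover_le` with the factor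
  -- s⁻¹ would give D ≤ D/2.
  set s : ℝ := max 1 (2 * (S.Cq * 4 ^ S.t) / D) with hs
  have hs1 : 1 ≤ s := le_max_left _ _
  have hs0 : 0 < s := by linarith
  set Red : Set ℕ := {n | s * S.Λ lam n ω ≤ S.Λ lam₂ n ω} with hRed
  -- a set of positive measure for the second family avoids red times
  obtain ⟨N₂, hN₂⟩ : ∃ N, ν₂ ω {x ∈ {x ∈ S.reg ω | ¬ ∃ᶠ n in atTop,
      S.it n ω x ∈ S.K (S.θ^[n] ω) ∧ n ∈ Red} |
      ∀ k ≥ N, k ∈ Red → S.it k ω x ∉ S.K (S.θ^[k] ω)} ≠ 0 := by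
    refine exists_eventually_avoid (fun h0 => ?_) fun x hx => hx.2
    have hc := h₂.cover_le h (ω := ω) (X := {x ∈ S.reg ω | ∃ᶠ n in atTop,
      S.it n ω x ∈ S.K (S.θ^[n] ω) ∧ n ∈ Red}) (fun x hx => hx.1) (s := s⁻¹) (by positivity)
      fun x hx => hx.2.mono fun n hn => ⟨hn.1, by
        rw [le_inv_mul_iff₀ hs0]; exact hn.2⟩
    have h1 : 1 ≤ ν₂ ω {x ∈ S.reg ω | ∃ᶠ n in atTop, S.it n ω x ∈ S.K (S.θ^[n] ω) ∧ n ∈ Red} := by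
      rw [← h₂.measure_reg ω]
      calc _ ≤ ν₂ ω ({x ∈ S.reg ω | ∃ᶠ n in atTop, S.it n ω x ∈ S.K (S.θ^[n] ω) ∧ n ∈ Red} ∪
            {x ∈ S.reg ω | ¬ ∃ᶠ n in atTop, S.it n ω x ∈ S.K (S.θ^[n] ω) ∧ n ∈ Red}) := by
            refine measure_mono fun x hx => ?_
            by_cases hf : ∃ᶠ n in atTop, S.it n ω x ∈ S.K (S.θ^[n] ω) ∧ n ∈ Red
            · exact Or.inl ⟨hx, hf⟩
            · exact Or.inr ⟨hx, hf⟩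
        _ ≤ _ := measure_union_le _ _
        _ = _ := by rw [h0, add_zero]
    have h2 : ENNReal.ofReal D ≤ ENNReal.ofReal (S.Cq * 4 ^ S.t * s⁻¹) :=
      calc ENNReal.ofReal D ≤ ENNReal.ofReal D * _ := le_mul_of_one_le_right' h1
        _ ≤ _ := hc
        _ ≤ ENNReal.ofReal (S.Cq * 4 ^ S.t * s⁻¹) * 1 := by gcongr; exact prob_le_one
        _ = _ := mul_one _
    rw [ENNReal.ofReal_le_ofReal_iff (by positivity), ← div_eq_mul_inv, le_div_iff₀ hs0] at h2
    have h3 : 2 * (S.Cq * 4 ^ S.t) / D ≤ s := le_max_right _ _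
    rw [div_le_iff₀ hD0] at h3
    have : 0 < S.Cq * 4 ^ S.t := by positivity
    linarith
  -- a set of positive measure for the first family avoids blue times
  obtain ⟨N₁, hN₁⟩ : ∃ N, ∃ E : Set ℝ, E ⊆ S.reg ω ∧ ν ω {x ∈ E |
      ∀ k ≥ N, k ∈ Redᶜ → S.it k ω x ∉ S.K (S.θ^[k] ω)} ≠ 0 := by
    have hne' : ∃ E, ν₂ ω E = 0 ∧ ν ω E ≠ 0 := by
      by_contra! hcon
      exact hne fun E hE => hcon E hE
    obtain ⟨E, hE₂, hE₁⟩ := hne'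
    -- By `cover_le`, the points of the ν₂-null set E that visit K at infinitely many blue times are
    -- also ν-null; the rest of E has positive ν-measure.
    have hE : ν ω {x ∈ E ∩ S.reg ω | ¬ ∃ᶠ n in atTop,
        S.it n ω x ∈ S.K (S.θ^[n] ω) ∧ n ∈ Redᶜ} ≠ 0 := by
      intro h0
      have hc := h.cover_le h₂ (ω := ω) (X := {x ∈ E ∩ S.reg ω | ∃ᶠ n in atTop,
        S.it n ω x ∈ S.K (S.θ^[n] ω) ∧ n ∈ Redᶜ}) (fun x hx => hx.1.2) hs0
        fun x hx => hx.2.mono fun n hn => ⟨hn.1, (not_le.1 fun hle => hn.2 hle).le⟩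
      rw [measure_mono_null (fun x hx => hx.1.1) hE₂, mul_zero, nonpos_iff_eq_zero, mul_eq_zero,
        or_iff_right (ENNReal.ofReal_pos.2 hD0).ne'] at hc
      refine hE₁ ?_
      rw [← h.measure_inter_reg]
      refine measure_mono_null (fun x hx => ?_) (measure_union_null hc h0)
      by_cases hf : ∃ᶠ n in atTop, S.it n ω x ∈ S.K (S.θ^[n] ω) ∧ n ∈ Redᶜ
      · exact Or.inl ⟨hx, hf⟩
      · exact Or.inr ⟨hx, hf⟩
    obtain ⟨N, hN⟩ := exists_eventually_avoid hE fun x hx => hx.2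
    exact ⟨N, _, fun x hx => hx.1.2, hN⟩
  obtain ⟨E, hEreg, hE⟩ := hN₁
  obtain ⟨C₁, hC₁, p₁, hp₁0, hp₁s, hb₁, ht₁⟩ := h.growth_of_avoid (R := Redᶜ) (N := N₁)
    (fun x hx => hEreg hx.1) (fun x hx => hx.2) hE
  obtain ⟨C₂, hC₂, p₂, hp₂0, hp₂s, hb₂, ht₂⟩ := h₂.growth_of_avoid (R := Red) (N := N₂)
    (fun x hx => hx.1.1) (fun x hx => hx.2) hN₂
  set b : ℕ → ℝ := fun n => (S.bs ω n).toReal with hb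
  have hb0 : ∀ n, 0 ≤ b n := fun n => ENNReal.toReal_nonneg
  set C := max C₁ C₂ with hC
  have hC0 : 0 ≤ C := hC₁.trans (le_max_left _ _)
  have hΓ0 : ∀ n, 0 ≤ ∑ k ∈ Finset.range n, b k := fun n => Finset.sum_nonneg fun k _ => hb0 k
  -- The sequence b is common to both families and each time is red or blue, so the two partial
  -- estimates give one recursion for all large n.
  obtain ⟨N, hN⟩ := eventually_atTop.1 (hb₁.and hb₂)
  have hsummable : Summable b := by
    refine summable_of_le_mul_sum (p := fun n => p₁ n + p₂ n) (C := C) (L := 4) (N := N) hb0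
      (fun n => add_nonneg (hp₁0 n) (hp₂0 n)) hC0 (fun n => ?_) fun n hn => ?_
    · rw [Finset.sum_add_distrib]; linarith [hp₁s n, hp₂s n]
    · have q₁ := hp₁0 n
      have q₂ := hp₂0 n
      have q₃ := hΓ0 n
      by_cases hr : n ∈ Red
      · refine ((hN n hn).2 hr).trans ?_
        gcongr
        · exact le_max_right _ _
        · exact le_add_of_nonneg_left q₁
      · refine ((hN n hn).1 hr).trans ?_
        gcongr
        · exact le_max_left _ _
        · exact le_add_of_nonneg_right q₂
  rw [Metric.tendsto_atTop]
  intro ε hε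
  have htail := tendsto_sum_nat_add b
  obtain ⟨m, hm⟩ : ∃ m, C * ∑' k, b (k + m) < ε := by
    have h1 := htail.const_mul C
    rw [mul_zero] at h1
    exact (h1.eventually_lt_const hε).exists
  have hIco : ∀ n, ∑ k ∈ Finset.Ico m n, b k ≤ ∑' k, b (k + m) := by
    intro n
    rw [Finset.sum_Ico_eq_sum_range]
    simp only [add_comm m]
    exact ((summable_nat_add_iff m).2 hsummable).sum_le_tsum _ fun k _ => hb0 _
  obtain ⟨N', hN'⟩ := eventually_atTop.1 ((ht₁ m).and (ht₂ m))
  refine ⟨N', fun n hn => ?_⟩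
  have hP := S.P_pos n ω
  have hΛ := h.Λ_pos n ω
  have hI0 : 0 ≤ ∑ k ∈ Finset.Ico m n, b k := Finset.sum_nonneg fun k _ => hb0 k
  rw [dist_zero_right, Real.norm_of_nonneg (by positivity)]
  refine lt_of_le_of_lt ?_ hm
  calc S.P n ω * S.Λ lam n ω ≤ C * ∑ k ∈ Finset.Ico m n, b k := by
        -- At red times the tail bound is that of the second family, whose product dominates because
        -- s ≥ 1.
        by_cases hr : n ∈ Red
        · calc S.P n ω * S.Λ lam n ω ≤ S.P n ω * S.Λ lam₂ n ω := by
                gcongr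
                exact (le_mul_of_one_le_left hΛ.le hs1).trans hr
            _ ≤ C₂ * ∑ k ∈ Finset.Ico m n, b k := (hN' n hn).2 hr
            _ ≤ _ := by gcongr; exact le_max_right _ _
        · calc _ ≤ C₁ * ∑ k ∈ Finset.Ico m n, b k := (hN' n hn).1 hr
            _ ≤ _ := by gcongr; exact le_max_left _ _
    _ ≤ _ := by gcongr; exact hIco n

end Conf
end System
-- Oscillation at the fixed point 0, convergence of ratios, and restriction to one orbit
namespace System
variable {ι Ω : Type*} {S : System ι Ω}

/-- The accumulated oscillation of the derivative along the fixed point `0`. -/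
def osc (S : System ι Ω) (bb : ℕ → Ω → ℝ) (n : ℕ) (ω : Ω) : ℝ :=
  ∑ l ∈ Finset.range n, bb (n - (l + 1)) (S.θ^[l] ω)

theorem osc_succ (bb : ℕ → Ω → ℝ) (n : ℕ) (ω : Ω) :
    S.osc bb (n + 1) ω = bb n ω + S.osc bb n (S.θ ω) := by
  rw [osc, Finset.sum_range_succ', add_comm]
  simp only [osc, Nat.add_sub_add_right, Nat.sub_zero, Function.iterate_succ_apply,
    Function.iterate_zero, id_eq]

/-- After l steps the point still begins with n + 1 − l letters of the cell of 0, which is scale n −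
l − 1 of the oscillation `bb`; the chain rule adds the contributions. -/
theorem abs_log_jac_sub_le {bb : ℕ → Ω → ℝ} (hbb : ∀ k ω, ∀ y ∈ S.ccyl (S.rep (k + 2)) ω,
      |Real.log (|S.d ω S.G.i0 y|) - Real.log (|S.d ω S.G.i0 0|)| ≤ bb k ω)
    {n : ℕ} {ω : Ω} {x : ℝ} (hx : x ∈ S.ccyl (S.rep (n + 1)) ω) :
    |Real.log (|S.jac (S.rep n) ω x|) - Real.log (|S.jac (S.rep n) ω 0|)| ≤ S.osc bb n ω := by
  induction n generalizing ω x with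
  | zero => simp [jac, osc]
  | succ n ih =>
    have h1 := ih hx.2
    have h2 := hbb n ω x hx
    have hκ := S.κ_pos
    have p1 : 0 < |S.jac (S.rep n) (S.θ ω) (S.T ω x)| :=
      (pow_pos hκ n).trans_le (pow_le_jac_rep hx.2)
    have p2 : 0 < |S.jac (S.rep n) (S.θ ω) 0| :=
      (pow_pos hκ n).trans_le (pow_le_jac_rep (S.zero_mem_ccyl _ _))
    have p3 : 0 < |S.d ω S.G.i0 x| := hκ.trans_le ((S.branch ω).expand_zero x hx.1 hx.2.1)
    have p4 : 0 < |S.d ω S.G.i0 0| := hκ.trans_le (S.κ_le_d_zero ω)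
    rw [osc_succ, show S.rep (n + 1) = S.G.i0 :: S.rep n from rfl]
    simp only [jac, (S.branch ω).map_zero, abs_mul]
    rw [Real.log_mul p3.ne' p1.ne', Real.log_mul p4.ne' p2.ne']
    refine le_trans (le_of_eq ?_) ((abs_add_le _ _).trans (add_le_add h2 h1))
    congr 1; ring

variable (S) in
/-- The constant in `one_le_exp_osc`. -/
def CE : ℝ := S.M ^ 1 * (S.A ^ 1) ^ S.t * S.Cw

namespace Conf
variable {ν : Ω → Measure ℝ} {lam : Ω → ℝ} (h : S.Conf ν lam)
include h

theorem CE_pos [Finite ι] (ω : Ω) : 0 < S.CE := by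
  have := h.M_pos ω; have := S.A_pos; have := Cw_pos (S := S)
  unfold CE; positivity

/-- The eigenvalue products do not decay much faster than the derivatives at the fixed point. -/
theorem one_le_exp_osc [Finite ι] {bb : ℕ → Ω → ℝ} (hbb : ∀ k ω, ∀ y ∈ S.ccyl (S.rep (k + 2)) ω,
      |Real.log (|S.d ω S.G.i0 y|) - Real.log (|S.d ω S.G.i0 0|)| ≤ bb k ω) (n : ℕ) (ω : Ω) :
    1 ≤ S.CE * (S.P n ω * S.Λ lam n ω * Real.exp ((S.t + S.a) * S.osc bb n ω)) := by
  have hκ := S.κ_pos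
  have hP := S.P_pos n ω
  have hΛ := h.Λ_pos n ω
  have hM := h.M_pos ω
  have hA := S.A_pos
  have hCw := Cw_pos (S := S)
  have ha := S.a_pos
  have ht := S.t_pos
  set o := S.osc bb n ω with ho
  have hlen : (S.rep n).length = n := List.length_replicate
  -- The target has mass bounded below, and arriving in it supplies the letter n + 1 that the
  -- distortion bound requires.
  set B := S.cyl (S.rep 1) (S.θ^[n] ω) with hB
  set Kn := S.P n ω * Real.exp ((S.t + S.a) * o) with hKn
  have h1 := h.le_lintegral (S.rep n) hlen (ω := ω) (g := B.indicator 1)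
    (u := fun x => ENNReal.ofReal Kn * S.wt x)
    (measurable_one.indicator (S.measurableSet_cyl _ _)) fun x hx => by
      by_cases hxB : S.it n ω x ∈ B
      swap
      · rw [indicator_of_notMem hxB]; simp
      rw [indicator_of_mem hxB, Pi.one_apply, one_mul, wt, ← ENNReal.ofReal_mul (by positivity)]
      refine ENNReal.ofReal_le_ofReal ?_
      have hx1 : x ∈ S.cyl (S.rep (n + 1)) ω := by
        rw [rep, List.replicate_succ', S.mem_cyl_append, hlen]
        exact ⟨hx, hxB⟩
      have hxc := S.cyl_subset_ccyl _ _ hx1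
      have hu := S.cyl_subset_unit _ _ hx
      have hf := S.cylFacts (S.rep (n + 1)) ω
      have hfn := S.cylFacts (S.rep n) ω
      set J0 := |S.jac (S.rep n) ω 0| with hJ0
      have pJ : ∀ z ∈ S.ccyl (S.rep (n + 1)) ω, 0 < |S.jac (S.rep n) ω z| := fun z hz =>
        (pow_pos hκ n).trans_le (pow_le_jac_rep hz)
      have pJ0 : 0 < J0 := pJ 0 (S.zero_mem_ccyl _ _)
      have hJ : ∀ z ∈ S.ccyl (S.rep (n + 1)) ω, J0 * Real.exp (-o) ≤ |S.jac (S.rep n) ω z| ∧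
          |S.jac (S.rep n) ω z| ≤ J0 * Real.exp o := by
        intro z hz
        have h3 := abs_le.1 (abs_log_jac_sub_le hbb hz)
        rw [← hJ0, ← ho] at h3
        constructor
        · rw [← Real.log_le_log_iff (by positivity) (pJ z hz), Real.log_mul pJ0.ne'
            (Real.exp_pos _).ne', Real.log_exp]
          linarith [h3.1]
        · rw [← Real.log_le_log_iff (pJ z hz) (by positivity), Real.log_mul pJ0.ne'
            (Real.exp_pos _).ne', Real.log_exp]
          linarith [h3.2]
      have hxn := S.cyl_subset_ccyl _ _ hx
      have h0n := S.zero_mem_ccyl n ω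
      have h4 := hfn.le_abs_sub h0n hxn (M := J0 * Real.exp (-o)) fun z hz =>
        (hJ z (hf.ord.uIcc_subset (S.zero_mem_ccyl _ _) hxc hz)).1
      have h5 : |S.it (S.rep n).length ω x - S.it (S.rep n).length ω 0| ≤ 1 := by
        have m1 := hfn.bij.mapsTo hxn
        have m2 := hfn.bij.mapsTo h0n
        rw [abs_le]; constructor <;> linarith [m1.1, m1.2, m2.1, m2.2]
      have h6 := h4.trans h5
      rw [sub_zero, abs_of_pos hu.1] at h6
      have he := e_pos hu
      have h7 : J0 * Real.exp (-o) * e x ≤ 1 := le_trans (by gcongr; exact e_le_left x) h6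
      -- Since the image has length at most 1, the distance to the ends is at most the inverse
      -- derivative. So the power a of the derivative is absorbed by the weight e^(-a), and only the
      -- power β, that is P, remains.
      have h8 : (J0 * Real.exp (-o)) ^ S.a * e x ^ S.a ≤ 1 := by
        rw [← Real.mul_rpow (by positivity) he.le]
        exact Real.rpow_le_one (by positivity) h7 ha.le
      have hexp : ∀ u v : ℝ, Real.exp u ^ v = Real.exp (u * v) := fun u v => (Real.exp_mul u v).symm
      calc |S.jac (S.rep n) ω x| ^ S.t ≤ (J0 * Real.exp o) ^ S.t := by
            gcongr; exact (hJ x hxc).2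
        _ = J0 ^ S.β * J0 ^ S.a * Real.exp (o * S.t) := by
            rw [Real.mul_rpow pJ0.le (Real.exp_pos _).le, hexp, ← Real.rpow_add pJ0,
              add_comm S.β, S.a_add_β]
        _ = Kn * (J0 * Real.exp (-o)) ^ S.a := by
            rw [hKn, S.P_eq, ← hJ0, Real.mul_rpow pJ0.le (Real.exp_pos _).le, hexp,
              show (S.t + S.a) * o = o * S.t + o * S.a by ring, Real.exp_add,
              show -o * S.a = -(o * S.a) by ring, Real.exp_neg]
            field_simp
        _ = Kn * ((J0 * Real.exp (-o)) ^ S.a * e x ^ S.a * e x ^ (-S.a)) := by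
            rw [mul_assoc _ (e x ^ S.a), ← Real.rpow_add he, add_neg_cancel, Real.rpow_zero, mul_one]
        _ ≤ Kn * (1 * e x ^ (-S.a)) := by gcongr
        _ = _ := by rw [one_mul]
  rw [lintegral_indicator_one (S.measurableSet_cyl _ _),
    lintegral_const_mul _ S.measurable_wt] at h1
  have h2 := h.le_measure_cyl (w := S.rep 1) (n := 1) rfl (S.θ^[n] ω)
  have h3 : (1 : ENNReal) ≤ ENNReal.ofReal (S.CE * (S.P n ω * S.Λ lam n ω *
      Real.exp ((S.t + S.a) * o))) := by
    calc (1 : ENNReal) ≤ _ := h2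
      _ ≤ ENNReal.ofReal (S.M ^ 1 * (S.A ^ 1) ^ S.t) * (ENNReal.ofReal (S.Λ lam n ω) *
          (ENNReal.ofReal Kn * ENNReal.ofReal S.Cw)) := by
          gcongr
          refine h1.trans ?_
          gcongr
          exact (setLIntegral_le_lintegral _ _).trans (h.lintegral_wt_le _)
      _ = _ := by
          rw [← ENNReal.ofReal_mul (by positivity), ← ENNReal.ofReal_mul (by positivity),
            ← ENNReal.ofReal_mul (by positivity), CE, hKn]
          congr 1; ring
  rwa [ENNReal.one_le_ofReal] at h3

variable {ν₂ : Ω → Measure ℝ} {lam₂ : Ω → ℝ}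

/-- The ratio of the eigenvalue products of comparable conformal families converges to a positive
number along a subsequence. -/
theorem exists_subseq_tendsto [Finite ι] (h₂ : S.Conf ν₂ lam₂) {ω : Ω} (hac : ν ω ≪ ν₂ ω) :
    ∃ n : ℕ → ℕ, StrictMono n ∧ ∃ L : ℝ, 0 < L ∧
      Tendsto (fun k => S.Λ lam (n k) ω / S.Λ lam₂ (n k) ω) atTop (𝓝 L) := by
  have hp₁ := h.prob ω
  have hp₂ := h₂.prob ω
  have hδ := S.δ_pos
  have hM := h.M_pos ω
  have hA := S.A_pos
  have hCq : 0 < S.Cq := by unfold Cq; positivity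
  set D := (S.δ ^ 2) ^ S.t with hD
  have hD0 : 0 < D := by positivity
  set C := S.Cq * 4 ^ S.t with hC
  have hC0 : 0 < C := by positivity
  set X : ℕ → Set ℝ := fun s => {x ∈ S.reg ω | ∃ᶠ n in atTop, S.it n ω x ∈ S.K (S.θ^[n] ω) ∧
    S.Λ lam n ω ≤ ((s : ℝ) + 1)⁻¹ * S.Λ lam₂ n ω} with hX
  set Y : ℕ → Set ℝ := fun s => {x ∈ S.reg ω | ∃ᶠ n in atTop, S.it n ω x ∈ S.K (S.θ^[n] ω) ∧
    S.Λ lam₂ n ω ≤ ((s : ℝ) + 1)⁻¹ * S.Λ lam n ω} with hY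
  have hnull : ∀ (μ : Measure ℝ) (Z : ℕ → Set ℝ),
      (∀ s : ℕ, ENNReal.ofReal D * μ (Z s) ≤ ENNReal.ofReal (C * ((s : ℝ) + 1)⁻¹)) →
      μ (⋂ s, Z s) = 0 := by
    intro μ Z hZ
    have h1 : ENNReal.ofReal D * μ (⋂ s, Z s) ≤ 0 := by
      have hlim : Tendsto (fun s : ℕ => ENNReal.ofReal (C * ((s : ℝ) + 1)⁻¹)) atTop (𝓝 0) := by
        rw [← ENNReal.ofReal_zero]
        refine ENNReal.tendsto_ofReal ?_
        have := (tendsto_one_div_add_atTop_nhds_zero_nat (𝕜 := ℝ)).const_mul C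
        simpa using this
      refine ge_of_tendsto' hlim fun s => le_trans ?_ (hZ s)
      gcongr; exact iInter_subset _ s
    rw [nonpos_iff_eq_zero, mul_eq_zero, or_iff_right (ENNReal.ofReal_pos.2 hD0).ne'] at h1
    exact h1
  -- `cover_le` shows this set to be null for the second family; absolute continuity transfers that
  -- to ν.
  have hXn : ν ω (⋂ s, X s) = 0 := hac (hnull _ X fun s => by
    have := h₂.cover_le h (ω := ω) (X := X s) (fun x hx => hx.1) (s := ((s : ℝ) + 1)⁻¹)
      (by positivity) fun x hx => hx.2
    calc _ ≤ _ := this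
      _ ≤ ENNReal.ofReal (C * ((s : ℝ) + 1)⁻¹) * 1 := by gcongr; exact prob_le_one
      _ = _ := mul_one _)
  have hYn : ν ω (⋂ s, Y s) = 0 := hnull _ Y fun s => by
    have := h.cover_le h₂ (ω := ω) (X := Y s) (fun x hx => hx.1) (s := ((s : ℝ) + 1)⁻¹)
      (by positivity) fun x hx => hx.2
    calc _ ≤ _ := this
      _ ≤ ENNReal.ofReal (C * ((s : ℝ) + 1)⁻¹) * 1 := by gcongr; exact prob_le_one
      _ = _ := mul_one _
  -- At the infinitely many visits of this single point to K, the ratio eventually stays in a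
  -- compact subinterval of (0, ∞).
  obtain ⟨x, hx, hxX, hxY⟩ : ∃ x ∈ S.reg ω, x ∉ ⋂ s, X s ∧ x ∉ ⋂ s, Y s := by
    by_contra! hcon
    have : ν ω (S.reg ω) = 0 := measure_mono_null (fun x hx => by
      by_cases h1 : x ∈ ⋂ s, X s
      · exact Or.inl h1
      · exact Or.inr (hcon x hx h1)) (measure_union_null hXn hYn)
    rw [h.measure_reg] at this
    exact one_ne_zero this
  simp only [mem_iInter, not_forall] at hxX hxY
  obtain ⟨s₁, hs₁⟩ := hxX
  obtain ⟨s₂, hs₂⟩ := hxY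
  have e1 : ∀ᶠ n in atTop, ¬ (S.it n ω x ∈ S.K (S.θ^[n] ω) ∧
      S.Λ lam n ω ≤ ((s₁ : ℝ) + 1)⁻¹ * S.Λ lam₂ n ω) := not_frequently.1 fun hf => hs₁ ⟨hx, hf⟩
  have e2 : ∀ᶠ n in atTop, ¬ (S.it n ω x ∈ S.K (S.θ^[n] ω) ∧
      S.Λ lam₂ n ω ≤ ((s₂ : ℝ) + 1)⁻¹ * S.Λ lam n ω) := not_frequently.1 fun hf => hs₂ ⟨hx, hf⟩
  have hvis : ∃ᶠ n in atTop, S.it n ω x ∈ S.K (S.θ^[n] ω) := by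
    rw [frequently_atTop]; exact exists_visit_ge hx
  have hfreq : ∃ᶠ n in atTop, S.Λ lam n ω / S.Λ lam₂ n ω ∈
      Icc ((s₁ : ℝ) + 1)⁻¹ ((s₂ : ℝ) + 1) := by
    refine (hvis.and_eventually (e1.and e2)).mono fun n hn => ?_
    obtain ⟨hK, h1, h2⟩ := hn
    have hΛ₂ := h₂.Λ_pos n ω
    have q1 := not_le.1 fun hle => h1 ⟨hK, hle⟩
    have q2 := not_le.1 fun hle => h2 ⟨hK, hle⟩
    refine ⟨by rw [le_div_iff₀ hΛ₂]; exact q1.le, ?_⟩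
    rw [div_le_iff₀ hΛ₂]
    rw [inv_mul_lt_iff₀ (by positivity)] at q2
    exact q2.le
  obtain ⟨L, hL, φ, hφ, hlim⟩ := isCompact_Icc.tendsto_subseq' hfreq
  exact ⟨φ, hφ, L, lt_of_lt_of_le (by positivity) hL.1, hlim⟩

end Conf

/-- The system along the orbit of a base point. -/
def orbit (S : System ι Ω) (ω : Ω) : System ι ℕ where
  G := S.G
  θ := Nat.succ
  T n := S.T (S.θ^[n] ω)
  d n := S.d (S.θ^[n] ω)
  κ := S.κ
  A := S.A
  α := S.α
  c₀ := S.c₀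
  C₁ := S.C₁
  ρ := S.ρ
  t := S.t
  j := S.j
  r := S.r
  one_lt_κ := S.one_lt_κ
  one_lt_A := S.one_lt_A
  α_pos := S.α_pos
  α_lt_one := S.α_lt_one
  c₀_pos := S.c₀_pos
  C₁_pos := S.C₁_pos
  ρ_pos := S.ρ_pos
  ρ_le := S.ρ_le
  t_pos := S.t_pos
  depth := S.depth
  branch _ := S.branch _
  measurable_T _ := S.measurable_T _
  measurable_d _ := S.measurable_d _

theorem orbit_θ_iterate (ω : Ω) (n k : ℕ) : (S.orbit ω).θ^[n] k = k + n :=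
  Nat.succ_iterate k n

theorem orbit_Λ (ω : Ω) (lam : Ω → ℝ) (n : ℕ) :
    (S.orbit ω).Λ (fun k => lam (S.θ^[k] ω)) n 0 = S.Λ lam n ω := by
  simp only [Λ, cocycle, orbit_θ_iterate, zero_add]

theorem orbit_P (ω : Ω) (n : ℕ) : (S.orbit ω).P n 0 = S.P n ω := by
  simp only [P, orbit_θ_iterate, zero_add]; rfl

theorem orbit_osc (ω : Ω) (bb : ℕ → Ω → ℝ) (n : ℕ) :
    (S.orbit ω).osc (fun k l => bb k (S.θ^[l] ω)) n 0 = S.osc bb n ω := by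
  simp only [osc, orbit_θ_iterate, zero_add]

theorem orbit_ccyl (ω : Ω) (w : List ι) (n : ℕ) :
    (S.orbit ω).ccyl w n = S.ccyl w (S.θ^[n] ω) := by
  induction w generalizing n with
  | nil => rfl
  | cons i w ih =>
    simp only [ccyl]
    rw [show (S.orbit ω).θ n = n + 1 from rfl, ih, Function.iterate_succ_apply']
    rfl

end System

/-! ### Maximal Birkhoff sums and divergence to −∞ -/

/-- The maximum of the first Birkhoff sums. -/
def maxSum {Ω : Type*} (θ : Ω → Ω) (ζ : Ω → ℝ) : ℕ → Ω → ℝ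
  | 0, _ => 0
  | N + 1, ω => max 0 (ζ ω + maxSum θ ζ N (θ ω))

section BirkhoffSums
variable {Ω : Type*} {θ : Ω → Ω} {ζ : Ω → ℝ}

theorem maxSum_nonneg (N : ℕ) (ω : Ω) : 0 ≤ maxSum θ ζ N ω := by
  cases N with
  | zero => exact le_rfl
  | succ N => exact le_max_left _ _

theorem monotone_maxSum (ω : Ω) : Monotone fun N => maxSum θ ζ N ω := by
  refine monotone_nat_of_le_succ fun N => ?_
  induction N generalizing ω with
  | zero => exact maxSum_nonneg _ _
  | succ N ih => exact max_le_max le_rfl (add_le_add le_rfl (ih _))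

theorem birkhoffSum_le_maxSum (N : ℕ) (ω : Ω) : birkhoffSum θ ζ N ω ≤ maxSum θ ζ N ω := by
  induction N generalizing ω with
  | zero => simp [maxSum]
  | succ N ih => rw [birkhoffSum_succ']; exact le_max_of_le_right (add_le_add le_rfl (ih _))

theorem exists_maxSum_eq (N : ℕ) (ω : Ω) : ∃ n, maxSum θ ζ N ω = birkhoffSum θ ζ n ω := by
  induction N generalizing ω with
  | zero => exact ⟨0, by simp [maxSum]⟩
  | succ N ih =>
    obtain ⟨n, hn⟩ := ih (θ ω)
    rcases max_choice 0 (ζ ω + maxSum θ ζ N (θ ω)) with h | h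
    · exact ⟨0, by rw [maxSum, h, birkhoffSum_zero]⟩
    · exact ⟨n + 1, by rw [maxSum, h, hn, birkhoffSum_succ']⟩

/-- The recursion in the form of a cohomological equation with a nonnegative error; the error is at
most |ζ|, which permits dominated convergence. -/
theorem maxSum_succ_sub (N : ℕ) (ω : Ω) : maxSum θ ζ (N + 1) ω =
    ζ ω + maxSum θ ζ N (θ ω) + max 0 (-(ζ ω + maxSum θ ζ N (θ ω))) := by
  rw [maxSum]
  rcases le_total 0 (ζ ω + maxSum θ ζ N (θ ω)) with h | h
  · rw [max_eq_right h, max_eq_left (by linarith), add_zero]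
  · rw [max_eq_left h, max_eq_right (by linarith)]; ring

theorem bddAbove_maxSum {ω : Ω} (h : Tendsto (fun n => birkhoffSum θ ζ n ω) atTop atBot) :
    BddAbove (range fun N => maxSum θ ζ N ω) := by
  obtain ⟨n₀, hn₀⟩ := eventually_atTop.1 (h.eventually_le_atBot 0)
  refine ⟨∑ n ∈ Finset.range n₀, |birkhoffSum θ ζ n ω|, ?_⟩
  rintro _ ⟨N, rfl⟩
  obtain ⟨n, hn⟩ := exists_maxSum_eq (θ := θ) (ζ := ζ) N ω
  simp only [hn]
  rcases lt_or_ge n n₀ with hlt | hge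
  · exact (le_abs_self _).trans (Finset.single_le_sum (f := fun n => |birkhoffSum θ ζ n ω|)
      (fun _ _ => abs_nonneg _) (Finset.mem_range.2 hlt))
  · exact (hn₀ n hge).trans (Finset.sum_nonneg fun _ _ => abs_nonneg _)

variable [MeasurableSpace Ω] {m : Measure Ω}

theorem measurable_maxSum (hθ : Measurable θ) (hζ : Measurable ζ) (N : ℕ) :
    Measurable (maxSum θ ζ N) := by
  induction N with
  | zero => exact measurable_const
  | succ N ih => exact measurable_const.max (hζ.add (ih.comp hθ))

theorem integrable_maxSum (hθ : MeasurePreserving θ m m) (hζ : Integrable ζ m) (N : ℕ) :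
    Integrable (maxSum θ ζ N) m := by
  induction N with
  | zero => exact integrable_zero _ _ _
  | succ N ih =>
    exact (integrable_zero Ω ℝ m).sup (hζ.add (hθ.integrable_comp_of_integrable ih))

/-- The negative part that controls the growth of `maxSum`. -/
theorem integrable_deficit (hθ : MeasurePreserving θ m m) (hζ : Integrable ζ m) (N : ℕ) :
    Integrable (fun ω => max 0 (-(ζ ω + maxSum θ ζ N (θ ω)))) m :=
  (integrable_zero Ω ℝ m).sup (hζ.add
    (hθ.integrable_comp_of_integrable (integrable_maxSum hθ hζ N))).neg

omit [MeasurableSpace Ω] in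
theorem abs_deficit_le (N : ℕ) (ω : Ω) :
    ‖max 0 (-(ζ ω + maxSum θ ζ N (θ ω)))‖ ≤ |ζ ω| := by
  rw [Real.norm_of_nonneg (le_max_left _ _)]
  refine max_le (abs_nonneg _) ?_
  have := maxSum_nonneg (θ := θ) (ζ := ζ) N (θ ω)
  linarith [neg_abs_le (ζ ω)]

theorem integral_maxSum_succ_sub (hθ : MeasurePreserving θ m m) (hm : Measurable ζ)
    (hζ : Integrable ζ m) (N : ℕ) :
    ∫ ω, (maxSum θ ζ (N + 1) ω - maxSum θ ζ N ω) ∂m =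
      ∫ ω, ζ ω ∂m + ∫ ω, max 0 (-(ζ ω + maxSum θ ζ N (θ ω))) ∂m := by
  have h1 := integrable_maxSum hθ hζ N
  have h2 : Integrable (fun ω => maxSum θ ζ N (θ ω)) m := hθ.integrable_comp_of_integrable h1
  have h3 : ∫ ω, maxSum θ ζ N (θ ω) ∂m = ∫ ω, maxSum θ ζ N ω ∂m := by
    have := integral_map hθ.measurable.aemeasurable (μ := m) (f := maxSum θ ζ N)
      (measurable_maxSum hθ.measurable hm N).aestronglyMeasurable
    rw [hθ.map_eq] at this
    exact this.symm
  rw [integral_sub (integrable_maxSum hθ hζ _) h1]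
  simp only [maxSum_succ_sub]
  have h4 : Integrable (fun ω => ζ ω + maxSum θ ζ N (θ ω)) m := hζ.add h2
  rw [integral_add h4 (integrable_deficit hθ hζ N), integral_add hζ h2, h3]
  ring

/-- A maximal ergodic inequality. -/
theorem integral_nonneg_of_exists_birkhoffSum (hθ : MeasurePreserving θ m m) (hm : Measurable ζ)
    (hζ : Integrable ζ m) (h : ∀ᵐ ω ∂m, ∃ n, 1 ≤ n ∧ 0 ≤ birkhoffSum θ ζ n ω) :
    0 ≤ ∫ ω, ζ ω ∂m := by
  -- A nonnegative Birkhoff sum gives ζ + maxSum ∘ θ ≥ 0 once N is large, so the error vanishes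
  -- eventually.
  have hlim : Tendsto (fun N => ∫ ω, max 0 (-(ζ ω + maxSum θ ζ N (θ ω))) ∂m) atTop
      (𝓝 (∫ _, (0 : ℝ) ∂m)) := by
    refine tendsto_integral_of_dominated_convergence (fun ω => |ζ ω|)
      (fun N => (integrable_deficit hθ hζ N).aestronglyMeasurable) hζ.abs
      (fun N => Eventually.of_forall fun ω => abs_deficit_le N ω) ?_
    filter_upwards [h] with ω hω
    obtain ⟨n, hn, hS⟩ := hω
    obtain ⟨k, rfl⟩ := Nat.exists_eq_succ_of_ne_zero (by omega : n ≠ 0)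
    refine tendsto_const_nhds.congr' ?_
    filter_upwards [eventually_ge_atTop k] with N hN
    rw [Nat.succ_eq_add_one, birkhoffSum_succ'] at hS
    have h1 := birkhoffSum_le_maxSum (θ := θ) (ζ := ζ) k (θ ω)
    have h2 := monotone_maxSum (θ := θ) (ζ := ζ) (θ ω) hN
    simp only at h2
    rw [max_eq_left (by linarith)]
  rw [integral_zero] at hlim
  have h2 := hlim.const_add (∫ ω, ζ ω ∂m)
  rw [add_zero] at h2
  refine ge_of_tendsto' h2 fun N => ?_
  rw [← integral_maxSum_succ_sub hθ hm hζ]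
  exact integral_nonneg fun ω => sub_nonneg.2 (monotone_maxSum ω N.le_succ)

/-- Birkhoff sums of a bounded function with nonnegative mean do not diverge to `-∞`. -/
theorem not_ae_tendsto_birkhoffSum_atBot [IsProbabilityMeasure m] (hθ : MeasurePreserving θ m m)
    (hm : Measurable ζ) {C : ℝ} (hC : ∀ᵐ ω ∂m, |ζ ω| ≤ C) (h0 : 0 ≤ ∫ ω, ζ ω ∂m) :
    ¬ ∀ᵐ ω ∂m, Tendsto (fun n => birkhoffSum θ ζ n ω) atTop atBot := by
  intro h
  have hζ : Integrable ζ m := Integrable.of_bound hm.aestronglyMeasurable C hC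
  have hq := hθ.quasiMeasurePreserving
  set v : Ω → ℝ := fun ω => ⨆ N, maxSum θ ζ N ω with hv
  have hvm : Measurable v := Measurable.iSup fun N => measurable_maxSum hθ.measurable hm N
  have hlim : ∀ᵐ ω ∂m, Tendsto (fun N => maxSum θ ζ N ω) atTop (𝓝 (v ω)) := by
    filter_upwards [h] with ω hω
    exact tendsto_atTop_ciSup (monotone_maxSum ω) (bddAbove_maxSum hω)
  have hlim' : ∀ᵐ ω ∂m, Tendsto (fun N => maxSum θ ζ N (θ ω)) atTop (𝓝 (v (θ ω))) := hq.ae hlim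
  -- A uniform bound for the increments, since the limit v need not be integrable.
  have hdiff : ∀ N, ∀ᵐ ω ∂m, maxSum θ ζ (N + 1) ω - maxSum θ ζ N ω ≤ C := by
    intro N
    induction N with
    | zero =>
      filter_upwards [hC] with ω hω
      simp only [maxSum, add_zero, sub_zero]
      exact max_le ((abs_nonneg _).trans hω) ((le_abs_self _).trans hω)
    | succ N ih =>
      filter_upwards [hq.ae ih, hC] with ω h1 h2
      have h3 := maxSum_nonneg (θ := θ) (ζ := ζ) (N + 1) ω
      have h4 : ζ ω + maxSum θ ζ N (θ ω) ≤ maxSum θ ζ (N + 1) ω := le_max_right _ _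
      rw [sub_le_iff_le_add, maxSum]
      refine max_le ?_ ?_
      · linarith [(abs_nonneg _).trans h2]
      · linarith
  have hD1 : Tendsto (fun N => ∫ ω, (maxSum θ ζ (N + 1) ω - maxSum θ ζ N ω) ∂m) atTop
      (𝓝 (∫ _, (0 : ℝ) ∂m)) := by
    refine tendsto_integral_of_dominated_convergence (fun _ => C)
      (fun N => ((integrable_maxSum hθ hζ _).sub (integrable_maxSum hθ hζ N)).aestronglyMeasurable)
      (integrable_const C) (fun N => ?_) ?_
    · filter_upwards [hdiff N] with ω hω
      rwa [Real.norm_of_nonneg (sub_nonneg.2 (monotone_maxSum ω N.le_succ))]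
    · filter_upwards [hlim] with ω hω
      have := ((tendsto_add_atTop_iff_nat 1).2 hω).sub hω
      rwa [sub_self] at this
  have hD2 : Tendsto (fun N => ∫ ω, max 0 (-(ζ ω + maxSum θ ζ N (θ ω))) ∂m) atTop
      (𝓝 (∫ ω, max 0 (-(ζ ω + v (θ ω))) ∂m)) := by
    refine tendsto_integral_of_dominated_convergence (fun ω => |ζ ω|)
      (fun N => (integrable_deficit hθ hζ N).aestronglyMeasurable) hζ.abs
      (fun N => Eventually.of_forall fun ω => abs_deficit_le N ω) ?_
    filter_upwards [hlim'] with ω hω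
    exact tendsto_const_nhds.max (hω.const_add _).neg
  -- The integrated increments tend to 0 and are at least the integrated errors, because ∫ ζ ≥ 0.
  have hD3 : ∫ ω, max 0 (-(ζ ω + v (θ ω))) ∂m ≤ 0 := by
    rw [integral_zero] at hD1
    refine le_of_tendsto_of_tendsto' hD2 hD1 fun N => ?_
    rw [integral_maxSum_succ_sub hθ hm hζ]
    linarith
  have hDi : Integrable (fun ω => max 0 (-(ζ ω + v (θ ω)))) m := by
    refine Integrable.mono' hζ.abs (measurable_const.max
      (hm.add (hvm.comp hθ.measurable)).neg).aestronglyMeasurable ?_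
    filter_upwards [hlim'] with ω hω
    exact le_of_tendsto' (tendsto_const_nhds.max (hω.const_add _).neg).norm
      fun N => abs_deficit_le N ω
  have hD4 : ∀ᵐ ω ∂m, max 0 (-(ζ ω + v (θ ω))) = 0 :=
    (integral_eq_zero_iff_of_nonneg (fun ω => le_max_left _ _) hDi).1
      (le_antisymm hD3 (integral_nonneg fun ω => le_max_left _ _))
  -- With vanishing error, the limit v exhibits ζ as a coboundary.
  have hcob : ∀ᵐ ω ∂m, v ω = ζ ω + v (θ ω) := by
    filter_upwards [hD4, hlim, hlim'] with ω h1 h2 h3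
    have h4 : 0 ≤ ζ ω + v (θ ω) := by linarith [le_max_right 0 (-(ζ ω + v (θ ω)))]
    have h5 := (tendsto_add_atTop_iff_nat 1).2 h2
    have h6 : Tendsto (fun N => maxSum θ ζ (N + 1) ω) atTop (𝓝 (max 0 (ζ ω + v (θ ω)))) :=
      tendsto_const_nhds.max (h3.const_add _)
    rw [max_eq_right h4] at h6
    exact tendsto_nhds_unique h5 h6
  have hcob' : ∀ᵐ ω ∂m, ∀ n, v (θ^[n] ω) = v ω - birkhoffSum θ ζ n ω := by
    have : ∀ᵐ ω ∂m, ∀ n, v (θ^[n] ω) = ζ (θ^[n] ω) + v (θ (θ^[n] ω)) :=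
      ae_all_iff.2 fun n => (hθ.iterate n).quasiMeasurePreserving.ae hcob
    filter_upwards [this] with ω hω n
    induction n with
    | zero => simp
    | succ n ih =>
      rw [birkhoffSum_succ, Function.iterate_succ_apply']
      linarith [hω n]
  -- Along an orbit v equals its initial value minus the Birkhoff sum, so it tends to +∞; Poincaré
  -- recurrence to a sublevel set of v forbids this.
  obtain ⟨K, hK⟩ : ∃ K : ℕ, m {ω | v ω ≤ K} ≠ 0 := by
    by_contra! hcon
    have h1 : m (⋃ K : ℕ, {ω | v ω ≤ K}) = 0 := measure_iUnion_null hcon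
    have h2 : (⋃ K : ℕ, {ω | v ω ≤ K}) = univ := eq_univ_of_forall fun ω =>
      mem_iUnion.2 (exists_nat_ge (v ω))
    rw [h2, measure_univ] at h1
    exact one_ne_zero h1
  have hrec := hθ.conservative.ae_mem_imp_frequently_image_mem
    (measurableSet_le hvm (measurable_const (a := (K : ℝ)))).nullMeasurableSet
  have hbad : ∀ᵐ ω ∂m, ω ∉ {ω | v ω ≤ K} := by
    filter_upwards [hrec, hcob', h] with ω h1 h2 h3 hω
    have h4 := h1 hω
    obtain ⟨n, hn1, hn2⟩ := (h4.and_eventually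
      (h3.eventually_lt_atBot (v ω - K))).exists
    have := h2 n
    have hn3 : v (θ^[n] ω) ≤ K := hn1
    linarith
  exact hK (by simpa [ae_iff] using hbad)

end BirkhoffSums
-- Integration over the base
namespace System
variable {ι Ω : Type*} {S : System ι Ω}

/-- The families `ν`, `lam` are conformal along almost every orbit. -/
structure AEConf [MeasurableSpace Ω] (S : System ι Ω) (m : Measure Ω) (ν : Ω → Measure ℝ)
    (lam : Ω → ℝ) : Prop where
  measurable : Measurable lam
  pos : ∀ ω, 0 < lam ω
  conf : ∀ᵐ ω ∂m, (S.orbit ω).Conf (fun n => ν (S.θ^[n] ω)) (fun n => lam (S.θ^[n] ω))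

variable (S) in
/-- The logarithmic derivative at the points near `0`. -/
def L (ω : Ω) (y : ℝ) : ℝ := Real.log (max S.κ |S.d ω S.G.i0 y|)

variable (S) in
/-- The scale of the cylinders at the fixed point. -/
def R (k : ℕ) : ℝ := min ((S.κ ^ (k + 1))⁻¹) (S.G.hi S.G.i0)

theorem R_pos (k : ℕ) : 0 < S.R k := lt_min (inv_pos.2 (pow_pos S.κ_pos _)) hi_i0_pos

instance nonempty_Icc_R (k : ℕ) : Nonempty (Icc (0 : ℝ) (S.R k)) := ⟨⟨0, le_rfl, (R_pos k).le⟩⟩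

variable (S) in
/-- The oscillation of the logarithmic derivative at a given scale near `0`. -/
def bb (k : ℕ) (ω : Ω) : ℝ :=
  ⨆ n, |S.L ω (TopologicalSpace.denseSeq (Icc (0 : ℝ) (S.R k)) n) - S.L ω 0|

theorem mem_cell_of_mem_Icc_R {k : ℕ} {y : ℝ} (hy : y ∈ Icc (0 : ℝ) (S.R k)) :
    y ∈ S.G.cell S.G.i0 := ⟨S.G.lo_i0.le.trans hy.1, hy.2.trans (min_le_right _ _)⟩

theorem L_mem {ω : Ω} {y : ℝ} (hy : y ∈ S.G.cell S.G.i0) :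
    S.L ω y ∈ Icc (Real.log S.κ) (Real.log (max S.κ S.A)) := by
  have := S.κ_pos
  exact ⟨Real.log_le_log this (le_max_left _ _), Real.log_le_log (this.trans_le (le_max_left _ _))
    (max_le_max le_rfl ((S.branch ω).deriv_le _ _ hy))⟩

variable (S) in
/-- A bound for the oscillation. -/
def bbMax : ℝ := Real.log (max S.κ S.A) - Real.log S.κ

theorem abs_L_sub_le {ω : Ω} {y : ℝ} (hy : y ∈ S.G.cell S.G.i0) :
    |S.L ω y - S.L ω 0| ≤ S.bbMax := by
  have h1 := L_mem (ω := ω) hy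
  have h2 := L_mem (ω := ω) S.G.zero_mem_cell_i0
  rw [bbMax, abs_le]
  constructor <;> linarith [h1.1, h1.2, h2.1, h2.2]

theorem bdd_bb (k : ℕ) (ω : Ω) : BddAbove (range fun n =>
    |S.L ω (TopologicalSpace.denseSeq (Icc (0 : ℝ) (S.R k)) n) - S.L ω 0|) := by
  refine ⟨S.bbMax, ?_⟩
  rintro _ ⟨n, rfl⟩
  exact abs_L_sub_le (mem_cell_of_mem_Icc_R (Subtype.coe_prop _))

theorem bb_le (k : ℕ) (ω : Ω) : S.bb k ω ≤ S.bbMax :=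
  ciSup_le fun _ => abs_L_sub_le (mem_cell_of_mem_Icc_R (Subtype.coe_prop _))

theorem bb_nonneg (k : ℕ) (ω : Ω) : 0 ≤ S.bb k ω := Real.iSup_nonneg fun _ => abs_nonneg _

theorem continuousOn_L (ω : Ω) : ContinuousOn (S.L ω) (S.G.cell S.G.i0) := by
  refine ContinuousOn.log (ContinuousOn.sup continuousOn_const ((S.branch ω).deriv_cont _).abs) fun y _ => ?_
  exact (S.κ_pos.trans_le (le_max_left _ _)).ne'

/-- The oscillation is a supremum over a dense sequence so as to be measurable in ω; continuity of
the derivative extends it to the whole interval. -/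
theorem abs_L_sub_le_bb {k : ℕ} {ω : Ω} {y : ℝ} (hy : y ∈ Icc (0 : ℝ) (S.R k)) :
    |S.L ω y - S.L ω 0| ≤ S.bb k ω := by
  have hc : Continuous fun z : Icc (0 : ℝ) (S.R k) => |S.L ω z - S.L ω 0| := by
    have := ((continuousOn_L (S := S) ω).mono fun z hz => mem_cell_of_mem_Icc_R (k := k) hz)
    exact ((continuousOn_iff_continuous_domRestrict.1 this).sub continuous_const).abs
  have hd := TopologicalSpace.denseRange_denseSeq (Icc (0 : ℝ) (S.R k))
  have hcl : IsClosed {z : Icc (0 : ℝ) (S.R k) | |S.L ω z - S.L ω 0| ≤ S.bb k ω} :=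
    isClosed_le hc continuous_const
  have := hd.induction_on (p := fun z => |S.L ω z - S.L ω 0| ≤ S.bb k ω) ⟨y, hy⟩ hcl
    fun n => le_ciSup (bdd_bb (S := S) k ω) n
  exact this

theorem tendsto_bb (ω : Ω) : Tendsto (fun k => S.bb k ω) atTop (𝓝 0) := by
  rw [Metric.tendsto_atTop]
  intro ε hε
  obtain ⟨δ, hδ, hδ'⟩ := Metric.continuousWithinAt_iff.1
    (continuousOn_L (S := S) ω 0 S.G.zero_mem_cell_i0) (ε / 2) (half_pos hε)
  have hκ := S.one_lt_κ
  have hlim : Tendsto (fun k : ℕ => (S.κ ^ (k + 1))⁻¹) atTop (𝓝 0) :=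
    tendsto_inv_atTop_zero.comp ((tendsto_pow_atTop_atTop_of_one_lt hκ).comp
      (tendsto_add_atTop_nat 1))
  obtain ⟨N, hN⟩ := eventually_atTop.1 (hlim.eventually_lt_const hδ)
  refine ⟨N, fun k hk => ?_⟩
  rw [Real.dist_eq, sub_zero, abs_of_nonneg (bb_nonneg k ω)]
  refine lt_of_le_of_lt (ciSup_le fun n => ?_) (half_lt_self hε)
  set y := TopologicalSpace.denseSeq (Icc (0 : ℝ) (S.R k)) n
  have h1 := y.2
  refine (hδ' (mem_cell_of_mem_Icc_R h1) ?_).le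
  rw [Real.dist_eq, sub_zero, abs_of_nonneg h1.1]
  exact (h1.2.trans (min_le_left _ _)).trans_lt (hN k hk)

theorem abs_log_d_sub_le (k : ℕ) (ω : Ω) {y : ℝ} (hy : y ∈ S.ccyl (S.rep (k + 2)) ω) :
    |Real.log (|S.d ω S.G.i0 y|) - Real.log (|S.d ω S.G.i0 0|)| ≤ S.bb k ω := by
  have h1 : y ∈ Icc (0 : ℝ) (S.R k) := by
    refine ⟨(S.G.cell_subset _ hy.1).1, le_min ?_ hy.1.2⟩
    have h2 := pow_mul_le_one (k := k + 1) hy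
    rw [← one_div, le_div_iff₀ (pow_pos S.κ_pos _), mul_comm]
    exact h2
  have h2 := abs_L_sub_le_bb (ω := ω) h1
  rwa [L, L, max_eq_right ((S.branch ω).expand_zero y hy.1 hy.2.1),
    max_eq_right (S.κ_le_d_zero ω)] at h2

theorem Λ_pos_of_pos {lam : Ω → ℝ} (hpos : ∀ ω, 0 < lam ω) (n : ℕ) (ω : Ω) :
    0 < S.Λ lam n ω := by
  unfold Λ cocycle
  exact Finset.prod_pos fun k _ => hpos _

variable (S) in
/-- The logarithm of `lam` compared with the derivative at the fixed point. -/
def zet (lam : Ω → ℝ) (ω : Ω) : ℝ := Real.log (lam ω) + S.β * Real.log |S.d ω S.G.i0 0|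

theorem log_Λ {lam : Ω → ℝ} (hpos : ∀ ω, 0 < lam ω) (n : ℕ) (ω : Ω) :
    Real.log (S.Λ lam n ω) = birkhoffSum S.θ (fun ω => Real.log (lam ω)) n ω := by
  rw [Λ, cocycle, Real.log_prod fun k _ => (hpos _).ne']; rfl

theorem log_P_mul_Λ {lam : Ω → ℝ} (hpos : ∀ ω, 0 < lam ω) (n : ℕ) (ω : Ω) :
    Real.log (S.P n ω * S.Λ lam n ω) = birkhoffSum S.θ (S.zet lam) n ω := by
  have hp : ∀ ω, 0 < |S.d ω S.G.i0 0| := fun ω => S.κ_pos.trans_le (S.κ_le_d_zero ω)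
  have hΛ : 0 < S.Λ lam n ω := Λ_pos_of_pos hpos _ _
  rw [Real.log_mul (S.P_pos n ω).ne' hΛ.ne', P,
    Real.log_prod fun k _ => (Real.rpow_pos_of_pos (hp _) _).ne', Λ, cocycle,
    Real.log_prod fun k _ => (hpos _).ne', ← Finset.sum_add_distrib]
  refine Finset.sum_congr rfl fun k _ => ?_
  rw [zet, Real.log_rpow (hp _), add_comm]

variable [MeasurableSpace Ω] {m : Measure Ω}

theorem measurable_bb (hd : ∀ x ∈ S.G.cell S.G.i0, Measurable fun ω => S.d ω S.G.i0 x) (k : ℕ) :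
    Measurable (S.bb k) := by
  have hL : ∀ x ∈ S.G.cell S.G.i0, Measurable fun ω => S.L ω x := fun x hx =>
    (measurable_const.max (continuous_abs.measurable.comp (hd x hx))).log
  exact Measurable.iSup fun n => continuous_abs.measurable.comp
    ((hL _ (mem_cell_of_mem_Icc_R (Subtype.coe_prop _))).sub (hL _ S.G.zero_mem_cell_i0))

namespace AEConf
variable {ν : Ω → Measure ℝ} {lam : Ω → ℝ} (h : S.AEConf m ν lam)
include h

theorem measurable_zet (hd : ∀ x ∈ S.G.cell S.G.i0, Measurable fun ω => S.d ω S.G.i0 x) :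
    Measurable (S.zet lam) :=
  h.measurable.log.add (measurable_const.mul
    (continuous_abs.measurable.comp (hd 0 S.G.zero_mem_cell_i0)).log)

theorem exists_abs_log_le [Finite ι] : ∃ C, ∀ᵐ ω ∂m, |Real.log (lam ω)| ≤ C := by
  refine ⟨max (S.t * Real.log S.A) (Real.log S.M), ?_⟩
  filter_upwards [h.conf] with ω hω
  have h1 : 1 ≤ lam ω * S.A ^ S.t := hω.one_le_lam 0
  have h2 : lam ω ≤ S.M := hω.lam_le 0
  have hA := S.A_pos
  have h3 := Real.log_nonneg h1
  rw [Real.log_mul (h.pos ω).ne' (by positivity), Real.log_rpow hA] at h3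
  have h4 := Real.log_le_log (h.pos ω) h2
  rw [abs_le']
  exact ⟨h4.trans (le_max_right _ _), le_max_of_le_left (by linarith)⟩

theorem integrable_log [Finite ι] [IsFiniteMeasure m] :
    Integrable (fun ω => Real.log (lam ω)) m :=
  let ⟨C, hC⟩ := h.exists_abs_log_le
  Integrable.of_bound h.measurable.log.aestronglyMeasurable C hC

theorem exists_abs_zet_le [Finite ι] : ∃ C, ∀ᵐ ω ∂m, |S.zet lam ω| ≤ C := by
  obtain ⟨C, hC⟩ := h.exists_abs_log_le
  refine ⟨C + S.β * Real.log S.A, ?_⟩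
  filter_upwards [hC] with ω hω
  have h1 : 0 ≤ Real.log |S.d ω S.G.i0 0| :=
    Real.log_nonneg (S.one_lt_κ.le.trans (S.κ_le_d_zero ω))
  have h2 := Real.log_le_log (S.κ_pos.trans_le (S.κ_le_d_zero ω)) (S.d_zero_le ω)
  have hβ := S.β_pos
  refine (abs_add_le _ _).trans (add_le_add hω ?_)
  rw [abs_of_nonneg (by positivity)]
  gcongr

/-- The logarithm of `one_le_exp_osc` is integrated and divided by n. By invariance the oscillation
contributes the Cesàro mean of the integrals of `bb k`, which tend to 0 because the derivative is
continuous at 0. -/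
theorem integral_zet_nonneg [Finite ι] [IsProbabilityMeasure m] (hθ : MeasurePreserving S.θ m m)
    (hd : ∀ x ∈ S.G.cell S.G.i0, Measurable fun ω => S.d ω S.G.i0 x) :
    0 ≤ ∫ ω, S.zet lam ω ∂m := by
  obtain ⟨C, hC⟩ := h.exists_abs_zet_le
  have hmeas := h.measurable_zet hd
  have hint : Integrable (S.zet lam) m := Integrable.of_bound hmeas.aestronglyMeasurable C hC
  have hbi : ∀ k, Integrable (S.bb k) m := fun k =>
    Integrable.of_bound (measurable_bb hd k).aestronglyMeasurable S.bbMax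
      (Eventually.of_forall fun ω => by
        rw [Real.norm_of_nonneg (bb_nonneg k ω)]; exact bb_le k ω)
  have hcomp : ∀ (g : Ω → ℝ) (n : ℕ), Measurable g →
      ∫ ω, g (S.θ^[n] ω) ∂m = ∫ ω, g ω ∂m := fun g n hg => by
    have := integral_map (hθ.iterate n).measurable.aemeasurable (μ := m) (f := g)
      hg.aestronglyMeasurable
    rw [(hθ.iterate n).map_eq] at this
    exact this.symm
  have hosc : ∀ n, Integrable (S.osc S.bb n) m ∧
      ∫ ω, S.osc S.bb n ω ∂m = ∑ k ∈ Finset.range n, ∫ ω, S.bb k ω ∂m := fun n => by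
    have h1 : ∀ l ∈ Finset.range n, Integrable (fun ω => S.bb (n - (l + 1)) (S.θ^[l] ω)) m :=
      fun l _ => (hθ.iterate l).integrable_comp_of_integrable (hbi _)
    refine ⟨integrable_finsetSum _ h1, ?_⟩
    unfold osc
    rw [integral_finsetSum _ h1, ← Finset.sum_range_reflect (fun k => ∫ ω, S.bb k ω ∂m)]
    refine Finset.sum_congr rfl fun l _ => ?_
    rw [hcomp _ _ (measurable_bb hd _), Nat.sub_sub, add_comm 1 l]
  have hbir : ∀ n : ℕ, Integrable (fun ω => birkhoffSum S.θ (S.zet lam) n ω) m ∧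
      ∫ ω, birkhoffSum S.θ (S.zet lam) n ω ∂m = n * ∫ ω, S.zet lam ω ∂m := fun n => by
    have h1 : ∀ l ∈ Finset.range n, Integrable (fun ω => S.zet lam (S.θ^[l] ω)) m :=
      fun l _ => (hθ.iterate l).integrable_comp_of_integrable hint
    refine ⟨integrable_finsetSum _ h1, ?_⟩
    unfold birkhoffSum
    rw [integral_finsetSum _ h1, Finset.sum_congr rfl fun l _ => hcomp _ l hmeas]
    simp
  have hk : ∀ n : ℕ, 0 ≤ Real.log S.CE + n * ∫ ω, S.zet lam ω ∂m +
      (S.t + S.a) * ∑ k ∈ Finset.range n, ∫ ω, S.bb k ω ∂m := fun n => by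
    rw [← (hosc n).2, ← (hbir n).2, ← integral_const_mul]
    have e1 : ∫ _, Real.log S.CE ∂m = Real.log S.CE := by simp
    have e2 : Integrable (fun ω => Real.log S.CE + birkhoffSum S.θ (S.zet lam) n ω) m :=
      (integrable_const _).add (hbir n).1
    rw [← e1, ← integral_add (integrable_const _) (hbir n).1,
      ← integral_add e2 ((hosc n).1.const_mul _)]
    refine integral_nonneg_of_ae ?_
    filter_upwards [h.conf] with ω hω
    have h1 := hω.one_le_exp_osc (bb := fun k l => S.bb k (S.θ^[l] ω))
      (fun k l y hy => by
        rw [orbit_ccyl] at hy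
        exact abs_log_d_sub_le (S := S) k _ hy) n 0
    rw [orbit_P, orbit_Λ, orbit_osc] at h1
    change 1 ≤ S.CE * (S.P n ω * S.Λ lam n ω * Real.exp ((S.t + S.a) * S.osc S.bb n ω)) at h1
    have hΛ : 0 < S.Λ lam n ω := Λ_pos_of_pos h.pos _ _
    have hP := S.P_pos n ω
    have hCE : 0 < S.CE := hω.CE_pos 0
    have h2 := Real.log_nonneg h1
    rw [Real.log_mul hCE.ne' (by positivity), Real.log_mul (by positivity) (by positivity),
      Real.log_exp, log_P_mul_Λ h.pos] at h2
    simp only [Pi.zero_apply]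
    linarith
  have hb0 : Tendsto (fun k => ∫ ω, S.bb k ω ∂m) atTop (𝓝 0) := by
    rw [← integral_zero Ω ℝ (μ := m)]
    exact tendsto_integral_of_dominated_convergence (fun _ => S.bbMax)
      (fun k => (hbi k).aestronglyMeasurable) (integrable_const _)
      (fun k => Eventually.of_forall fun ω => by
        rw [Real.norm_of_nonneg (bb_nonneg k ω)]; exact bb_le k ω)
      (Eventually.of_forall fun ω => tendsto_bb ω)
  have hces := (hb0.cesaro.const_mul (S.t + S.a)).add
    (tendsto_inv_atTop_nhds_zero_nat (𝕜 := ℝ) |>.mul_const (Real.log S.CE))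
  have hces' := hces.add_const (∫ ω, S.zet lam ω ∂m)
  simp only [mul_zero, zero_mul, zero_add] at hces'
  refine ge_of_tendsto hces' ?_
  filter_upwards [eventually_ge_atTop 1] with n hn
  have hn0 : (0 : ℝ) < n := by exact_mod_cast hn
  have := mul_nonneg (inv_nonneg.2 hn0.le) (hk n)
  refine this.trans (le_of_eq ?_)
  field_simp
  ring

/-- Conformal families are absolutely continuous with respect to each other. -/
theorem ae_absolutelyContinuous [Finite ι] [IsProbabilityMeasure m] {ν₂ : Ω → Measure ℝ}
    {lam₂ : Ω → ℝ} (h₂ : S.AEConf m ν₂ lam₂) (hθ : Ergodic S.θ m)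
    (hd : ∀ x ∈ S.G.cell S.G.i0, Measurable fun ω => S.d ω S.G.i0 x) :
    ∀ᵐ ω ∂m, ν ω ≪ ν₂ ω := by
  have hmp := hθ.toMeasurePreserving
  obtain ⟨C, hC⟩ := h.exists_abs_zet_le
  have hmeas := h.measurable_zet hd
  set Z := {ω | Tendsto (fun n => birkhoffSum S.θ (S.zet lam) n ω) atTop atBot} with hZ
  have hZm : MeasurableSet Z := measurableSet_tendsto _ fun n =>
    Finset.measurable_sum _ fun k _ => hmeas.comp (hmp.measurable.iterate k)
  have hZi : S.θ ⁻¹' Z = Z := by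
    ext ω
    simp only [hZ, mem_preimage, mem_ofPred_eq]
    rw [← tendsto_add_atTop_iff_nat (f := fun n => birkhoffSum S.θ (S.zet lam) n ω) 1]
    simp only [birkhoffSum_succ']
    constructor
    · exact fun hlim => tendsto_atBot_add_const_left _ _ hlim
    · intro hlim
      have := tendsto_atBot_add_const_left _ (-(S.zet lam ω)) hlim
      simpa using this
  -- The divergence event is invariant, hence of probability 0 or 1, and a nonnegative mean excludes
  -- 1.
  have hZ0 : m Z = 0 := by
    refine (hθ.toPreErgodic.prob_eq_zero_or_one hZm hZi).resolve_right fun h1 => ?_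
    refine not_ae_tendsto_birkhoffSum_atBot hmp hmeas hC (h.integral_zet_nonneg hmp hd) ?_
    exact (mem_ae_iff_prob_eq_one hZm).2 h1
  filter_upwards [h.conf, h₂.conf, measure_eq_zero_iff_ae_notMem.1 hZ0] with ω h1 h2 h3
  by_contra hne
  apply h3
  have h4 := h1.tendsto_of_not_absolutelyContinuous h2 (ω := 0) hne
  simp only [orbit_P, orbit_Λ] at h4
  have h5 : Tendsto (fun n => S.P n ω * S.Λ lam n ω) atTop (𝓝[>] 0) :=
    tendsto_nhdsWithin_iff.2 ⟨h4, Eventually.of_forall fun n =>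
      mul_pos (S.P_pos n ω) (Λ_pos_of_pos h.pos _ _)⟩
  have h6 := Real.tendsto_log_nhdsGT_zero.comp h5
  exact h6.congr fun n => log_P_mul_Λ h.pos n ω

theorem ae_exists_subseq_tendsto [Finite ι] [IsProbabilityMeasure m] {ν₂ : Ω → Measure ℝ}
    {lam₂ : Ω → ℝ} (h₂ : S.AEConf m ν₂ lam₂) (hθ : Ergodic S.θ m)
    (hd : ∀ x ∈ S.G.cell S.G.i0, Measurable fun ω => S.d ω S.G.i0 x) :
    ∀ᵐ ω ∂m, ∃ n : ℕ → ℕ, StrictMono n ∧ ∃ L : ℝ, 0 < L ∧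
      Tendsto (fun k => S.Λ lam (n k) ω / S.Λ lam₂ (n k) ω) atTop (𝓝 L) := by
  filter_upwards [h.conf, h₂.conf, h.ae_absolutelyContinuous h₂ hθ hd] with ω h1 h2 h3
  have := h1.exists_subseq_tendsto h2 (ω := 0) h3
  simpa only [orbit_Λ] using this

/-- Along the subsequence the log-ratios stay bounded while n ε → ∞, so log λ₂ − log λ + ε has some
nonnegative Birkhoff sum almost everywhere, and the maximal inequality applies. -/
theorem integral_log_le [Finite ι] [IsProbabilityMeasure m] {ν₂ : Ω → Measure ℝ}
    {lam₂ : Ω → ℝ} (h₂ : S.AEConf m ν₂ lam₂) (hθ : Ergodic S.θ m)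
    (hd : ∀ x ∈ S.G.cell S.G.i0, Measurable fun ω => S.d ω S.G.i0 x) :
    ∫ ω, Real.log (lam ω) ∂m ≤ ∫ ω, Real.log (lam₂ ω) ∂m := by
  have i1 := h.integrable_log
  have i2 := h₂.integrable_log
  refine le_of_forall_pos_le_add fun ε hε => ?_
  set ζ : Ω → ℝ := fun ω => Real.log (lam₂ ω) - Real.log (lam ω) + ε with hζ
  have hζm : Measurable ζ := (h₂.measurable.log.sub h.measurable.log).add_const _
  have hζi : Integrable ζ m := (i2.sub i1).add (integrable_const ε)
  have key : 0 ≤ ∫ ω, ζ ω ∂m := by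
    refine integral_nonneg_of_exists_birkhoffSum hθ.toMeasurePreserving hζm hζi ?_
    filter_upwards [h.ae_exists_subseq_tendsto h₂ hθ hd] with ω hω
    obtain ⟨n, hn, L, hL, hlim⟩ := hω
    have h1 := (Real.continuousAt_log hL.ne').tendsto.comp hlim
    have h2 : Tendsto (fun k => (n k : ℝ) * ε) atTop atTop :=
      (tendsto_natCast_atTop_atTop.comp hn.tendsto_atTop).atTop_mul_const hε
    obtain ⟨k, h3, h4, h5⟩ := ((h1.eventually_lt_const (lt_add_one _)).and
      ((h2.eventually_ge_atTop (Real.log L + 1)).and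
        (hn.tendsto_atTop.eventually_ge_atTop 1))).exists
    refine ⟨n k, h5, ?_⟩
    have p1 : 0 < S.Λ lam (n k) ω := Λ_pos_of_pos h.pos _ _
    have p2 : 0 < S.Λ lam₂ (n k) ω := Λ_pos_of_pos h₂.pos _ _
    rw [Function.comp_apply, Real.log_div p1.ne' p2.ne', log_Λ h.pos, log_Λ h₂.pos] at h3
    have h6 : birkhoffSum S.θ ζ (n k) ω = birkhoffSum S.θ (fun ω => Real.log (lam₂ ω)) (n k) ω -
        birkhoffSum S.θ (fun ω => Real.log (lam ω)) (n k) ω + n k * ε := by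
      simp [birkhoffSum, hζ, Finset.sum_add_distrib, Finset.sum_sub_distrib]
    linarith
  have e1 : ∫ ω, ζ ω ∂m = ∫ ω, Real.log (lam₂ ω) ∂m - ∫ ω, Real.log (lam ω) ∂m + ε := by
    have e2 : Integrable (fun ω => Real.log (lam₂ ω) - Real.log (lam ω)) m := i2.sub i1
    rw [hζ, integral_add e2 (integrable_const ε), integral_sub i2 i1]
    simp
  linarith

end AEConf
end System

/-! ### From random maps to systems: regular points have full measure -/

theorem iter_congr {Ω : Type*} {θ : Ω → Ω} {T T' : Ω → ℝ → ℝ} {X : Set ℝ}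
    (h : ∀ ω, EqOn (T ω) (T' ω) X) {ω : Ω} {x : ℝ} (hx : ∀ n, iter θ T n ω x ∈ X) (n : ℕ) :
    iter θ T n ω x = iter θ T' n ω x := by
  induction n with
  | zero => rfl
  | succ n ih => rw [iter_succ', iter_succ', h _ (hx n), ih]

/-- The derivative at a fixed point of a cell depends measurably on the map. -/
theorem IsRandomMap.measurable_D {ι Ω : Type*} [MeasurableSpace Ω] {G : IntervalFamily ι} {κ A : ℝ}
    {T : Ω → ℝ → ℝ} (h : IsRandomMap G T κ A) {i : ι} {x : ℝ} (hx : x ∈ G.cell i) :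
    Measurable fun ω => G.D (T ω) i x := by
  have : (𝓝[G.cell i \ {x}] x).NeBot := by
    rw [← accPt_principal_iff_nhdsWithin, ← uniqueDiffWithinAt_iff_accPt]
    exact G.uniqueDiffOn_cell i x hx
  -- One sequence serves for all ω, so the derivative is a limit of measurable difference quotients.
  obtain ⟨u, hu⟩ := exists_seq_tendsto (𝓝[G.cell i \ {x}] x)
  obtain ⟨N, hN⟩ := eventually_atTop.1 (hu.eventually self_mem_nhdsWithin)
  have hm : ∀ y ∈ G.cell i, Measurable fun ω => T ω y := fun y hy =>
    h.measurable y (mem_iUnion.2 ⟨i, hy⟩)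
  refine measurable_of_tendsto_metrizable (f := fun n ω => slope (T ω) x (u (n + N))) (fun n => ?_)
    (tendsto_pi_nhds.2 fun ω => ?_)
  · simp only [slope_def_field]
    exact ((hm _ (hN _ (Nat.le_add_left _ _)).1).sub (hm x hx)).div_const _
  · exact (hasDerivWithinAt_iff_tendsto_slope.1 ((h.isMap ω).hasDerivWithinAt i hx)).comp
      ((tendsto_add_atTop_iff_nat N).2 hu)

theorem IntervalFamily.isClosed_Istar {ι : Type*} [Finite ι] (G : IntervalFamily ι) :
    IsClosed G.Istar := isClosed_iUnion_of_finite fun _ => isClosed_Icc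

namespace System
variable {ι Ω : Type*} {S : System ι Ω}

theorem T_endpoint {ω : Ω} {i : ι} {x : ℝ} (hx : x ∈ S.G.cell i) (hx' : x ∉ S.ocell i) :
    S.T ω x = 0 ∨ S.T ω x = 1 := by
  have hlo : S.G.lo i ∈ S.G.cell i := left_mem_Icc.2 (S.G.lo_lt_hi i).le
  have hhi : S.G.hi i ∈ S.G.cell i := right_mem_Icc.2 (S.G.lo_lt_hi i).le
  have hu := S.T_mem_unit (ω := ω) hx
  obtain ⟨z, hz, hz0⟩ := ((S.branch ω).bijOn i).surjOn (left_mem_Icc.2 zero_le_one)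
  obtain ⟨y, hy, hy1⟩ := ((S.branch ω).bijOn i).surjOn (right_mem_Icc.2 zero_le_one)
  have hend : x = S.G.lo i ∨ x = S.G.hi i := by
    by_contra! hcon
    exact hx' ⟨lt_of_le_of_ne hx.1 hcon.1.symm, lt_of_le_of_ne hx.2 hcon.2⟩
  rcases S.strict ω i with hs | hs <;> rcases hend with rfl | rfl
  · exact Or.inl (le_antisymm (hz0 ▸ hs.monotoneOn hlo hz hz.1) hu.1)
  · exact Or.inr (le_antisymm hu.2 (hy1 ▸ hs.monotoneOn hy hhi hy.2))
  · exact Or.inr (le_antisymm hu.2 (hy1 ▸ hs.antitoneOn hlo hy hy.1))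
  · exact Or.inl (le_antisymm (hz0 ▸ hs.antitoneOn hz hhi hz.2) hu.1)

theorem exists_mem_ocell {ω : Ω} (i : ι) {y : ℝ} (hy : y ∈ Ioo (0 : ℝ) 1) :
    ∃ x ∈ S.ocell i, S.T ω x = y := by
  obtain ⟨x, hx, hxy⟩ := ((S.branch ω).bijOn i).surjOn (Ioo_subset_Icc_self hy)
  refine ⟨x, ?_, hxy⟩
  by_contra hcon
  rcases T_endpoint hx hcon with h | h
  · rw [hxy] at h; exact hy.1.ne' h
  · rw [hxy] at h; exact hy.2.ne h

variable (S) in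
/-- The points whose orbit stays in the closed cells. -/
def jul (ω : Ω) : Set ℝ := {x | ∀ n, S.it n ω x ∈ S.G.Istar}

theorem mem_jul_iff {ω : Ω} {x : ℝ} :
    x ∈ S.jul ω ↔ x ∈ S.G.Istar ∧ S.T ω x ∈ S.jul (S.θ ω) :=
  ⟨fun h => ⟨h 0, fun n => h (n + 1)⟩, fun h n => by
    cases n with
    | zero => exact h.1
    | succ n => exact h.2 n⟩

theorem measurableSet_jul [Finite ι] (ω : Ω) : MeasurableSet (S.jul ω) := by
  have : S.jul ω = ⋂ n, S.it n ω ⁻¹' S.G.Istar := by ext; simp [jul]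
  rw [this]
  exact MeasurableSet.iInter fun n => S.measurable_it n ω S.G.isClosed_Istar.measurableSet

theorem reg_subset_jul (ω : Ω) : S.reg ω ⊆ S.jul ω := fun _ hx n =>
  let ⟨i, hi⟩ := hx n
  mem_iUnion.2 ⟨i, S.ocell_subset i hi⟩

theorem zero_mem_jul (ω : Ω) : (0 : ℝ) ∈ S.jul ω := by
  have : ∀ n ω, S.it n ω 0 = 0 := fun n => by
    induction n with
    | zero => exact fun _ => rfl
    | succ n ih => intro ω; rw [it_succ, (S.branch ω).map_zero, ih]
  intro n
  rw [this]
  exact mem_iUnion.2 ⟨_, S.G.zero_mem_cell_i0⟩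

theorem one_mem_jul (ω : Ω) : (1 : ℝ) ∈ S.jul ω :=
  mem_jul_iff.2 ⟨mem_iUnion.2 ⟨_, S.G.one_mem_cell_i1⟩, by
    rw [(S.branch ω).map_one]; exact zero_mem_jul _⟩

theorem orbit_it (ω : Ω) (k n : ℕ) (x : ℝ) :
    (S.orbit ω).it k n x = S.it k (S.θ^[n] ω) x := by
  induction k generalizing n x with
  | zero => rfl
  | succ k ih =>
    rw [it_succ, it_succ, show (S.orbit ω).θ n = n + 1 from rfl, ih, Function.iterate_succ_apply']
    rfl

theorem orbit_reg (ω : Ω) (n : ℕ) : (S.orbit ω).reg n = S.reg (S.θ^[n] ω) := by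
  ext x
  simp only [reg, orbit_it]
  rfl

/-- The system describes the random map `T` on the cells. -/
structure Realizes [MeasurableSpace Ω] (S : System ι Ω) (T : Ω → ℝ → ℝ) : Prop where
  isRandomMap : IsRandomMap S.G T S.κ S.A
  map_eq : ∀ ω, EqOn (S.T ω) (T ω) S.G.Istar
  deriv_eq : ∀ ω i, EqOn (S.d ω i) (S.G.D (T ω) i) (S.G.cell i)

/-- The conditions of conformality on one fibre. -/
structure FibreConf (S : System ι Ω) (T : Ω → ℝ → ℝ) (ν : Ω → Measure ℝ) (lam : Ω → ℝ)
    (ω : Ω) : Prop where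
  supported : ν ω (julia S.G S.θ T ω) = 1
  fconformal : FConformal (T ω) (julia S.G S.θ T ω)
    (fun x => ENNReal.ofReal (lam ω) * S.G.speed (T ω) x ^ S.t) (ν ω) (ν (S.θ ω))
  quasi : ∀ B, MeasurableSet B → ν (S.θ ω) B = 0 → ν ω (julia S.G S.θ T ω ∩ T ω ⁻¹' B) = 0

variable [MeasurableSpace Ω] {T : Ω → ℝ → ℝ}

namespace Realizes
variable (hR : S.Realizes T)
include hR

theorem iter_eq {ω : Ω} {x : ℝ} (hx : x ∈ S.jul ω) (n : ℕ) : iter S.θ T n ω x = S.it n ω x :=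
  (iter_congr hR.map_eq hx n).symm

theorem julia_eq (ω : Ω) : julia S.G S.θ T ω = S.jul ω := by
  ext x
  constructor
  · intro hx n
    rw [it, ← iter_congr (fun ω => (hR.map_eq ω).symm) hx n]
    exact hx n
  · intro hx n
    rw [hR.iter_eq hx]
    exact hx n

theorem speed_eq {ω : Ω} {i : ι} {x : ℝ} (hx : x ∈ S.ocell i) :
    S.G.speed (T ω) x = ENNReal.ofReal |S.d ω i x| := by
  rw [hR.deriv_eq ω i (S.ocell_subset i hx)]
  refine le_antisymm (iInf₂_le i (S.ocell_subset i hx)) (le_iInf₂ fun k hk => ?_)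
  have : k = i := by
    by_contra hne
    exact S.not_mem_cell (Ne.symm hne) hx hk
  rw [this]

theorem measurable_d_zero {x : ℝ} (hx : x ∈ S.G.cell S.G.i0) :
    Measurable fun ω => S.d ω S.G.i0 x := by
  simp only [fun ω => hR.deriv_eq ω S.G.i0 hx]
  exact hR.isRandomMap.measurable_D hx

theorem measurable_uncurry_T [Finite ι] (hS : ∀ ω, ∀ x ∉ S.G.Istar, S.T ω x = 0) :
    Measurable fun p : Ω × ℝ => S.T p.1 p.2 := by
  classical
  have h1 : Measurable (Function.uncurry fun (x : S.G.Istar) (ω : Ω) => T ω x) :=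
    measurable_uncurry_of_continuous_of_measurable
      (fun ω => continuousOn_iff_continuous_domRestrict.1 (hR.isRandomMap.isMap ω).continuousOn)
      fun x => hR.isRandomMap.measurable x x.2
  set s : Set (Ω × ℝ) := {p | p.2 ∈ S.G.Istar} with hs
  have hsm : MeasurableSet s := measurable_snd S.G.isClosed_Istar.measurableSet
  have h2 : Measurable fun p : s => T p.1.1 p.1.2 :=
    h1.comp (((measurable_snd.comp measurable_subtype_coe).subtype_mk (h := fun p => p.2)).prodMk
      (measurable_fst.comp measurable_subtype_coe))
  convert Measurable.dite h2 (measurable_const (a := (0 : ℝ))) hsm using 2 with p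
  split_ifs with hp
  · exact hR.map_eq _ hp
  · exact hS _ _ hp

theorem measurable_uncurry_it [Finite ι] (hθ : Measurable S.θ)
    (hS : ∀ ω, ∀ x ∉ S.G.Istar, S.T ω x = 0) (n : ℕ) :
    Measurable fun p : Ω × ℝ => S.it n p.1 p.2 := by
  induction n with
  | zero => exact measurable_snd
  | succ n ih =>
    exact ih.comp ((hθ.comp measurable_fst).prodMk (hR.measurable_uncurry_T hS))

theorem measurableSet_regGraph [Finite ι] (hθ : Measurable S.θ)
    (hS : ∀ ω, ∀ x ∉ S.G.Istar, S.T ω x = 0) : MeasurableSet {p : Ω × ℝ | p.2 ∈ S.reg p.1} := by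
  have : {p : Ω × ℝ | p.2 ∈ S.reg p.1} =
      ⋂ n, ⋃ i, (fun p : Ω × ℝ => S.it n p.1 p.2) ⁻¹' S.ocell i := by ext; simp [reg]
  rw [this]
  exact MeasurableSet.iInter fun n => MeasurableSet.iUnion fun i =>
    hR.measurable_uncurry_it hθ hS n measurableSet_Ioo

/-- Critical points lie on the boundary of their cells, and the cells have disjoint interiors, so a
regular orbit never meets them. -/
theorem regGraph_subset : {p : Ω × ℝ | p.2 ∈ S.reg p.1} ⊆
    juliaGraph S.G S.θ T \ critBackGraph S.G S.θ T := by
  rintro ⟨ω, x⟩ hx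
  have hx : x ∈ S.reg ω := hx
  have hj := reg_subset_jul _ hx
  refine ⟨by change x ∈ julia S.G S.θ T ω; rwa [hR.julia_eq], ?_⟩
  rintro ⟨-, n, i, hi, hn⟩
  obtain ⟨k, hk⟩ := hx n
  simp only at hn
  rw [hR.iter_eq hj] at hn
  rw [← hn] at hk
  rcases eq_or_ne k i with rfl | hne
  · rcases S.G.c_mem_boundary k hi with h | h
    · exact hk.1.ne' h
    · exact hk.2.ne h
  · exact S.not_mem_cell hne hk (IntervalFamily.c_mem_cell hi)

variable {ν : Ω → Measure ℝ} {lam : Ω → ℝ}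

/-- A critical point with critical value 0 exists, and the Jacobian vanishes there, so forward
conformality on this single point gives its image no mass. -/
theorem measure_zero_eq_zero {ω : Ω} (h : S.FibreConf T ν lam ω) : ν (S.θ ω) {0} = 0 := by
  obtain ⟨i, hi⟩ := S.G.critZero_nonempty
  have hic := S.G.critZero_subset hi
  have hm := hR.isRandomMap.isMap ω
  have hc := IntervalFamily.c_mem_cell hic
  have hcI : S.G.c i ∈ S.G.Istar := mem_iUnion.2 ⟨i, hc⟩
  have hc0 : T ω (S.G.c i) = 0 := hm.critValue_zero i hi
  have hsp : S.G.speed (T ω) (S.G.c i) = 0 := by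
    refine le_antisymm ((iInf₂_le i hc).trans ?_) zero_le
    rw [(hm.critical i hic _ hc).2 rfl]; simp
  have := (h.fconformal {S.G.c i} ⟨?_, measurableSet_singleton _, injOn_singleton _ _⟩).2
  · rw [image_singleton, hc0, lintegral_singleton, hsp, ENNReal.zero_rpow_of_pos S.t_pos] at this
    simpa using this
  · rw [singleton_subset_iff, hR.julia_eq, mem_jul_iff, hR.map_eq ω hcI, hc0]
    exact ⟨hcI, zero_mem_jul _⟩

theorem measure_preimage_eq_zero {ω : Ω} (h : S.FibreConf T ν lam ω) {B : Set ℝ}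
    (hB : MeasurableSet B) (h0 : ν (S.θ ω) B = 0) : ν ω (S.jul ω ∩ S.T ω ⁻¹' B) = 0 := by
  have := h.quasi B hB h0
  rw [hR.julia_eq] at this
  refine measure_mono_null ?_ this
  intro x hx
  refine ⟨hx.1, ?_⟩
  have h1 := hR.map_eq ω (hx.1 0)
  rw [it_zero] at h1
  rw [mem_preimage, ← h1]
  exact hx.2

/-- Both ends are mapped to 0, so quasi-invariance reduces the claim to the point 0 of the next
fibre. -/
theorem measure_ends_eq_zero {ω : Ω} (h : S.FibreConf T ν lam ω) : ν ω {0, 1} = 0 := by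
  have h2 := hR.measure_preimage_eq_zero h (measurableSet_singleton 0) (hR.measure_zero_eq_zero h)
  refine measure_mono_null (fun x hx => ?_) h2
  simp only [mem_insert_iff, mem_singleton_iff] at hx
  rcases hx with rfl | rfl
  · exact ⟨zero_mem_jul _, (S.branch ω).map_zero⟩
  · exact ⟨one_mem_jul _, (S.branch ω).map_one⟩

/-- A point of the Julia set that is not regular meets the boundary of a cell and is mapped to 0 or
1 one step later; these countably many events are null by iterated quasi-invariance. -/
theorem measure_compl_reg [Finite ι] {ω : Ω} (hp : ∀ ω, IsProbabilityMeasure (ν ω))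
    (h : ∀ n, S.FibreConf T ν lam (S.θ^[n] ω)) : ν ω (S.reg ω)ᶜ = 0 := by
  have := hp ω
  have h1 : ∀ n ω, (∀ n, S.FibreConf T ν lam (S.θ^[n] ω)) →
      ν ω (S.jul ω ∩ S.it n ω ⁻¹' {0, 1}) = 0 := by
    intro n
    induction n with
    | zero =>
      intro ω h
      exact measure_mono_null inter_subset_right (hR.measure_ends_eq_zero (h 0))
    | succ n ih =>
      intro ω h
      have h2 := hR.measure_preimage_eq_zero (h 0) ((measurableSet_jul _).inter
        (S.measurable_it n (S.θ ω) (toFinite {0, 1}).measurableSet))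
        (ih (S.θ ω) fun n => h (n + 1))
      refine measure_mono_null ?_ h2
      exact fun x hx => ⟨hx.1, (mem_jul_iff.1 hx.1).2, hx.2⟩
  have h2 : ν ω (S.jul ω)ᶜ = 0 := by
    rw [prob_compl_eq_zero_iff (measurableSet_jul ω), ← hR.julia_eq]
    exact (h 0).supported
  have h3 := measure_union_null h2 (measure_iUnion_null fun n => h1 (n + 1) ω h)
  refine measure_mono_null (fun x hx => ?_) h3
  by_cases hj : x ∈ S.jul ω
  swap
  · exact Or.inl hj
  have : ∃ n, ∀ i, S.it n ω x ∉ S.ocell i := by simpa [reg] using hx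
  obtain ⟨n, hn⟩ := this
  obtain ⟨i, hi⟩ := mem_iUnion.1 (hj n)
  refine Or.inr (mem_iUnion.2 ⟨n, hj, ?_⟩)
  rw [mem_preimage, it_succ']
  exact T_endpoint hi (hn i)

/-- Forward conformality on the part of the Julia set in one open cell identifies the next fibre
measure with the push-forward of a density. Each cell already yields the whole measure, because
every branch covers all regular points. -/
theorem lintegral_eq [Finite ι] {ω : Ω} (hp : ∀ ω, IsProbabilityMeasure (ν ω))
    (hl : 0 < lam ω) (h : S.FibreConf T ν lam ω) (hreg : ν (S.θ ω) (S.reg (S.θ ω))ᶜ = 0) (i : ι)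
    {φ : ℝ → ENNReal} (hφ : Measurable φ) : ∫⁻ y, φ y ∂ν (S.θ ω) =
      ∫⁻ x in S.ocell i, φ (S.T ω x) * ENNReal.ofReal (lam ω * |S.d ω i x| ^ S.t) ∂ν ω := by
  have hT := S.measurable_T ω
  set ψ : ℝ → ENNReal := fun x => ENNReal.ofReal (lam ω * |S.d ω i x| ^ S.t) with hψ
  have hψm : Measurable ψ := (measurable_const.mul
    ((continuous_abs.measurable.comp (S.measurable_d ω i)).pow_const _)).ennreal_ofReal
  have hκ : ν (S.θ ω) = (((ν ω).restrict (S.ocell i)).withDensity ψ).map (S.T ω) := by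
    ext V hV
    have hpre : MeasurableSet (S.T ω ⁻¹' V) := hT hV
    rw [Measure.map_apply hT hV, withDensity_apply _ hpre, Measure.restrict_restrict hpre]
    set A := S.jul ω ∩ (S.T ω ⁻¹' V ∩ S.ocell i) with hA
    have hsub : A ⊆ S.G.Istar := fun x hx => hx.1 0
    have hspec : IsSpecial (T ω) (julia S.G S.θ T ω) A := by
      refine ⟨by rw [hR.julia_eq]; exact inter_subset_left,
        (measurableSet_jul ω).inter (hpre.inter measurableSet_Ioo), ?_⟩
      exact ((hR.isRandomMap.isMap ω).injOn i).mono fun x hx => S.ocell_subset i hx.2.2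
    have h1 := (h.fconformal A hspec).2
    have h2 : T ω '' A = S.T ω '' A := ((hR.map_eq ω).mono hsub).image_eq.symm
    have h3 : ν (S.θ ω) (T ω '' A) = ν (S.θ ω) V := by
      rw [h2]
      refine le_antisymm (measure_mono (image_subset_iff.2 fun x hx => hx.2.1)) ?_
      have h6 : ν (S.θ ω) (V \ S.reg (S.θ ω)) = 0 := measure_mono_null (fun x hx => hx.2) hreg
      rw [← measure_inter_add_sdiff V (S.measurableSet_reg (S.θ ω)), h6, add_zero]
      refine measure_mono fun y hy => ?_
      obtain ⟨x, hx, rfl⟩ := exists_mem_ocell (S := S) (ω := ω) i (S.reg_subset_unit _ hy.2)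
      exact ⟨x, ⟨mem_jul_iff.2 ⟨mem_iUnion.2 ⟨i, S.ocell_subset i hx⟩, reg_subset_jul _ hy.2⟩,
        hy.1, hx⟩, rfl⟩
    rw [← h3, h1]
    have := hp ω
    have h4 : ν ω (S.jul ω)ᶜ = 0 := by
      rw [prob_compl_eq_zero_iff (measurableSet_jul ω), ← hR.julia_eq]
      exact h.supported
    have h5 : (ν ω).restrict A = (ν ω).restrict (S.T ω ⁻¹' V ∩ S.ocell i) := by
      refine Measure.restrict_congr_set ?_
      have h7 : ∀ᵐ x ∂ν ω, x ∈ S.jul ω := mem_ae_iff.2 h4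
      filter_upwards [h7] with x hx
      exact propext ⟨fun hA => hA.2, fun hB => ⟨hx, hB⟩⟩
    rw [h5]
    refine setLIntegral_congr_fun (hpre.inter measurableSet_Ioo) fun x hx => ?_
    simp only [hR.speed_eq hx.2, hψ]
    rw [ENNReal.ofReal_rpow_of_nonneg (abs_nonneg _) S.t_pos.le, ENNReal.ofReal_mul hl.le]
  conv_lhs => rw [hκ]
  rw [lintegral_map hφ hT, lintegral_withDensity_eq_lintegral_mul _ hψm (g := fun x => φ (S.T ω x))
    (hφ.comp hT)]
  refine lintegral_congr fun x => ?_
  rw [Pi.mul_apply, mul_comm]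

theorem conf_orbit [Finite ι] {ω : Ω} (hp : ∀ ω, IsProbabilityMeasure (ν ω)) (hl : ∀ ω, 0 < lam ω)
    (h : ∀ n, S.FibreConf T ν lam (S.θ^[n] ω)) :
    (S.orbit ω).Conf (fun n => ν (S.θ^[n] ω)) (fun n => lam (S.θ^[n] ω)) := by
  have hreg : ∀ n, ν (S.θ^[n] ω) (S.reg (S.θ^[n] ω))ᶜ = 0 := fun n =>
    hR.measure_compl_reg hp fun k => by rw [← Function.iterate_add_apply]; exact h _
  refine ⟨fun _ => hp _, fun n => ?_, fun _ => hl _, fun n i φ hφ => ?_⟩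
  · rw [orbit_reg]; exact hreg n
  · have h1 := hreg (n + 1)
    rw [Function.iterate_succ_apply'] at h1
    have := hR.lintegral_eq hp (hl _) (h n) h1 i hφ
    rw [← Function.iterate_succ_apply' S.θ] at this
    exact this

end Realizes
end System

theorem BranchMap.congr {ι : Type*} {G : IntervalFamily ι} {κ A α c₀ C₁ ρ : ℝ} {j : ι}
    {f g : ℝ → ℝ} {d e : ι → ℝ → ℝ} (h : BranchMap G κ A α c₀ C₁ ρ j f d)
    (hf : ∀ i, EqOn g f (G.cell i)) (hd : ∀ i, EqOn (e i) (d i) (G.cell i)) :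
    BranchMap G κ A α c₀ C₁ ρ j g e where
  continuousOn i := (h.continuousOn i).congr (hf i)
  bijOn i := (h.bijOn i).congr (hf i).symm
  hasDeriv i x hx := by rw [hd i hx]; exact (h.hasDeriv i x hx).congr (hf i) (hf i hx)
  deriv_cont i := (h.deriv_cont i).congr (hd i)
  deriv_ne i x hx := by rw [hd i (Ioo_subset_Icc_self hx)]; exact h.deriv_ne i x hx
  deriv_le i x hx := by rw [hd i hx]; exact h.deriv_le i x hx
  koebe i := by
    intro x hx x' hx' q hq hb
    have := h.koebe i x hx x' hx' q hq hb
    rwa [hd i hx, hd i hx', hf i hx, hf i hx', hf i hq]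
  map_zero := by rw [hf _ G.zero_mem_cell_i0]; exact h.map_zero
  map_one := by rw [hf _ G.one_mem_cell_i1]; exact h.map_one
  expand_zero x hx := by rw [hf _ hx, hd _ hx]; exact h.expand_zero x hx
  expand_one x hx := by rw [hf _ hx, hd _ hx]; exact h.expand_one x hx
  deriv_lower i x hx := by rw [hf _ hx, hd _ hx]; exact h.deriv_lower i x hx
  launch := by
    refine h.launch.imp (fun h1 => ⟨h1.1, h1.2.1, fun x hx => ?_⟩) fun h1 x hx => ?_
    · rw [hf _ hx, hd _ hx]; exact h1.2.2 x hx
    · rw [hf _ hx, hd _ hx]; exact h1 x hx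

/-- A random map, extended by `0`, as a system. -/
theorem IsRandomMap.exists_system {ι Ω : Type*} [Finite ι] [MeasurableSpace Ω]
    {G : IntervalFamily ι} {κ A : ℝ} {T : Ω → ℝ → ℝ} (h : IsRandomMap G T κ A) (θ : Ω → Ω)
    {t : ℝ} (ht : 0 < t) : ∃ S : System ι Ω, S.G = G ∧ S.θ = θ ∧ S.t = t ∧ S.Realizes T ∧
      ∀ ω, ∀ x ∉ S.G.Istar, S.T ω x = 0 := by
  obtain ⟨α, hα, c₀, hc₀, C₁, hC₁, ρ, hρ, j, hb⟩ := h.exists_branchMap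
  obtain ⟨r, hr⟩ := pow_unbounded_of_one_lt ρ⁻¹ h.one_lt_κ
  have hI : ∀ i, G.cell i ⊆ G.Istar := fun i => subset_iUnion _ i
  have hTe : ∀ ω, EqOn (G.Istar.indicator (T ω)) (T ω) G.Istar := fun ω => eqOn_indicator
  have hde : ∀ ω i, EqOn ((G.cell i).indicator (G.D (T ω) i)) (G.D (T ω) i) (G.cell i) :=
    fun ω i => eqOn_indicator
  have hmeas : ∀ (s : Set ℝ) (f : ℝ → ℝ), MeasurableSet s → ContinuousOn f s →
      Measurable (s.indicator f) := fun s f hs hf => by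
    classical
    rw [← piecewise_eq_indicator]
    exact hf.measurable_piecewise continuousOn_const hs
  refine ⟨{
    G := G
    θ := θ
    T := fun ω => G.Istar.indicator (T ω)
    d := fun ω i => (G.cell i).indicator (G.D (T ω) i)
    κ := κ
    A := A
    α := α
    c₀ := c₀
    C₁ := C₁
    ρ := ρ
    t := t
    j := j
    r := r
    one_lt_κ := h.one_lt_κ
    one_lt_A := h.one_lt_A
    α_pos := hα.1
    α_lt_one := hα.2
    c₀_pos := hc₀
    C₁_pos := hC₁
    ρ_pos := hρ.1
    ρ_le := hρ.2
    t_pos := ht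
    depth := by
      have h2 := hρ.1
      have := mul_le_mul_of_nonneg_right hr.le h2.le
      rwa [inv_mul_cancel₀ h2.ne'] at this
    branch := fun ω => (hb ω).congr (fun i => (hTe ω).mono (hI i)) (hde ω)
    measurable_T := fun ω => hmeas _ _ G.isClosed_Istar.measurableSet (h.isMap ω).continuousOn
    measurable_d := fun ω i => hmeas _ _ measurableSet_Icc ((hb ω).deriv_cont i) },
    rfl, rfl, rfl, ⟨h, hTe, hde⟩, fun ω x hx => indicator_of_notMem hx _⟩

namespace IsConformal
variable {ι Ω : Type*} [Finite ι] [MeasurableSpace Ω] {S : System ι Ω} {T : Ω → ℝ → ℝ}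
  {m : Measure Ω} {ν : Kernel Ω ℝ} [IsMarkovKernel ν] {lam : Ω → ℝ}

omit [Finite ι] [IsMarkovKernel ν] in
theorem ae_fibreConf (h : IsConformal S.G S.θ T m S.t ν lam) (hθ : MeasurePreserving S.θ m m) :
    ∀ᵐ ω ∂m, ∀ n, S.FibreConf T ν lam (S.θ^[n] ω) := by
  have h1 : ∀ᵐ ω ∂m, S.FibreConf T ν lam ω := by
    filter_upwards [h.supported, h.fconformal, h.bconformal] with ω h1 h2 h3
    exact ⟨h1, h2, h3.1⟩
  exact ae_all_iff.2 fun n => (hθ.iterate n).quasiMeasurePreserving.ae h1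

theorem aeConf (h : IsConformal S.G S.θ T m S.t ν lam) (hR : S.Realizes T)
    (hθ : MeasurePreserving S.θ m m) : S.AEConf m (fun ω => ν ω) lam where
  measurable := h.measurable
  pos := h.pos
  conf := by
    filter_upwards [h.ae_fibreConf hθ] with ω hω
    exact hR.conf_orbit (fun _ => inferInstance) h.pos hω

theorem compProd_diff_eq_one [IsProbabilityMeasure m] (h : IsConformal S.G S.θ T m S.t ν lam)
    (hR : S.Realizes T) (hθ : MeasurePreserving S.θ m m)
    (hS : ∀ ω, ∀ x ∉ S.G.Istar, S.T ω x = 0) :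
    (m ⊗ₘ ν) (juliaGraph S.G S.θ T \ critBackGraph S.G S.θ T) = 1 := by
  -- The graph of the regular points is measurable and contained in the set in question, whose own
  -- measurability is not needed.
  refine le_antisymm prob_le_one (le_trans (le_of_eq ?_) (measure_mono hR.regGraph_subset))
  rw [Measure.compProd_apply (hR.measurableSet_regGraph hθ.measurable hS)]
  have h1 : ∀ᵐ ω ∂m, ν ω (Prod.mk ω ⁻¹' {p : Ω × ℝ | p.2 ∈ S.reg p.1}) = 1 := by
    filter_upwards [h.ae_fibreConf hθ] with ω hω
    have := hR.measure_compl_reg (fun _ => inferInstance) hω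
    rwa [prob_compl_eq_zero_iff (S.measurableSet_reg ω)] at this
  rw [lintegral_congr_ae h1]
  simp

end IsConformal
end CritFinite
end

theorem mainTheorem2 {ι Ω : Type*} [Finite ι] [MeasurableSpace Ω]
    (m : Measure Ω) [IsProbabilityMeasure m] (θ : Ω ≃ᵐ Ω) (hθ : Ergodic θ m)
    (G : CritFinite.IntervalFamily ι) (κ A : ℝ) (T : Ω → ℝ → ℝ)
    (hT : CritFinite.IsRandomMap G T κ A) (t : ℝ) (ht : 0 < t)
    (ν₁ ν₂ : Kernel Ω ℝ) [IsMarkovKernel ν₁] [IsMarkovKernel ν₂] (lam₁ lam₂ : Ω → ℝ)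
    (h₁ : CritFinite.IsConformal G θ T m t ν₁ lam₁)
    (h₂ : CritFinite.IsConformal G θ T m t ν₂ lam₂) :
    -- (a) full measure off the backward orbits of the critical points
    ((m ⊗ₘ ν₁) (CritFinite.juliaGraph G θ T \ CritFinite.critBackGraph G θ T) = 1 ∧
      (m ⊗ₘ ν₂) (CritFinite.juliaGraph G θ T \ CritFinite.critBackGraph G θ T) = 1) ∧
    -- (b) equivalence, globally and fiberwise
    ((m ⊗ₘ ν₁ ≪ m ⊗ₘ ν₂ ∧ m ⊗ₘ ν₂ ≪ m ⊗ₘ ν₁) ∧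
      ∀ᵐ ω ∂m, ν₁ ω ≪ ν₂ ω ∧ ν₂ ω ≪ ν₁ ω) ∧
    -- (c) the ratio of the eigenvalue products converges in `(0,∞)` along a subsequence
    (∀ᵐ ω ∂m, ∃ n : ℕ → ℕ, StrictMono n ∧ ∃ L : ℝ, 0 < L ∧
      Tendsto (fun k => CritFinite.cocycle θ lam₁ (n k) ω / CritFinite.cocycle θ lam₂ (n k) ω)
        atTop (𝓝 L)) ∧
    -- (d) the expected pressure is a well-defined number that does not depend on the measure
    (Integrable (fun ω => Real.log (lam₁ ω)) m ∧ Integrable (fun ω => Real.log (lam₂ ω)) m ∧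
      ∫ ω, Real.log (lam₁ ω) ∂m = ∫ ω, Real.log (lam₂ ω) ∂m) := by
  obtain ⟨S, rfl, hSθ, rfl, hR, hS⟩ := hT.exists_system θ ht
  rw [← hSθ] at h₁ h₂ hθ ⊢
  have hmp := hθ.toMeasurePreserving
  have c₁ := h₁.aeConf hR hmp
  have c₂ := h₂.aeConf hR hmp
  have hd : ∀ x ∈ S.G.cell S.G.i0, Measurable fun ω => S.d ω S.G.i0 x :=
    fun x hx => hR.measurable_d_zero hx
  -- The situation is symmetric in the two families, so equivalence and equality of the pressures
  -- follow from the one-sided statements.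
  have a₁ := c₁.ae_absolutelyContinuous c₂ hθ hd
  have a₂ := c₂.ae_absolutelyContinuous c₁ hθ hd
  exact ⟨⟨h₁.compProd_diff_eq_one hR hmp hS, h₂.compProd_diff_eq_one hR hmp hS⟩,
    ⟨⟨Measure.AbsolutelyContinuous.compProd_right a₁,
      Measure.AbsolutelyContinuous.compProd_right a₂⟩, a₁.and a₂⟩,
    c₁.ae_exists_subseq_tendsto c₂ hθ hd, c₁.integrable_log, c₂.integrable_log,
    le_antisymm (c₁.integral_log_le c₂ hθ hd) (c₂.integral_log_le c₁ hθ hd)⟩
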